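/- Let $k$ be a field, let $H$ be a Hopf algebra over $k$ with antipode $S$, let $A$ be a right $H$-comodule algebra with coaction $a\mapsto a_{(0)}\otimes a_{(1)}$, and let $C$ be a right $H$-module coalgebra with comultiplication $\Delta$ and counit $\varepsilon$ (so $\Delta(c\cdot h)=c_{(1)}\cdot h_{(1)}\otimes c_{(2)}\cdot h_{(2)}$ and $\varepsilon(c\cdot h)=\varepsilon(c)\varepsilon(h)$). In particular this covers every quotient coalgebra-Galois extension $B\subseteq A$ with $C=H/I$, $I\subseteq H$ a coideal right ideal. Unadorned tensor products are over $k$, and numerical subscripts in parentheses denote iterated coactions and comultiplications. **Source.** $A\otimes C$ is an $A$-coring with $a'(a\otimes c)=a'a\otimes c$, $(a\otimes c)a'=aa'_{(0)}\otimes c\cdot a'_{(1)}$, comultiplication $\Delta(a\otimes c)=(a\otimes c_{(1)})\otimes_A(1\otimes c_{(2)})$ and counit $\varepsilon(a\otimes c)=a\,\varepsilon(c)$. Let $A^e=A\otimes A^{op}$ and $$X_n=\big((A\otimes C)^{\otimes_A(n+1)}\big)\otimes_{A^e}A ,\qquad a''xa'\otimes_{A^e} b=x\otimes_{A^e}a'ba''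 .$$ For $x_i\in A\otimes C$ the face $\delta_i$ replaces $x_i$ by $\varepsilon(x_i)$ (the resulting element of $A$ being absorbed by a neighbouring factor), the degeneracy $\sigma_j$ replaces $x_j$ by $\Delta(x_j)$, and $$\tau\big((x_0\otimes_A\cdots\otimes_A x_n)\otimes_{A^e} b\big)=(x_nb\otimes_A x_0\otimes_A\cdots\otimes_A x_{n-1})\otimes_{A^e}1 .$$ **Target.** Let $$M=(H\otimes A)\big/\big\langle h a'_{(1)}\otimes a a'_{(0)}-h\otimes a'a\;:\;h\in H,\ a,a'\in A\big\rangle ,$$ with left action $h'\cdot[h\otimes a]=[h'h\otimes a]$ and right coaction $m\mapsto m_{(0)}\otimes m_{(1)}$ given by $[h\otimes a]\mapsto[h_{(2)}\otimes a_{(0)}]\otimes h_{(3)}a_{(1)}S(h_{(1)})$. Let $Y_n=C^{\otimes(n+1)}\otimes_H M$, where $H$ acts diagonally on $C^{\otimes (n+1)}$ from the right, with operators $$d_i\big((c^0\otimes\cdots\otimes c^n)\otimes_H m\big)=\varepsilon(c^i)\,(c^0\otimes\cdots\widehat{c^i}\cdots\otimes c^n)\otimes_H m,$$ $$s_j\big((c^0\otimes\cdots\otimes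 c^n)\otimes_H m\big)=(c^0\otimes\cdots\otimes\Delta(c^j)\otimes\cdots\otimes c^n)\otimes_H m,$$ $$t\big((c^0\otimes\cdots\otimes c^n)\otimes_H m\big)=(c^n\cdot m_{(1)}\otimes c^0\otimes\cdots\otimes c^{n-1})\otimes_H m_{(0)} .$$ **Theorem.** With these (well-defined) operators $X_\bullet$ and $Y_\bullet$ are cyclic $k$-modules, and there are $k$-linear isomorphisms $\Phi_n:X_n\to Y_n$, $n\ge0$, commuting with all faces, degeneracies and cyclic operators, such that $$\Phi_n\Big(\big((a^0\otimes c^0)\otimes_A\cdots\otimes_A(a^n\otimes c^n)\big)\otimes_{A^e}1\Big)=\big(c^0\cdot a^1_{(1)}\cdots a^n_{(1)}\otimes c^1\cdot a^2_{(2)}\cdots a^n_{(2)}\otimes\cdots\otimes c^{n-1}\cdot a^n_{(n)}\otimes c^n\big)\otimes_H\big[1\otimes a^0a^1_{(0)}\cdots a^n_{(0)}\big].$$ If moreover $S$ is bijective, then $\Psi_n=\Phi_n^{-1}$ is given by $$\Psi_n\big((c^0\otimes\cdots\otimes c^n)\otimes_H[h\otimes a]\big)=\Big(\big(1\otimes c^0\cdot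 h_{(1)}S^{-1}(a_{(n+1)})\big)\otimes_A\big(1\otimes c^1\cdot h_{(2)}S^{-1}(a_{(n)})\big)\otimes_A\cdots\otimes_A\big(1\otimes c^n\cdot h_{(n+1)}S^{-1}(a_{(1)})\big)\Big)\otimes_{A^e}a_{(0)} .$$ -/

import Mathlib

open scoped TensorProduct

noncomputable section

namespace HopfCyclic

set_option linter.unusedSectionVars false

section TensorPowers

variable {k V X : Type*} [CommRing k] [AddCommGroup V] [Module k V] [AddCommGroup X] [Module k X]
  {n : ℕ}

/-- `x₀ ⊗ ⋯ ⊗ xₙ ↦ xᵢ ⊗ (x₀ ⊗ ⋯ x̂ᵢ ⋯ ⊗ xₙ)`. -/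
def removeAt (i : Fin (n + 1)) : ⨂[k]^(n + 1) V →ₗ[k] V ⊗[k] (⨂[k]^n V) :=
  PiTensorProduct.lift (LinearMap.uncurryMid (M := fun _ => V) i
    (PiTensorProduct.lift.symm.toLinearMap ∘ₗ TensorProduct.mk k V (⨂[k]^n V)))

/-- `v ⊗ (y₀ ⊗ ⋯ ⊗ yₙ₋₁) ↦ y₀ ⊗ ⋯ ⊗ v ⊗ ⋯ ⊗ yₙ₋₁`, with `v` in position `i` of the result. -/
def insertAt (i : Fin (n + 1)) : V ⊗[k] (⨂[k]^n V) →ₗ[k] ⨂[k]^(n + 1) V :=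
  TensorProduct.lift (PiTensorProduct.lift.toLinearMap ∘ₗ
    (PiTensorProduct.tprod k (s := fun _ : Fin (n + 1) => V)).curryMid i)

/-- A linear endomorphism of `V` applied to the `i`-th tensor factor. -/
def opAt (i : Fin n) : (V →ₗ[k] V) →ₗ[k] (⨂[k]^n V →ₗ[k] ⨂[k]^n V) :=
  (PiTensorProduct.mapMultilinear k (fun _ : Fin n => V) (fun _ => V)).toLinearMap
    (fun _ => LinearMap.id) i

@[simp] lemma removeAt_tprod (i : Fin (n + 1)) (x : Fin (n + 1) → V) :
    removeAt (k := k) i (PiTensorProduct.tprod k x) =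
      x i ⊗ₜ[k] PiTensorProduct.tprod k (i.removeNth x) := by
  simp [removeAt]

@[simp] lemma insertAt_tmul (i : Fin (n + 1)) (v : V) (y : Fin n → V) :
    insertAt (k := k) i (v ⊗ₜ[k] PiTensorProduct.tprod k y) =
      PiTensorProduct.tprod k (i.insertNth (α := fun _ => V) v y) := by
  simp [insertAt]

@[simp] lemma opAt_tprod (i : Fin n) (f : V →ₗ[k] V) (x : Fin n → V) :
    opAt i f (PiTensorProduct.tprod k x) =
      PiTensorProduct.tprod k (Function.update x i (f (x i))) := by
  simp only [opAt, MultilinearMap.toLinearMap_apply, PiTensorProduct.mapMultilinear_apply,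
    PiTensorProduct.map_tprod]
  congr 1
  ext j
  rcases eq_or_ne j i with rfl | h <;> simp [*]

/-- `v ⊗ w ⊗ (y₀ ⊗ ⋯ ⊗ yₙ₋₁) ↦ y₀ ⊗ ⋯ ⊗ v ⊗ w ⊗ ⋯ ⊗ yₙ₋₁`, with `v`, `w` in positions
`i`, `i + 1`. -/
def insertPairAt (i : Fin (n + 1)) : (V ⊗[k] V) ⊗[k] (⨂[k]^n V) →ₗ[k] ⨂[k]^(n + 2) V :=
  insertAt i.castSucc ∘ₗ (insertAt i).lTensor V ∘ₗ (TensorProduct.assoc k V V (⨂[k]^n V)).toLinearMap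

/-- `x₀ ⊗ ⋯ ⊗ xₙ ↦ x₀ ⊗ ⋯ ⊗ Δ(xᵢ) ⊗ ⋯ ⊗ xₙ`. -/
def dupAt (Δ : V →ₗ[k] V ⊗[k] V) (i : Fin (n + 1)) : ⨂[k]^(n + 1) V →ₗ[k] ⨂[k]^(n + 2) V :=
  insertPairAt i ∘ₗ Δ.rTensor (⨂[k]^n V) ∘ₗ removeAt i

/-- `x₀ ⊗ ⋯ ⊗ xₙ ↦ xₙ ⊗ x₀ ⊗ ⋯ ⊗ xₙ₋₁`. -/
def rotate (k V : Type*) [CommRing k] [AddCommGroup V] [Module k V] (n : ℕ) :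
    ⨂[k]^(n + 1) V →ₗ[k] ⨂[k]^(n + 1) V :=
  insertAt 0 ∘ₗ removeAt (Fin.last n)

/-- `x₀ ⊗ ⋯ ⊗ xₙ ↦ f(xₙ) ⊗ x₀ ⊗ ⋯ ⊗ xₙ₋₁`, for an endomorphism `f` taken from a linear family. -/
def rotateBy (f : X →ₗ[k] V →ₗ[k] V) (n : ℕ) :
    X →ₗ[k] ⨂[k]^(n + 1) V →ₗ[k] ⨂[k]^(n + 1) V :=
  LinearMap.lcomp k _ (rotate k V n) ∘ₗ opAt 0 ∘ₗ f

lemma opAt_comp_apply (i : Fin n) (f g : V →ₗ[k] V) (w : ⨂[k]^n V) :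
    opAt i f (opAt i g w) = opAt i (f ∘ₗ g) w := by
  induction w using PiTensorProduct.induction_on with
  | smul_tprod r x => simp
  | add a b ha hb => simp [ha, hb]

lemma opAt_comm_apply {i j : Fin n} (h : i ≠ j) (f g : V →ₗ[k] V) (w : ⨂[k]^n V) :
    opAt i f (opAt j g w) = opAt j g (opAt i f w) := by
  induction w using PiTensorProduct.induction_on with
  | smul_tprod r x => simp [h, h.symm, Function.update_comm h]
  | add a b ha hb => simp [ha, hb]

lemma removeAt_opAt_self (i : Fin (n + 1)) (f : V →ₗ[k] V) (w : ⨂[k]^(n + 1) V) :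
    removeAt i (opAt i f w) = f.rTensor (⨂[k]^n V) (removeAt i w) := by
  induction w using PiTensorProduct.induction_on with
  | smul_tprod r x => simp
  | add a b ha hb => simp [ha, hb]

lemma removeAt_opAt_succAbove (i : Fin (n + 1)) (j : Fin n) (f : V →ₗ[k] V)
    (w : ⨂[k]^(n + 1) V) :
    removeAt i (opAt (i.succAbove j) f w) = (opAt j f).lTensor V (removeAt i w) := by
  induction w using PiTensorProduct.induction_on with
  | smul_tprod r x => simp [Fin.removeNth_update_succAbove]; rfl
  | add a b ha hb => simp [ha, hb]

lemma insertAt_rTensor (i : Fin (n + 1)) (f : V →ₗ[k] V) (z : V ⊗[k] (⨂[k]^n V)) :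
    insertAt i (f.rTensor (⨂[k]^n V) z) = opAt i f (insertAt i z) := by
  induction z using TensorProduct.induction_on with
  | zero => simp
  | add a b ha hb => simp [ha, hb]
  | tmul v w =>
    induction w using PiTensorProduct.induction_on with
    | smul_tprod r x => simp
    | add a b ha hb => simp_all [TensorProduct.tmul_add]

lemma insertAt_lTensor (i : Fin (n + 1)) (j : Fin n) (f : V →ₗ[k] V)
    (z : V ⊗[k] (⨂[k]^n V)) :
    insertAt i ((opAt j f).lTensor V z) = opAt (i.succAbove j) f (insertAt i z) := by
  induction z using TensorProduct.induction_on with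
  | zero => simp
  | add a b ha hb => simp [ha, hb]
  | tmul v w =>
    induction w using PiTensorProduct.induction_on with
    | smul_tprod r x => simp
    | add a b ha hb => simp_all [TensorProduct.tmul_add]

lemma insertAt_removeAt (i : Fin (n + 1)) (w : ⨂[k]^(n + 1) V) :
    insertAt i (removeAt i w) = w := by
  induction w using PiTensorProduct.induction_on with
  | smul_tprod r x => simp
  | add a b ha hb => simp [ha, hb]

lemma removeAt_insertAt (i : Fin (n + 1)) (z : V ⊗[k] (⨂[k]^n V)) :
    removeAt i (insertAt i z) = z := by
  induction z using TensorProduct.induction_on with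
  | zero => simp
  | add a b ha hb => simp [ha, hb]
  | tmul v w =>
    induction w using PiTensorProduct.induction_on with
    | smul_tprod r x => simp
    | add a b ha hb => simp_all [TensorProduct.tmul_add]

lemma insertAt_induction (i : Fin (n + 1)) {P : ⨂[k]^(n + 1) V → Prop}
    (h0 : P 0) (hadd : ∀ a b, P a → P b → P (a + b))
    (h : ∀ v y, P (insertAt i (v ⊗ₜ y))) (w : ⨂[k]^(n + 1) V) : P w := by
  rw [← insertAt_removeAt i w]
  generalize removeAt i w = z
  induction z using TensorProduct.induction_on with
  | zero => simpa using h0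
  | add a b ha hb => simpa using hadd _ _ ha hb
  | tmul v w => exact h v w

lemma opAt_insertAt_self (i : Fin (n + 1)) (f : V →ₗ[k] V) (v : V) (y : ⨂[k]^n V) :
    opAt i f (insertAt i (v ⊗ₜ y)) = insertAt i (f v ⊗ₜ y) := by
  rw [← insertAt_rTensor, LinearMap.rTensor_tmul]

lemma opAt_insertAt (i : Fin (n + 1)) (j : Fin n) (f : V →ₗ[k] V) (v : V) (y : ⨂[k]^n V) :
    opAt (i.succAbove j) f (insertAt i (v ⊗ₜ y)) = insertAt i (v ⊗ₜ opAt j f y) := by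
  rw [← insertAt_lTensor, LinearMap.lTensor_tmul]

lemma rotate_opAt_castSucc (i : Fin n) (f : V →ₗ[k] V) (w : ⨂[k]^(n + 1) V) :
    rotate k V n (opAt i.castSucc f w) = opAt i.succ f (rotate k V n w) := by
  have := removeAt_opAt_succAbove (Fin.last n) i f w
  rw [Fin.succAbove_last] at this
  simp only [rotate, LinearMap.comp_apply, this, insertAt_lTensor, Fin.zero_succAbove]

lemma rotate_opAt_last (f : V →ₗ[k] V) (w : ⨂[k]^(n + 1) V) :
    rotate k V n (opAt (Fin.last n) f w) = opAt 0 f (rotate k V n w) := by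
  simp only [rotate, LinearMap.comp_apply, removeAt_opAt_self, insertAt_rTensor]

lemma rotateBy_apply (f : X →ₗ[k] V →ₗ[k] V) (x : X) (w : ⨂[k]^(n + 1) V) :
    rotateBy f n x w = opAt 0 (f x) (rotate k V n w) := rfl

lemma dupAt_insertAt (Δ : V →ₗ[k] V ⊗[k] V) (i : Fin (n + 1)) (v : V) (y : ⨂[k]^n V) :
    dupAt Δ i (insertAt i (v ⊗ₜ y)) = insertPairAt i (Δ v ⊗ₜ y) := by
  simp only [dupAt, LinearMap.comp_apply, removeAt_insertAt, LinearMap.rTensor_tmul]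

lemma insertPairAt_rTensor (i : Fin (n + 1)) (f : V →ₗ[k] V) (z : V ⊗[k] V) (y : ⨂[k]^n V) :
    insertPairAt i (f.rTensor V z ⊗ₜ y) = opAt i.castSucc f (insertPairAt i (z ⊗ₜ y)) := by
  induction z using TensorProduct.induction_on with
  | zero => simp
  | add a b ha hb => simp_all [TensorProduct.add_tmul]
  | tmul v w => simp [insertPairAt, opAt_insertAt_self]

lemma insertPairAt_lTensor (i : Fin (n + 1)) (f : V →ₗ[k] V) (z : V ⊗[k] V) (y : ⨂[k]^n V) :
    insertPairAt i (f.lTensor V z ⊗ₜ y) = opAt i.succ f (insertPairAt i (z ⊗ₜ y)) := by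
  have e : i.succ = i.castSucc.succAbove i := by simp
  induction z using TensorProduct.induction_on with
  | zero => simp
  | add a b ha hb => simp_all [TensorProduct.add_tmul]
  | tmul v w => simp [insertPairAt, e, -Fin.succAbove_castSucc_self, opAt_insertAt, opAt_insertAt_self]

lemma insertPairAt_opAt (i : Fin (n + 1)) (j : Fin n) (f : V →ₗ[k] V) (z : V ⊗[k] V)
    (y : ⨂[k]^n V) :
    insertPairAt i (z ⊗ₜ opAt j f y) =
      opAt (i.castSucc.succAbove (i.succAbove j)) f (insertPairAt i (z ⊗ₜ y)) := by
  induction z using TensorProduct.induction_on with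
  | zero => simp
  | add a b ha hb => simp_all [TensorProduct.add_tmul]
  | tmul v w => simp [insertPairAt, opAt_insertAt]

end TensorPowers

section Structures

/-- A right comodule algebra over a Hopf algebra `H`: an algebra `A` with a coassociative, counital
right coaction `A → A ⊗ H`, `a ↦ a₍₀₎ ⊗ a₍₁₎`, that is an algebra map. -/
class RightComoduleAlgebra (k H A : Type*) [CommRing k] [Ring H] [HopfAlgebra k H] [Ring A]
    [Algebra k A] where
  coact : A →ₐ[k] A ⊗[k] H
  coassoc : (TensorProduct.assoc k A H H).toLinearMap ∘ₗ coact.toLinearMap.rTensor H ∘ₗ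
      coact.toLinearMap = (Coalgebra.comul (R := k) (A := H)).lTensor A ∘ₗ coact.toLinearMap
  counit_coact : (TensorProduct.rid k A).toLinearMap ∘ₗ
      (Coalgebra.counit (R := k) (A := H)).lTensor A ∘ₗ coact.toLinearMap = LinearMap.id

/-- A right module coalgebra over a Hopf algebra `H`: a coalgebra `C` with a right action
`act c h = c · h` such that `ε(c · h) = ε(c) ε(h)` and `Δ(c · h) = c₍₁₎ · h₍₁₎ ⊗ c₍₂₎ · h₍₂₎`. -/
class RightModuleCoalgebra (k H C : Type*) [CommRing k] [Ring H] [HopfAlgebra k H]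
    [AddCommGroup C] [Module k C] [Coalgebra k C] where
  act : C →ₗ[k] H →ₗ[k] C
  act_one : ∀ c : C, act c 1 = c
  act_mul : ∀ (c : C) (g h : H), act c (g * h) = act (act c g) h
  counit_act : ∀ (c : C) (h : H), Coalgebra.counit (R := k) (act c h) =
    Coalgebra.counit (R := k) c * Coalgebra.counit (R := k) h
  comul_act : ∀ (c : C) (h : H), Coalgebra.comul (R := k) (act c h) =
    TensorProduct.map₂ act act (Coalgebra.comul (R := k) c) (Coalgebra.comul (R := k) h)

end Structures

section GaloisCoring

variable (k H A C : Type*) [CommRing k] [Ring H] [HopfAlgebra k H] [Ring A] [Algebra k A]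
  [RightComoduleAlgebra k H A] [AddCommGroup C] [Module k C] [Coalgebra k C]
  [RightModuleCoalgebra k H C]

/-- The coaction `a ↦ a₍₀₎ ⊗ a₍₁₎` as a linear map. -/
def coact : A →ₗ[k] A ⊗[k] H := (RightComoduleAlgebra.coact (k := k) (H := H) (A := A)).toLinearMap

/-- The left action on the Galois coring, `a' (a ⊗ c) = a' a ⊗ c`. -/
def leftAct : A →ₗ[k] (A ⊗[k] C) →ₗ[k] (A ⊗[k] C) :=
  LinearMap.rTensorHom C ∘ₗ LinearMap.mul k A

/-- The right action on the Galois coring, `(a ⊗ c) a' = a a'₍₀₎ ⊗ c · a'₍₁₎`. -/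
def rightAct : A →ₗ[k] (A ⊗[k] C) →ₗ[k] (A ⊗[k] C) :=
  (TensorProduct.map₂ (LinearMap.mul k A) (RightModuleCoalgebra.act (k := k) (H := H))).flip ∘ₗ
    coact k H A

/-- The counit of the Galois coring, `a ⊗ c ↦ a ε(c)`. -/
def coringCounit : A ⊗[k] C →ₗ[k] A :=
  (TensorProduct.rid k A).toLinearMap ∘ₗ (Coalgebra.counit (R := k) (A := C)).lTensor A

/-- The comultiplication of the Galois coring, `a ⊗ c ↦ (a ⊗ c₍₁₎) ⊗ (1 ⊗ c₍₂₎)`, as a map to the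
tensor product over `k`; the comultiplication is its composite with the projection to the tensor
product over `A`. -/
def coringComul : A ⊗[k] C →ₗ[k] (A ⊗[k] C) ⊗[k] (A ⊗[k] C) :=
  (TensorProduct.mk k A C 1).lTensor (A ⊗[k] C) ∘ₗ
    (TensorProduct.assoc k A C C).symm.toLinearMap ∘ₗ (Coalgebra.comul (R := k) (A := C)).lTensor A

section lemmas
variable {k H A C}

lemma coact_mul (a b : A) : coact k H A (a * b) = coact k H A a * coact k H A b :=
  map_mul (RightComoduleAlgebra.coact (k := k) (H := H) (A := A)) a b

lemma coact_one : coact k H A 1 = 1 :=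
  map_one (RightComoduleAlgebra.coact (k := k) (H := H) (A := A))

lemma coact_coassoc (a : A) :
    (TensorProduct.assoc k A H H) ((coact k H A).rTensor H (coact k H A a)) =
      (Coalgebra.comul (R := k) (A := H)).lTensor A (coact k H A a) :=
  LinearMap.congr_fun (RightComoduleAlgebra.coassoc (k := k) (H := H) (A := A)) a

lemma coact_counit (a : A) :
    TensorProduct.rid k A ((Coalgebra.counit (R := k) (A := H)).lTensor A (coact k H A a)) = a :=
  LinearMap.congr_fun (RightComoduleAlgebra.counit_coact (k := k) (H := H) (A := A)) a

@[simp] lemma leftAct_tmul (a b : A) (c : C) : leftAct k A C a (b ⊗ₜ c) = (a * b) ⊗ₜ c := rfl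

lemma rightAct_apply (a : A) (z : A ⊗[k] C) : rightAct k H A C a z =
    TensorProduct.map₂ (LinearMap.mul k A) (RightModuleCoalgebra.act (k := k) (H := H)) z
      (coact k H A a) := rfl

lemma rightAct_tmul (a b : A) (c : C) : rightAct k H A C a (b ⊗ₜ c) =
    TensorProduct.map (LinearMap.mulLeft k b) (RightModuleCoalgebra.act (k := k) (H := H) c)
      (coact k H A a) := rfl

@[simp] lemma coringCounit_tmul (a : A) (c : C) :
    coringCounit k A C (a ⊗ₜ c) = Coalgebra.counit (R := k) c • a := rfl

lemma leftAct_mul (a b : A) : leftAct k A C (a * b) = leftAct k A C a ∘ₗ leftAct k A C b := by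
  ext; simp [mul_assoc]

lemma leftAct_one : leftAct k A C 1 = LinearMap.id := by
  ext; simp

lemma rightAct_one : rightAct k H A C 1 = LinearMap.id := by
  ext b c
  simp [rightAct_tmul, coact_one, Algebra.TensorProduct.one_def, RightModuleCoalgebra.act_one]

lemma rightAct_mul (a b : A) :
    rightAct k H A C (a * b) = rightAct k H A C b ∘ₗ rightAct k H A C a := by
  ext x c
  simp only [TensorProduct.AlgebraTensorModule.curry_apply, LinearMap.restrictScalars_self,
    TensorProduct.curry_apply, LinearMap.comp_apply, rightAct_tmul, coact_mul]
  generalize coact k H A a = p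
  rw [rightAct_apply]
  generalize coact k H A b = q
  induction p using TensorProduct.induction_on with
  | zero => simp
  | add p p' h h' => simp only [add_mul, map_add, h, h', LinearMap.add_apply]
  | tmul a g =>
    induction q using TensorProduct.induction_on with
    | zero => simp
    | add p p' h h' => simp only [mul_add, map_add, h, h']
    | tmul a' g' => simp [RightModuleCoalgebra.act_mul, mul_assoc]

lemma left_right_comm (a b : A) :
    leftAct k A C a ∘ₗ rightAct k H A C b = rightAct k H A C b ∘ₗ leftAct k A C a := by
  ext x c
  simp only [TensorProduct.AlgebraTensorModule.curry_apply, LinearMap.restrictScalars_self,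
    TensorProduct.curry_apply, LinearMap.comp_apply, rightAct_tmul, leftAct_tmul]
  generalize coact k H A b = q
  induction q using TensorProduct.induction_on with
  | zero => simp
  | add p p' h h' => simp only [map_add, h, h']
  | tmul a' g' => simp

lemma counit_leftAct (a : A) (z : A ⊗[k] C) :
    coringCounit k A C (leftAct k A C a z) = a * coringCounit k A C z := by
  induction z using TensorProduct.induction_on with
  | zero => simp
  | add p p' h h' => simp only [map_add, h, h', mul_add]
  | tmul a' g' => simp

lemma counit_rightAct (a : A) (z : A ⊗[k] C) :
    coringCounit k A C (rightAct k H A C a z) = coringCounit k A C z * a := by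
  induction z using TensorProduct.induction_on with
  | zero => simp
  | add p p' h h' => simp only [map_add, h, h', add_mul]
  | tmul b c =>
    rw [rightAct_tmul]
    conv_rhs => rw [← coact_counit (k := k) (H := H) a]
    generalize coact k H A a = q
    induction q using TensorProduct.induction_on with
    | zero => simp
    | add p p' h h' => simp only [map_add, h, h', mul_add]
    | tmul a' g' =>
      simp only [TensorProduct.map_tmul, LinearMap.mulLeft_apply, coringCounit_tmul,
        RightModuleCoalgebra.counit_act, mul_smul, LinearMap.lTensor_tmul,
        TensorProduct.rid_tmul, mul_smul_comm, smul_mul_assoc]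
      rw [smul_comm]

lemma comul_leftAct (a : A) (z : A ⊗[k] C) :
    coringComul k A C (leftAct k A C a z) = (leftAct k A C a).rTensor _ (coringComul k A C z) := by
  induction z using TensorProduct.induction_on with
  | zero => simp
  | add p p' h h' => simp only [map_add, h, h']
  | tmul b c =>
    simp only [coringComul, leftAct_tmul, LinearMap.comp_apply, LinearMap.lTensor_tmul]
    generalize Coalgebra.comul (R := k) c = q
    induction q using TensorProduct.induction_on with
    | zero => simp
    | add p p' h h' => simp only [map_add, h, h', TensorProduct.tmul_add]
    | tmul a' g' => simp

/-- The comultiplication is right linear modulo the relations of the tensor product over `A`. -/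
lemma comul_rightAct {X : Type*} [AddCommGroup X] [Module k X]
    (G : (A ⊗[k] C) ⊗[k] (A ⊗[k] C) →ₗ[k] X)
    (hG : ∀ a z, G ((rightAct k H A C a).rTensor _ z) = G ((leftAct k A C a).lTensor _ z))
    (a : A) (z : A ⊗[k] C) :
    G (coringComul k A C (rightAct k H A C a z)) =
      G ((rightAct k H A C a).lTensor _ (coringComul k A C z)) := by
  induction z using TensorProduct.induction_on with
  | zero => simp
  | add p p' h h' => simp only [map_add, h, h']
  | tmul b c =>
    have key : ∀ (z : C ⊗[k] C) (q : A ⊗[k] H), 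
        G ((TensorProduct.mk k A C 1).lTensor (A ⊗[k] C) ((TensorProduct.assoc k A C C).symm
          (TensorProduct.map (LinearMap.mulLeft k b) 
            (TensorProduct.map₂ (RightModuleCoalgebra.act (k := k) (H := H))
              (RightModuleCoalgebra.act (k := k) (H := H)) z)
            ((TensorProduct.assoc k A H H) ((coact k H A).rTensor H q))))) =
        G (TensorProduct.map LinearMap.id (TensorProduct.map₂ (LinearMap.mul k A) (RightModuleCoalgebra.act (k := k) (H := H)) |>.flip q) ((TensorProduct.mk k A C 1).lTensor (A ⊗[k] C) ((TensorProduct.assoc k A C C).symm (b ⊗ₜ z)))) := by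
      intro z q
      induction z using TensorProduct.induction_on with
      | zero => simp
      | add p p' h h' =>
        simp only [map_add, TensorProduct.map_add_right, LinearMap.add_apply,
          TensorProduct.tmul_add, h, h']
      | tmul c₁ c₂ =>
        induction q using TensorProduct.induction_on with
        | zero => simp
        | add p p' h h' =>
          simp only [map_add, TensorProduct.map_add_right, LinearMap.add_apply, h, h']
        | tmul a' g =>
          have := hG a' ((b ⊗ₜ c₁) ⊗ₜ (1 ⊗ₜ RightModuleCoalgebra.act (k := k) c₂ g))
          simp only [LinearMap.rTensor_tmul, LinearMap.lTensor_tmul, leftAct_tmul, rightAct_tmul,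
            mul_one] at this
          simp only [LinearMap.rTensor_tmul, TensorProduct.map₂_apply_tmul,
            TensorProduct.assoc_symm_tmul, LinearMap.lTensor_tmul, TensorProduct.mk_apply,
            TensorProduct.map_tmul, LinearMap.id_apply, LinearMap.flip_apply,
            LinearMap.mul_apply', one_mul]
          rw [← this]
          congr 1
          generalize coact k H A a' = r
          induction r using TensorProduct.induction_on with
          | zero => simp
          | add p p' h h' => simp only [map_add, TensorProduct.add_tmul, h, h']
          | tmul a' g => simp
    have := key (Coalgebra.comul (R := k) c) (coact k H A a)
    rw [coact_coassoc] at this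
    refine Eq.trans ?_ this
    rw [rightAct_tmul]
    congr 1
    simp only [coringComul, LinearMap.comp_apply]
    simp only [LinearEquiv.coe_coe]
    congr 2
    generalize coact k H A a = q
    induction q using TensorProduct.induction_on with
    | zero => simp
    | add p p' h h' => simp only [map_add, h, h']
    | tmul a' g => simp [RightModuleCoalgebra.comul_act]

end lemmas
end GaloisCoring

section Source

/-- An `A`-coring `V` with a chosen lift of its comultiplication: an `A`-bimodule with a bilinear
counit `ε : V → A` and a bilinear comultiplication `V → V ⊗_A V`, the latter being the composite of a
coassociative left `A`-linear map `comul : V → V ⊗ V` with the projection to `V ⊗_A V`. The condition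
`comul_right` says that this composite is right `A`-linear; it need not hold for `comul` itself. The
Galois coring, which is the one used here, comes with such a lift. -/
structure Coring (k A V : Type*) [CommRing k] [Ring A] [Algebra k A] [AddCommGroup V]
    [Module k V] where
  left : A →ₗ[k] V →ₗ[k] V
  right : A →ₗ[k] V →ₗ[k] V
  counit : V →ₗ[k] A
  comul : V →ₗ[k] V ⊗[k] V
  left_one : left 1 = LinearMap.id
  left_mul : ∀ a b, left (a * b) = left a ∘ₗ left b
  right_one : right 1 = LinearMap.id
  right_mul : ∀ a b, right (a * b) = right b ∘ₗ right a
  left_right_comm : ∀ a b, left a ∘ₗ right b = right b ∘ₗ left a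
  counit_left : ∀ a v, counit (left a v) = a * counit v
  counit_right : ∀ a v, counit (right a v) = counit v * a
  comul_left : ∀ a v, comul (left a v) = (left a).rTensor V (comul v)
  comul_right : ∀ a v, comul (right a v) - (right a).lTensor V (comul v) ∈
    Submodule.span k {z : V ⊗[k] V | ∃ (b : A) (w : V ⊗[k] V),
      z = (right b).rTensor V w - (left b).lTensor V w}
  coassoc : ∀ v, TensorProduct.assoc k V V V (comul.rTensor V (comul v)) =
    comul.lTensor V (comul v)
  counit_comul_left : ∀ v, TensorProduct.lift (left ∘ₗ counit) (comul v) = v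
  counit_comul_right : ∀ v, TensorProduct.lift (right ∘ₗ counit).flip (comul v) = v

lemma sub_mem_tensorRel {k A V : Type*} [CommRing k] [Ring A] [Algebra k A] [AddCommGroup V]
    [Module k V] (left right : A →ₗ[k] V →ₗ[k] V) (x y : V ⊗[k] V)
    (h : ∀ G : V ⊗[k] V →ₗ[k] (V ⊗[k] V) ⧸ Submodule.span k
        {z : V ⊗[k] V | ∃ (b : A) (w : V ⊗[k] V),
          z = (right b).rTensor V w - (left b).lTensor V w},
      (∀ b z, G ((right b).rTensor V z) = G ((left b).lTensor V z)) → G x = G y) :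
    x - y ∈ Submodule.span k {z : V ⊗[k] V | ∃ (b : A) (w : V ⊗[k] V),
      z = (right b).rTensor V w - (left b).lTensor V w} := by
  rw [← Submodule.Quotient.mk_eq_zero, ← Submodule.mkQ_apply, map_sub, sub_eq_zero]
  refine h _ fun b z => ?_
  rw [← sub_eq_zero, ← map_sub, Submodule.mkQ_apply, Submodule.Quotient.mk_eq_zero]
  exact Submodule.subset_span ⟨b, z, rfl⟩

variable {k A V : Type*} [CommRing k] [Ring A] [Algebra k A] [AddCommGroup V] [Module k V]
  (S : Coring k A V)

/-- The relations `⋯ ⊗ xᵢ a ⊗ xᵢ₊₁ ⊗ ⋯ = ⋯ ⊗ xᵢ ⊗ a xᵢ₊₁ ⊗ ⋯` of the tensor product over `A`. -/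
def balanced (n : ℕ) : Submodule k (⨂[k]^(n + 1) V) :=
  Submodule.span k {z | ∃ (i : Fin n) (a : A) (w : ⨂[k]^(n + 1) V),
    z = opAt i.castSucc (S.right a) w - opAt i.succ (S.left a) w}

/-- The `(n+1)`-fold tensor product `(A ⊗ C) ⊗_A ⋯ ⊗_A (A ⊗ C)`. -/
abbrev CoringPow (n : ℕ) : Type _ := (⨂[k]^(n + 1) V) ⧸ balanced S n

section lemmas
variable {S} {n : ℕ}

lemma mk_balanced (i : Fin n) (a : A) (w : ⨂[k]^(n + 1) V) :
    (balanced S n).mkQ (opAt i.castSucc (S.right a) w) =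
      (balanced S n).mkQ (opAt i.succ (S.left a) w) := by
  rw [← sub_eq_zero, ← map_sub, Submodule.mkQ_apply, Submodule.Quotient.mk_eq_zero]
  exact Submodule.subset_span ⟨i, a, w, rfl⟩

lemma balanced_le_ker {X : Type*} [AddCommGroup X] [Module k X]
    (G : ⨂[k]^(n + 1) V →ₗ[k] X)
    (h : ∀ (i : Fin n) (a : A) (w : ⨂[k]^(n + 1) V),
      G (opAt i.castSucc (S.right a) w) = G (opAt i.succ (S.left a) w)) :
    balanced S n ≤ LinearMap.ker G := by
  refine Submodule.span_le.2 ?_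
  rintro _ ⟨i, a, w, rfl⟩
  simp [h]

lemma opAt_left_right_comm {m : ℕ} (i j : Fin m) (a b : A) (w : ⨂[k]^m V) :
    opAt i (S.left a) (opAt j (S.right b) w) =
      opAt j (S.right b) (opAt i (S.left a) w) := by
  rcases eq_or_ne i j with rfl | h
  · rw [opAt_comp_apply, opAt_comp_apply, S.left_right_comm]
  · rw [opAt_comm_apply h]

end lemmas

/-- The left action of `A` on `(A ⊗ C) ⊗_A ⋯ ⊗_A (A ⊗ C)`, through the first factor. -/
def powLeftAct (n : ℕ) (a : A) : CoringPow S n →ₗ[k] CoringPow S n :=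
  (balanced S n).mapQ (balanced S n) (opAt 0 (S.left a)) <| by
    refine (balanced_le_ker ((balanced S n).mkQ ∘ₗ opAt _ _) fun i b w => ?_).trans_eq
      (by rw [LinearMap.ker_comp, Submodule.ker_mkQ])
    simp only [LinearMap.comp_apply]
    rw [opAt_left_right_comm, mk_balanced, opAt_comm_apply (Fin.succ_ne_zero i)]

/-- The right action of `A` on `(A ⊗ C) ⊗_A ⋯ ⊗_A (A ⊗ C)`, through the last factor. -/
def powRightAct (n : ℕ) (a : A) : CoringPow S n →ₗ[k] CoringPow S n :=
  (balanced S n).mapQ (balanced S n) (opAt (Fin.last n) (S.right a)) <| by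
    refine (balanced_le_ker ((balanced S n).mkQ ∘ₗ opAt _ _) fun i b w => ?_).trans_eq
      (by rw [LinearMap.ker_comp, Submodule.ker_mkQ])
    simp only [LinearMap.comp_apply]
    rw [← opAt_left_right_comm, ← mk_balanced, opAt_comm_apply (Fin.castSucc_lt_last i).ne]

/-- The relations `a'' m a' ⊗ b = m ⊗ a' b a''` of the tensor product over `A ⊗ Aᵒᵖ`. -/
def envelopingRel (n : ℕ) : Submodule k (CoringPow S n ⊗[k] A) :=
  Submodule.span k {z | ∃ (a' a'' : A) (m : CoringPow S n) (b : A),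
    z = powLeftAct S n a'' (powRightAct S n a' m) ⊗ₜ[k] b - m ⊗ₜ[k] (a' * b * a'')}

/-- The module `((A ⊗ C) ⊗_A ⋯ ⊗_A (A ⊗ C)) ⊗_{Aᵉ} A` with `n + 1` factors `A ⊗ C`. -/
abbrev CoringCyclic (n : ℕ) : Type _ := (CoringPow S n ⊗[k] A) ⧸ envelopingRel S n

/-- The class of `(x₀ ⊗_A ⋯ ⊗_A xₙ) ⊗_{Aᵉ} b`. -/
def coringMk (n : ℕ) (w : ⨂[k]^(n + 1) V) (b : A) : CoringCyclic S n :=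
  (envelopingRel S n).mkQ ((balanced S n).mkQ w ⊗ₜ b)

/-- The operator by which `ε(x) ∈ A` acts on the remaining factors once `x` has been removed from
position `i`: it multiplies the next factor from the left, or, if `x` was the last factor, the
preceding one from the right. -/
def absorb (n : ℕ) (i : Fin (n + 2)) :
    V →ₗ[k] ⨂[k]^(n + 1) V →ₗ[k] ⨂[k]^(n + 1) V :=
  Fin.lastCases (motive := fun _ =>
      V →ₗ[k] ⨂[k]^(n + 1) V →ₗ[k] ⨂[k]^(n + 1) V)
    (opAt (Fin.last n) ∘ₗ S.right ∘ₗ S.counit)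
    (fun j => opAt j ∘ₗ S.left ∘ₗ S.counit) i

/-- `x₀ ⊗ ⋯ ⊗ xₙ₊₁ ↦ x₀ ⊗ ⋯ ⊗ ε(xᵢ) ⊗ ⋯ ⊗ xₙ₊₁`. -/
def freeFace (n : ℕ) (i : Fin (n + 2)) :
    ⨂[k]^(n + 2) V →ₗ[k] ⨂[k]^(n + 1) V :=
  TensorProduct.lift (absorb S n i) ∘ₗ removeAt i

section lemmas
variable {S} {n : ℕ}

lemma freeFace_castSucc (j : Fin (n + 1)) (v : V) (y : ⨂[k]^(n + 1) V) :
    freeFace S n j.castSucc (insertAt j.castSucc (v ⊗ₜ y)) =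
      opAt j (S.left (S.counit v)) y := by
  simp only [freeFace, LinearMap.comp_apply, removeAt_insertAt, TensorProduct.lift.tmul, absorb,
    Fin.lastCases_castSucc]

lemma freeFace_last (v : V) (y : ⨂[k]^(n + 1) V) :
    freeFace S n (Fin.last _) (insertAt (Fin.last _) (v ⊗ₜ y)) =
      opAt (Fin.last n) (S.right (S.counit v)) y := by
  simp only [freeFace, LinearMap.comp_apply, removeAt_insertAt, TensorProduct.lift.tmul, absorb,
    Fin.lastCases_last]

lemma face_balanced (i : Fin (n + 2)) (l : Fin (n + 1)) (a : A) (w : ⨂[k]^(n + 2) V) :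
    (balanced S n).mkQ (freeFace S n i (opAt l.castSucc (S.right a) w)) =
      (balanced S n).mkQ (freeFace S n i (opAt l.succ (S.left a) w)) := by
  induction w using insertAt_induction (i := i) with
  | h0 => simp
  | hadd x y hx hy => simp only [map_add, hx, hy]
  | h v y =>
    induction i using Fin.lastCases with
    | last =>
      rw [show l.castSucc = (Fin.last (n + 1)).succAbove l by simp, opAt_insertAt, freeFace_last]
      induction l using Fin.lastCases with
      | last =>
        rw [Fin.succ_last, opAt_insertAt_self, freeFace_last, S.counit_left, S.right_mul,
          opAt_comp_apply]
      | cast l =>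
        rw [Fin.succ_castSucc,
          show l.succ.castSucc = (Fin.last (n + 1)).succAbove l.succ by simp, opAt_insertAt,
          freeFace_last, opAt_comm_apply (Fin.castSucc_lt_last l).ne', mk_balanced,
          opAt_left_right_comm]
    | cast j =>
      rcases lt_trichotomy l j with hlj | rfl | hlj
      · rcases eq_or_lt_of_le (show l.val + 1 ≤ j.val from hlj) with hlj' | hlj'
        · obtain ⟨l', rfl⟩ : ∃ l' : Fin n, l = l'.castSucc :=
            ⟨⟨l, by have := j.2; omega⟩, rfl⟩
          obtain rfl : j = l'.succ := by ext; simp [← hlj']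
          rw [show l'.castSucc.castSucc = l'.succ.castSucc.succAbove l'.castSucc by
              rw [Fin.succAbove_of_castSucc_lt]; simp [Fin.lt_def],
            opAt_insertAt, freeFace_castSucc, Fin.succ_castSucc, opAt_insertAt_self,
            freeFace_castSucc, S.counit_left, S.left_mul, ← opAt_comp_apply,
            opAt_left_right_comm, mk_balanced]
        · obtain ⟨l', rfl⟩ : ∃ l' : Fin n, l = l'.castSucc :=
            ⟨⟨l, by have := j.2; omega⟩, rfl⟩
          simp only [Fin.val_castSucc] at hlj'
          rw [show l'.castSucc.castSucc = j.castSucc.succAbove l'.castSucc by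
              rw [Fin.succAbove_of_castSucc_lt]; simp [Fin.lt_def]; omega,
            show l'.castSucc.succ = j.castSucc.succAbove l'.succ by
              rw [Fin.succAbove_of_castSucc_lt]; · simp
              simp [Fin.lt_def]; omega,
            opAt_insertAt, opAt_insertAt, freeFace_castSucc, freeFace_castSucc,
            opAt_left_right_comm, mk_balanced, opAt_comm_apply]
          simp only [ne_eq, Fin.ext_iff, Fin.val_succ]
          omega
      · rw [opAt_insertAt_self, show l.succ = l.castSucc.succAbove l by simp, opAt_insertAt,
          freeFace_castSucc, freeFace_castSucc, S.counit_right, S.left_mul, opAt_comp_apply]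
      · obtain ⟨l', rfl⟩ : ∃ l' : Fin n, l = l'.succ :=
          ⟨⟨l - 1, by have := l.2; have : j.val < l.val := hlj; omega⟩, by
            ext; have : j.val < l.val := hlj; simp; omega⟩
        have hlj' : j.val < l'.val + 1 := hlj
        rw [show l'.succ.castSucc = j.castSucc.succAbove l'.castSucc by
              rw [Fin.succAbove_of_le_castSucc]; · simp
              simp [Fin.le_def]; omega,
            show l'.succ.succ = j.castSucc.succAbove l'.succ by
              rw [Fin.succAbove_of_le_castSucc]
              simp [Fin.le_def]; omega,
            opAt_insertAt, opAt_insertAt, freeFace_castSucc, freeFace_castSucc,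
            opAt_left_right_comm, mk_balanced, opAt_comm_apply]
        simp only [ne_eq, Fin.ext_iff, Fin.val_succ]
        omega

lemma face_left (i : Fin (n + 2)) (a : A) (w : ⨂[k]^(n + 2) V) :
    freeFace S n i (opAt 0 (S.left a) w) =
      opAt 0 (S.left a) (freeFace S n i w) := by
  induction w using insertAt_induction (i := i) with
  | h0 => simp
  | hadd x y hx hy => simp only [map_add, hx, hy]
  | h v y =>
    induction i using Fin.lastCases with
    | last =>
      rw [show (0 : Fin (n + 2)) = (Fin.last (n + 1)).succAbove 0 by simp, opAt_insertAt,
        freeFace_last, freeFace_last, opAt_left_right_comm]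
    | cast j =>
      rcases eq_or_ne j 0 with rfl | hj
      · rw [show (0 : Fin (n + 2)) = Fin.castSucc 0 by simp, opAt_insertAt_self,
          freeFace_castSucc, freeFace_castSucc, S.counit_left, S.left_mul, opAt_comp_apply]
      · rw [show (0 : Fin (n + 2)) = j.castSucc.succAbove 0 by
            rw [Fin.succAbove_ne_zero_zero]; simpa using hj,
          opAt_insertAt, freeFace_castSucc, freeFace_castSucc, opAt_comm_apply hj]

lemma face_right (i : Fin (n + 2)) (a : A) (w : ⨂[k]^(n + 2) V) :
    freeFace S n i (opAt (Fin.last _) (S.right a) w) =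
      opAt (Fin.last _) (S.right a) (freeFace S n i w) := by
  induction w using insertAt_induction (i := i) with
  | h0 => simp
  | hadd x y hx hy => simp only [map_add, hx, hy]
  | h v y =>
    induction i using Fin.lastCases with
    | last =>
      rw [opAt_insertAt_self, freeFace_last, freeFace_last, S.counit_right, S.right_mul,
        opAt_comp_apply]
    | cast j =>
      rw [show Fin.last (n + 1) = j.castSucc.succAbove (Fin.last n) by
            rw [Fin.succAbove_ne_last_last]; exact (Fin.castSucc_lt_last j).ne,
          opAt_insertAt, freeFace_castSucc, freeFace_castSucc, opAt_left_right_comm]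

lemma coringMk_left (w : ⨂[k]^(n + 1) V) (a b : A) :
    coringMk S n (opAt 0 (S.left a) w) b = coringMk S n w (b * a) := by
  rw [← sub_eq_zero, coringMk, coringMk, ← map_sub, Submodule.mkQ_apply,
    Submodule.Quotient.mk_eq_zero]
  refine Submodule.subset_span ⟨1, a, (balanced S n).mkQ w, b, ?_⟩
  simp only [powLeftAct, powRightAct, Submodule.mkQ_apply, Submodule.mapQ_apply, S.right_one,
    one_mul]
  congr 3
  rw [show opAt (Fin.last n) (LinearMap.id : V →ₗ[k] _) w = w from ?_]
  induction w using PiTensorProduct.induction_on with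
  | smul_tprod r x => simp
  | add a b ha hb => simp [ha, hb]

lemma coringMk_right (w : ⨂[k]^(n + 1) V) (a b : A) :
    coringMk S n (opAt (Fin.last n) (S.right a) w) b =
      coringMk S n w (a * b) := by
  rw [← sub_eq_zero, coringMk, coringMk, ← map_sub, Submodule.mkQ_apply,
    Submodule.Quotient.mk_eq_zero]
  refine Submodule.subset_span ⟨a, 1, (balanced S n).mkQ w, b, ?_⟩
  simp only [powLeftAct, powRightAct, Submodule.mkQ_apply, Submodule.mapQ_apply, S.left_one,
    mul_one]
  congr 3
  generalize opAt (Fin.last n) (S.right a) w = w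
  rw [show opAt 0 (LinearMap.id : V →ₗ[k] _) w = w from ?_]
  induction w using PiTensorProduct.induction_on with
  | smul_tprod r x => simp
  | add a b ha hb => simp [ha, hb]

lemma coringMk_balanced (i : Fin n) (a b : A) (w : ⨂[k]^(n + 1) V) :
    coringMk S n (opAt i.castSucc (S.right a) w) b =
      coringMk S n (opAt i.succ (S.left a) w) b := by
  rw [coringMk, mk_balanced, coringMk]

/-- A map out of `((A ⊗ C) ⊗_A ⋯) ⊗ A` respecting the relations, checked on representatives. -/
lemma enveloping_le_ker {X : Type*} [AddCommGroup X] [Module k X]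
    (G : CoringPow S n ⊗[k] A →ₗ[k] X)
    (h : ∀ (a' a'' : A) (w : ⨂[k]^(n + 1) V) (b : A),
      G ((balanced S n).mkQ (opAt 0 (S.left a'')
        (opAt (Fin.last n) (S.right a') w)) ⊗ₜ b) =
      G ((balanced S n).mkQ w ⊗ₜ (a' * b * a''))) :
    envelopingRel S n ≤ LinearMap.ker G := by
  refine Submodule.span_le.2 ?_
  rintro _ ⟨a', a'', m, b, rfl⟩
  obtain ⟨w, rfl⟩ := Submodule.mkQ_surjective _ m
  have := h a' a'' w b
  simp only [SetLike.mem_coe, LinearMap.mem_ker, map_sub, ← this, sub_eq_zero]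
  rfl

end lemmas

/-- `x₀ ⊗_A ⋯ ⊗_A xₙ₊₁ ↦ x₀ ⊗_A ⋯ ⊗_A ε(xᵢ) ⊗_A ⋯ ⊗_A xₙ₊₁`. -/
def powFace (n : ℕ) (i : Fin (n + 2)) : CoringPow S (n + 1) →ₗ[k] CoringPow S n :=
  (balanced S (n + 1)).mapQ _ (freeFace S n i) <| by
    rw [← Submodule.ker_mkQ (balanced S n), ← LinearMap.ker_comp]
    exact balanced_le_ker _ fun l a w => face_balanced i l a w

/-- The face `δᵢ(x₀ ⊗_A ⋯ ⊗_A xₙ₊₁ ⊗ b) = x₀ ⊗_A ⋯ ⊗_A ε(xᵢ) ⊗_A ⋯ ⊗_A xₙ₊₁ ⊗ b`. -/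
def coringFace (n : ℕ) (i : Fin (n + 2)) :
    CoringCyclic S (n + 1) →ₗ[k] CoringCyclic S n :=
  (envelopingRel S (n + 1)).mapQ _ ((powFace S n i).rTensor A) <| by
    rw [← Submodule.ker_mkQ (envelopingRel S n), ← LinearMap.ker_comp]
    refine enveloping_le_ker _ fun a' a'' w b => ?_
    change coringMk S n (freeFace S n i _) b =
      coringMk S n (freeFace S n i w) (a' * b * a'')
    rw [face_left, face_right, coringMk_left, coringMk_right, mul_assoc]

section lemmas
variable {S} {n : ℕ}

lemma succAbove_succAbove_of_lt {i : Fin (n + 1)} {j : Fin n} (h : j.val < i.val) :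
    i.castSucc.succAbove (i.succAbove j) = j.castSucc.castSucc := by
  rw [Fin.succAbove_of_castSucc_lt i j h, Fin.succAbove_of_castSucc_lt]
  exact h

lemma succAbove_succAbove_of_le {i : Fin (n + 1)} {j : Fin n} (h : i.val ≤ j.val) :
    i.castSucc.succAbove (i.succAbove j) = j.succ.succ := by
  rw [Fin.succAbove_of_le_castSucc i j h, Fin.succAbove_of_le_castSucc]
  simp only [Fin.le_def, Fin.val_castSucc, Fin.val_succ]
  omega

lemma insertPairAt_comul_right (j : Fin (n + 1)) (a : A) (v : V) (y : ⨂[k]^n V) :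
    (balanced S (n + 1)).mkQ (insertPairAt j (S.comul (S.right a v) ⊗ₜ y)) =
      (balanced S (n + 1)).mkQ (opAt j.succ (S.right a) (insertPairAt j (S.comul v ⊗ₜ y))) := by
  rw [← insertPairAt_lTensor]
  let G := (balanced S (n + 1)).mkQ ∘ₗ insertPairAt j ∘ₗ
    (TensorProduct.mk k (V ⊗[k] V) (⨂[k]^n V)).flip y
  have : Submodule.span k {z : V ⊗[k] V | ∃ (b : A) (w : V ⊗[k] V),
      z = (S.right b).rTensor V w - (S.left b).lTensor V w} ≤ LinearMap.ker G := by
    refine Submodule.span_le.2 ?_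
    rintro _ ⟨b, w, rfl⟩
    simp only [SetLike.mem_coe, LinearMap.mem_ker, map_sub, sub_eq_zero]
    simp only [G, LinearMap.comp_apply, LinearMap.flip_apply, TensorProduct.mk_apply]
    rw [insertPairAt_rTensor, insertPairAt_lTensor, mk_balanced]
  have := this (S.comul_right a v)
  rw [LinearMap.mem_ker, map_sub, sub_eq_zero] at this
  exact this

lemma dup_balanced (j : Fin (n + 1)) (l : Fin n) (a : A) (w : ⨂[k]^(n + 1) V) :
    (balanced S (n + 1)).mkQ
        (dupAt (S.comul) j (opAt l.castSucc (S.right a) w)) =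
      (balanced S (n + 1)).mkQ
        (dupAt (S.comul) j (opAt l.succ (S.left a) w)) := by
  induction w using insertAt_induction (i := j) with
  | h0 => simp
  | hadd x y hx hy => simp only [map_add, hx, hy]
  | h v y =>
    rcases lt_trichotomy l.castSucc j with hlj | rfl | hlj
    · rcases eq_or_lt_of_le (show l.val + 1 ≤ j.val from hlj) with hlj' | hlj'
      · obtain rfl : j = l.succ := by ext; simp [← hlj']
        have hl : l.castSucc = l.succ.succAbove l := by simp
        rw [opAt_insertAt_self, hl, opAt_insertAt,
          dupAt_insertAt, dupAt_insertAt, S.comul_left, insertPairAt_rTensor, insertPairAt_opAt,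
          succAbove_succAbove_of_lt (by simp), mk_balanced, Fin.succ_castSucc]
      · let l' : Fin n := ⟨l + 1, by have := j.2; omega⟩
        have h1 : l.castSucc = j.succAbove l := by
          rw [Fin.succAbove_of_castSucc_lt]; exact hlj
        have h2 : l.succ = j.succAbove l' := by
          rw [Fin.succAbove_of_castSucc_lt]
          · ext; simp [l']
          · simpa [l', Fin.lt_def] using hlj'
        rw [h1, h2, opAt_insertAt, opAt_insertAt, dupAt_insertAt, dupAt_insertAt,
          insertPairAt_opAt, insertPairAt_opAt, succAbove_succAbove_of_lt hlj,
          succAbove_succAbove_of_lt hlj', mk_balanced]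
        rfl
    · have h2 : l.succ = l.castSucc.succAbove l := by simp
      rw [opAt_insertAt_self, h2, opAt_insertAt, dupAt_insertAt, dupAt_insertAt,
        insertPairAt_comul_right, insertPairAt_opAt, succAbove_succAbove_of_le (by simp),
        Fin.succ_castSucc, mk_balanced]
    · have hlj' : j.val < l.val := hlj
      let l' : Fin n := ⟨l - 1, by have := l.2; omega⟩
      have hl' : j.val ≤ l'.val := by simp only [l']; omega
      have h1 : l.castSucc = j.succAbove l' := by
        rw [Fin.succAbove_of_le_castSucc _ _ hl']
        ext; simp only [Fin.val_castSucc, Fin.val_succ, l']; omega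
      have h2 : l.succ = j.succAbove l := by
        rw [Fin.succAbove_of_le_castSucc _ _ hlj.le]
      have h3 : l'.succ.succ = l.succ.castSucc := by
        ext; simp only [Fin.val_castSucc, Fin.val_succ, l']; omega
      rw [h1, h2, opAt_insertAt, opAt_insertAt, dupAt_insertAt, dupAt_insertAt,
        insertPairAt_opAt, insertPairAt_opAt, succAbove_succAbove_of_le hl',
        succAbove_succAbove_of_le hlj'.le, h3, mk_balanced]

lemma dup_left (j : Fin (n + 1)) (a : A) (w : ⨂[k]^(n + 1) V) :
    dupAt S.comul j (opAt 0 (S.left a) w) = opAt 0 (S.left a) (dupAt S.comul j w) := by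
  induction w using insertAt_induction (i := j) with
  | h0 => simp
  | hadd x y hx hy => simp only [map_add, hx, hy]
  | h v y =>
    rcases eq_or_ne j 0 with rfl | hj
    · rw [opAt_insertAt_self, dupAt_insertAt, dupAt_insertAt, S.comul_left, insertPairAt_rTensor,
        Fin.castSucc_zero]
    · obtain ⟨m, rfl⟩ : ∃ m, n = m + 1 := ⟨n - 1, by
        have := j.2; have : j.val ≠ 0 := fun h => hj (Fin.ext h); omega⟩
      have h0 : (0 : Fin (m + 2)) = j.succAbove 0 := (Fin.succAbove_ne_zero_zero hj).symm
      conv_lhs => rw [h0]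
      rw [opAt_insertAt, dupAt_insertAt, dupAt_insertAt, insertPairAt_opAt,
        succAbove_succAbove_of_lt (Fin.pos_iff_ne_zero.2 hj)]
      rfl

lemma dup_right (j : Fin (n + 1)) (a : A) (w : ⨂[k]^(n + 1) V) :
    (balanced S (n + 1)).mkQ (dupAt S.comul j (opAt (Fin.last n) (S.right a) w)) =
      (balanced S (n + 1)).mkQ (opAt (Fin.last _) (S.right a) (dupAt S.comul j w)) := by
  induction w using insertAt_induction (i := j) with
  | h0 => simp
  | hadd x y hx hy => simp only [map_add, hx, hy]
  | h v y =>
    induction j using Fin.lastCases with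
    | last =>
      rw [opAt_insertAt_self, dupAt_insertAt, dupAt_insertAt, insertPairAt_comul_right,
        Fin.succ_last]
    | cast j =>
      obtain ⟨m, rfl⟩ : ∃ m, n = m + 1 := ⟨n - 1, by have := j.2; omega⟩
      have h0 : Fin.last (m + 1) = j.castSucc.succAbove (Fin.last m) :=
        (Fin.succAbove_ne_last_last (Fin.castSucc_lt_last j).ne).symm
      conv_lhs => rw [h0]
      rw [opAt_insertAt, dupAt_insertAt, dupAt_insertAt, insertPairAt_opAt,
        succAbove_succAbove_of_le (Fin.le_last j), Fin.succ_last, Fin.succ_last]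

lemma coringMk_congr {w w' : ⨂[k]^(n + 1) V}
    (h : (balanced S n).mkQ w = (balanced S n).mkQ w') (b : A) :
    coringMk S n w b = coringMk S n w' b := by
  rw [coringMk, h, coringMk]

end lemmas

/-- `x₀ ⊗_A ⋯ ⊗_A xₙ ↦ x₀ ⊗_A ⋯ ⊗_A Δ(xⱼ) ⊗_A ⋯ ⊗_A xₙ`. -/
def powDegeneracy (n : ℕ) (j : Fin (n + 1)) : CoringPow S n →ₗ[k] CoringPow S (n + 1) :=
  (balanced S n).mapQ (balanced S (n + 1)) (dupAt S.comul j) <| by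
    rw [← Submodule.ker_mkQ (balanced S (n + 1)), ← LinearMap.ker_comp]
    exact balanced_le_ker _ fun l a w => dup_balanced j l a w

/-- The degeneracy `σⱼ(x₀ ⊗_A ⋯ ⊗_A xₙ ⊗ b) = x₀ ⊗_A ⋯ ⊗_A Δ(xⱼ) ⊗_A ⋯ ⊗_A xₙ ⊗ b`. -/
def coringDegeneracy (n : ℕ) (j : Fin (n + 1)) :
    CoringCyclic S n →ₗ[k] CoringCyclic S (n + 1) :=
  (envelopingRel S n).mapQ (envelopingRel S (n + 1)) ((powDegeneracy S n j).rTensor A) <| by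
    rw [← Submodule.ker_mkQ (envelopingRel S (n + 1)), ← LinearMap.ker_comp]
    refine enveloping_le_ker _ fun a' a'' w b => ?_
    change coringMk S (n + 1) (dupAt S.comul j _) b =
      coringMk S (n + 1) (dupAt S.comul j w) (a' * b * a'')
    rw [dup_left, coringMk_left, coringMk_congr (dup_right j a' w), coringMk_right, mul_assoc]

section lemmas
variable {S} {n : ℕ}

lemma rotate_relation (l : Fin n) (a b : A) (w : ⨂[k]^(n + 1) V) :
    coringMk S n (rotateBy S.right n b (opAt l.castSucc (S.right a) w)) 1 =
      coringMk S n (rotateBy S.right n b (opAt l.succ (S.left a) w)) 1 := by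
  obtain ⟨m, rfl⟩ : ∃ m, n = m + 1 := ⟨n - 1, by have := l.2; omega⟩
  simp only [rotateBy_apply, rotate_opAt_castSucc]
  induction l using Fin.lastCases with
  | last =>
    have h0 : (0 : Fin (m + 2)) ≠ (Fin.last m).succ := (Fin.succ_ne_zero _).symm
    rw [opAt_comm_apply h0, Fin.succ_last, rotate_opAt_last, ← opAt_left_right_comm,
      coringMk_left]
    exact (coringMk_right _ a 1).trans (by rw [one_mul, mul_one])
  | cast l =>
    have h0 : (0 : Fin (m + 2)) ≠ l.castSucc.succ := (Fin.succ_ne_zero _).symm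
    rw [opAt_comm_apply h0, Fin.succ_castSucc, rotate_opAt_castSucc, ← opAt_left_right_comm,
      coringMk_balanced]

lemma rotate_enveloping (a' a'' b : A) (w : ⨂[k]^(n + 1) V) :
    coringMk S n (rotateBy S.right n b
        (opAt 0 (S.left a'') (opAt (Fin.last n) (S.right a') w))) 1 =
      coringMk S n (rotateBy S.right n (a' * b * a'') w) 1 := by
  simp only [rotateBy_apply]
  rcases n with _ | n
  · have hr : ∀ w : ⨂[k]^(0 + 1) V, rotate k V 0 w = w := by
      intro w
      rw [rotate, LinearMap.comp_apply]
      exact insertAt_removeAt 0 w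
    have h := coringMk_right (S := S) (opAt 0 (S.right b) (opAt 0 (S.right a') w)) a'' 1
    rw [hr, hr, ← opAt_left_right_comm, coringMk_left, one_mul, Fin.last_zero]
    rw [mul_one] at h
    rw [← h, Fin.last_zero, opAt_comp_apply, opAt_comp_apply, S.right_mul, S.right_mul, LinearMap.comp_assoc]
  · have h0 : (0 : Fin (n + 2)) ≠ Fin.succ 0 := (Fin.succ_ne_zero _).symm
    rw [opAt_left_right_comm, rotate_opAt_last, ← Fin.castSucc_zero, rotate_opAt_castSucc,
      ← opAt_left_right_comm, ← opAt_left_right_comm, ← coringMk_balanced, Fin.castSucc_zero,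
      opAt_comp_apply, opAt_comp_apply, S.right_mul, S.right_mul, LinearMap.comp_assoc]

end lemmas

/-- The cyclic operator `τ(x₀ ⊗_A ⋯ ⊗_A xₙ ⊗ b) = xₙ b ⊗_A x₀ ⊗_A ⋯ ⊗_A xₙ₋₁ ⊗ 1`. -/
def coringCyc (n : ℕ) : CoringCyclic S n →ₗ[k] CoringCyclic S n :=
  (envelopingRel S n).liftQ
    (TensorProduct.lift ((balanced S n).liftQ
      ((rotateBy S.right n).compr₂ ((envelopingRel S n).mkQ ∘ₗ
        (TensorProduct.mk k (CoringPow S n) A).flip 1 ∘ₗ (balanced S n).mkQ)).flip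
      (balanced_le_ker _ fun l a w => LinearMap.ext fun b => rotate_relation l a b w)))
    (enveloping_le_ker _ fun a' a'' w b => rotate_enveloping a' a'' b w)

instance (n : ℕ) : AddCommMonoid (CoringCyclic S n) := Submodule.Quotient.addCommMonoid _

instance (n : ℕ) : Module k (CoringCyclic S n) := Submodule.Quotient.module _

end Source

section GaloisCoring

variable (k H A C : Type*) [CommRing k] [Ring H] [HopfAlgebra k H] [Ring A] [Algebra k A]
  [RightComoduleAlgebra k H A] [AddCommGroup C] [Module k C] [Coalgebra k C]
  [RightModuleCoalgebra k H C]

/-- The Galois coring `A ⊗ C`. -/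
def galoisCoring : Coring k A (A ⊗[k] C) where
  left := leftAct k A C
  right := rightAct k H A C
  counit := coringCounit k A C
  comul := coringComul k A C
  left_one := leftAct_one
  left_mul := leftAct_mul
  right_one := rightAct_one
  right_mul := rightAct_mul
  left_right_comm := left_right_comm
  counit_left := counit_leftAct
  counit_right := counit_rightAct
  comul_left := comul_leftAct
  comul_right := fun a v => sub_mem_tensorRel _ _ _ _ fun G hG => comul_rightAct G hG a v
  coassoc := by
    intro v
    induction v using TensorProduct.induction_on with
    | zero => simp
    | add p p' h h' => simp only [map_add, h, h']
    | tmul a c =>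
      let ι := TensorProduct.mk k A C 1
      have h1 : ∀ z : C ⊗[k] C, TensorProduct.assoc k _ _ _
          ((coringComul k A C).rTensor _ (ι.lTensor _ ((TensorProduct.assoc k A C C).symm
            (a ⊗ₜ z)))) =
          TensorProduct.map (TensorProduct.mk k A C a) (TensorProduct.map ι ι)
            (TensorProduct.assoc k C C C ((Coalgebra.comul (R := k)).rTensor C z)) := by
        intro z
        induction z using TensorProduct.induction_on with
        | zero => simp
        | add p p' h h' => simp only [map_add, TensorProduct.tmul_add, h, h']
        | tmul c d =>
          simp only [TensorProduct.assoc_symm_tmul, LinearMap.lTensor_tmul,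
            LinearMap.rTensor_tmul, coringComul, LinearMap.comp_apply, LinearEquiv.coe_coe]
          generalize Coalgebra.comul (R := k) c = q
          induction q using TensorProduct.induction_on with
          | zero => simp
          | add p p' h h' =>
            simp only [map_add, TensorProduct.tmul_add, TensorProduct.add_tmul, h, h']
          | tmul x y => rfl
      have h2 : ∀ z : C ⊗[k] C,
          (coringComul k A C).lTensor _ (ι.lTensor _ ((TensorProduct.assoc k A C C).symm
            (a ⊗ₜ z))) =
          TensorProduct.map (TensorProduct.mk k A C a) (TensorProduct.map ι ι)
            ((Coalgebra.comul (R := k)).lTensor C z) := by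
        intro z
        induction z using TensorProduct.induction_on with
        | zero => simp
        | add p p' h h' => simp only [map_add, TensorProduct.tmul_add, h, h']
        | tmul c d =>
          simp only [TensorProduct.assoc_symm_tmul, LinearMap.lTensor_tmul, ι,
            TensorProduct.mk_apply, coringComul, LinearMap.comp_apply, LinearEquiv.coe_coe]
          generalize Coalgebra.comul (R := k) d = q
          induction q using TensorProduct.induction_on with
          | zero => simp
          | add p p' h h' =>
            simp only [map_add, TensorProduct.tmul_add, h, h']
          | tmul x y => rfl
      have h3 : coringComul k A C (a ⊗ₜ c) = ι.lTensor _ ((TensorProduct.assoc k A C C).symm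
            (a ⊗ₜ Coalgebra.comul (R := k) c)) := rfl
      rw [h3, h1, h2, Coalgebra.coassoc_apply]
  counit_comul_left := by
    intro v
    induction v using TensorProduct.induction_on with
    | zero => simp
    | add p p' h h' => simp only [map_add, h, h']
    | tmul a c =>
      have h1 : ∀ z : C ⊗[k] C, TensorProduct.lift (leftAct k A C ∘ₗ coringCounit k A C)
          ((TensorProduct.mk k A C 1).lTensor _ ((TensorProduct.assoc k A C C).symm (a ⊗ₜ z))) =
          a ⊗ₜ TensorProduct.lid k C ((Coalgebra.counit (R := k)).rTensor C z) := by
        intro z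
        induction z using TensorProduct.induction_on with
        | zero => simp
        | add p p' h h' => simp only [map_add, TensorProduct.tmul_add, h, h']
        | tmul c d => simp
      refine (h1 _).trans ?_
      rw [Coalgebra.rTensor_counit_comul, TensorProduct.lid_tmul, one_smul]
  counit_comul_right := by
    intro v
    induction v using TensorProduct.induction_on with
    | zero => simp
    | add p p' h h' => simp only [map_add, h, h']
    | tmul a c =>
      have h1 : ∀ z : C ⊗[k] C, TensorProduct.lift (rightAct k H A C ∘ₗ coringCounit k A C).flip
          ((TensorProduct.mk k A C 1).lTensor _ ((TensorProduct.assoc k A C C).symm (a ⊗ₜ z))) =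
          a ⊗ₜ TensorProduct.rid k C ((Coalgebra.counit (R := k)).lTensor C z) := by
        intro z
        induction z using TensorProduct.induction_on with
        | zero => simp
        | add p p' h h' => simp only [map_add, TensorProduct.tmul_add, h, h']
        | tmul c d => simp [rightAct_one]
      refine (h1 _).trans ?_
      rw [Coalgebra.lTensor_counit_comul, TensorProduct.rid_tmul, one_smul]

end GaloisCoring

section IteratedComultiplication

variable (k H : Type*) [CommRing k] [Ring H] [HopfAlgebra k H]

/-- `legs m j h = h₍₁₎ ⊗ ⋯ ⊗ h₍ⱼ₎ ⊗ 1 ⊗ ⋯ ⊗ 1 ∈ H^{⊗m}` for `j ≤ m`. -/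
def legs : (m j : ℕ) → (H →ₗ[k] ⨂[k]^m H)
  | 0, _ => Algebra.linearMap k (⨂[k]^0 H) ∘ₗ Coalgebra.counit
  | m + 1, 0 => Algebra.linearMap k (⨂[k]^(m + 1) H) ∘ₗ Coalgebra.counit
  | m + 1, j + 1 => insertAt 0 ∘ₗ (legs m j).lTensor H ∘ₗ Coalgebra.comul

/-- The iterated comultiplication `h ↦ h₍₁₎ ⊗ ⋯ ⊗ h₍ₘ₎ ∈ H^{⊗m}`. -/
def iterComul (m : ℕ) : H →ₗ[k] ⨂[k]^m H := legs k H m m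

end IteratedComultiplication

section CoefficientModule

variable (k H A : Type*) [CommRing k] [Ring H] [HopfAlgebra k H] [Ring A] [Algebra k A]
  [RightComoduleAlgebra k H A]

/-- `b ⊗ g ↦ h g ⊗ a b`. -/
def twist (h : H) (a : A) : A ⊗[k] H →ₗ[k] H ⊗[k] A :=
  TensorProduct.map (LinearMap.mulLeft k h) (LinearMap.mulLeft k a) ∘ₗ
    (TensorProduct.comm k A H).toLinearMap

/-- The relations `h a'₍₁₎ ⊗ a a'₍₀₎ = h ⊗ a' a`. -/
def coeffRel : Submodule k (H ⊗[k] A) :=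
  Submodule.span k {z | ∃ (h : H) (a a' : A),
    z = twist k H A h a (coact k H A a') - h ⊗ₜ[k] (a' * a)}

/-- The module `M = (H ⊗ A) / ⟨h a'₍₁₎ ⊗ a a'₍₀₎ - h ⊗ a' a⟩`. -/
abbrev Coeff : Type _ := (H ⊗[k] A) ⧸ coeffRel k H A

section lemmas
variable {k H A}

lemma coeffRel_le_ker {X : Type*} [AddCommGroup X] [Module k X] (G : H ⊗[k] A →ₗ[k] X)
    (h : ∀ (h : H) (a a' : A), G (twist k H A h a (coact k H A a')) = G (h ⊗ₜ (a' * a))) :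
    coeffRel k H A ≤ LinearMap.ker G := by
  refine Submodule.span_le.2 ?_
  rintro _ ⟨g, a, a', rfl⟩
  simp [h]

lemma mk_coeffRel (h : H) (a a' : A) :
    (coeffRel k H A).mkQ (twist k H A h a (coact k H A a')) =
      (coeffRel k H A).mkQ (h ⊗ₜ (a' * a)) := by
  rw [← sub_eq_zero, ← map_sub, Submodule.mkQ_apply, Submodule.Quotient.mk_eq_zero]
  exact Submodule.subset_span ⟨h, a, a', rfl⟩

lemma twist_mul (g h : H) (a : A) (z : A ⊗[k] H) :
    (LinearMap.mulLeft k g).rTensor A (twist k H A h a z) = twist k H A (g * h) a z := by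
  induction z using TensorProduct.induction_on with
  | zero => simp
  | add p p' h h' => simp only [map_add, h, h']
  | tmul b g => simp [twist]

end lemmas

/-- The left action `h' · [h ⊗ a] = [h' h ⊗ a]`. -/
def coeffAct : H →ₗ[k] Coeff k H A →ₗ[k] Coeff k H A :=
  ((coeffRel k H A).liftQ
    ((LinearMap.rTensorHom A ∘ₗ LinearMap.mul k H).compr₂ (coeffRel k H A).mkQ).flip
    (coeffRel_le_ker _ fun h a a' => LinearMap.ext fun g => by
      change (coeffRel k H A).mkQ ((LinearMap.mulLeft k g).rTensor A _) =
        (coeffRel k H A).mkQ ((LinearMap.mulLeft k g).rTensor A _)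
      rw [twist_mul, mk_coeffRel, LinearMap.rTensor_tmul, LinearMap.mulLeft_apply])).flip

/-- `((x ⊗ z) ⊗ g) ↦ z g S(x)`. -/
def conjMul : (H ⊗[k] H) ⊗[k] H →ₗ[k] H :=
  LinearMap.mul' k H ∘ₗ (TensorProduct.comm k H H).toLinearMap ∘ₗ
    TensorProduct.map (HopfAlgebra.antipode k) (LinearMap.mul' k H) ∘ₗ
    (TensorProduct.assoc k H H H).toLinearMap

/-- `(x ⊗ (y ⊗ z)) ⊗ (b ⊗ g) ↦ (y ⊗ b) ⊗ z g S(x)`. -/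
def coactShuffle : (H ⊗[k] (H ⊗[k] H)) ⊗[k] (A ⊗[k] H) →ₗ[k] (H ⊗[k] A) ⊗[k] H :=
  (conjMul k H).lTensor (H ⊗[k] A) ∘ₗ
    (TensorProduct.tensorTensorTensorComm k H (H ⊗[k] H) A H).toLinearMap ∘ₗ
    (TensorProduct.leftComm k H H H).toLinearMap.rTensor (A ⊗[k] H)

@[simp] lemma coactShuffle_tmul (x y z g : H) (b : A) :
    coactShuffle k H A ((x ⊗ₜ (y ⊗ₜ z)) ⊗ₜ (b ⊗ₜ g)) =
      (y ⊗ₜ b) ⊗ₜ (z * g * HopfAlgebra.antipode k x) := rfl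

/-- The coaction `h ⊗ a ↦ (h₍₂₎ ⊗ a₍₀₎) ⊗ h₍₃₎ a₍₁₎ S(h₍₁₎)` on `H ⊗ A`. -/
def freeCoact : H ⊗[k] A →ₗ[k] (H ⊗[k] A) ⊗[k] H :=
  coactShuffle k H A ∘ₗ
    TensorProduct.map ((Coalgebra.comul (R := k) (A := H)).lTensor H ∘ₗ Coalgebra.comul)
      (coact k H A)

section lemmas
variable {k H A}

/-- `h ↦ h₍₁₎ ⊗ (h₍₂₎ ⊗ h₍₃₎)`. -/
def comul₂ : H →ₗ[k] H ⊗[k] (H ⊗[k] H) :=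
  (Coalgebra.comul (R := k) (A := H)).lTensor H ∘ₗ Coalgebra.comul

lemma comul₂_mul (g h : H) : comul₂ (k := k) (g * h) = comul₂ (k := k) g * comul₂ (k := k) h := by
  exact map_mul ((Algebra.TensorProduct.map (AlgHom.id k H)
      (Bialgebra.comulAlgHom k H)).comp (Bialgebra.comulAlgHom k H)) g h

/-- `h₍₁₎ S(h₍₂₎) ⊗ h₍₃₎ ⊗ h₍₄₎ = 1 ⊗ h₍₁₎ ⊗ h₍₂₎`. -/
lemma mul_antipode_comul₂ (s : H) :
    (LinearMap.mul' k H ∘ₗ (HopfAlgebra.antipode k).lTensor H).rTensor (H ⊗[k] H)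
      ((TensorProduct.assoc k H H (H ⊗[k] H)).symm
        ((comul₂ (k := k)).lTensor H (Coalgebra.comul (R := k) s))) =
      1 ⊗ₜ Coalgebra.comul (R := k) s := by
  have h1 : ∀ z : H ⊗[k] H, (comul₂ (k := k)).lTensor H z =
      ((Coalgebra.comul (R := k) (A := H)).lTensor H).lTensor H
        ((Coalgebra.comul (R := k) (A := H)).lTensor H z) := fun z => by
    rw [comul₂, LinearMap.lTensor_comp, LinearMap.comp_apply]
  rw [h1, ← Coalgebra.coassoc_apply]
  have h2 : ∀ z : H ⊗[k] H,
      (LinearMap.mul' k H ∘ₗ (HopfAlgebra.antipode k).lTensor H).rTensor (H ⊗[k] H)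
        ((TensorProduct.assoc k H H (H ⊗[k] H)).symm
          (((Coalgebra.comul (R := k) (A := H)).lTensor H).lTensor H
            (TensorProduct.assoc k H H H ((Coalgebra.comul (R := k)).rTensor H z)))) =
      TensorProduct.map (Algebra.linearMap k H) (Coalgebra.comul (R := k))
        ((Coalgebra.counit (R := k)).rTensor H z) := by
    intro z
    induction z using TensorProduct.induction_on with
    | zero => simp
    | add p p' h h' => simp only [map_add, h, h']
    | tmul m n =>
      simp only [LinearMap.rTensor_tmul, TensorProduct.map_tmul, Algebra.linearMap_apply]
      rw [← HopfAlgebra.mul_antipode_lTensor_comul_apply (R := k) m]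
      generalize Coalgebra.comul (R := k) m = q
      induction q using TensorProduct.induction_on with
      | zero => simp
      | add p p' h h' => simp only [map_add, TensorProduct.add_tmul, h, h']
      | tmul x y => simp
  rw [h2, Coalgebra.rTensor_counit_comul]
  simp

/-- `(a ⊗ g) ⊗ t ↦ shuffle (p Δ²(t) ⊗ q (a ⊗ g))`. -/
def coactAux (p : H ⊗[k] (H ⊗[k] H)) (q : A ⊗[k] H) : (A ⊗[k] H) ⊗[k] H →ₗ[k] (H ⊗[k] A) ⊗[k] H :=
  coactShuffle k H A ∘ₗ TensorProduct.map (LinearMap.mulLeft k p ∘ₗ comul₂)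
    (LinearMap.mulLeft k q) ∘ₗ (TensorProduct.comm k (A ⊗[k] H) H).toLinearMap

/-- `a ⊗ (u ⊗ v) ↦ shuffle (p (1 ⊗ (u ⊗ v)) ⊗ q (a ⊗ 1))`. -/
def coactAux' (p : H ⊗[k] (H ⊗[k] H)) (q : A ⊗[k] H) : A ⊗[k] (H ⊗[k] H) →ₗ[k] (H ⊗[k] A) ⊗[k] H :=
  coactShuffle k H A ∘ₗ TensorProduct.map (LinearMap.mulLeft k p ∘ₗ TensorProduct.mk k H _ 1)
    (LinearMap.mulLeft k q ∘ₗ (TensorProduct.mk k A H).flip 1) ∘ₗ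
      (TensorProduct.comm k A (H ⊗[k] H)).toLinearMap

lemma coactAux_add_left (p p' : H ⊗[k] (H ⊗[k] H)) (q : A ⊗[k] H) :
    coactAux (p + p') q = coactAux p q + coactAux p' q := by
  refine LinearMap.ext fun z => ?_
  induction z using TensorProduct.induction_on with
  | zero => simp
  | add z z' h h' => simp only [map_add, h, h']
  | tmul r t => simp [coactAux, add_mul, TensorProduct.add_tmul]

lemma coactAux_add_right (p : H ⊗[k] (H ⊗[k] H)) (q q' : A ⊗[k] H) :
    coactAux p (q + q') = coactAux p q + coactAux p q' := by
  refine LinearMap.ext fun z => ?_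
  induction z using TensorProduct.induction_on with
  | zero => simp
  | add z z' h h' => simp only [map_add, h, h']
  | tmul r t => simp [coactAux, add_mul, TensorProduct.tmul_add]

lemma coactAux'_add_left (p p' : H ⊗[k] (H ⊗[k] H)) (q : A ⊗[k] H) :
    coactAux' (p + p') q = coactAux' p q + coactAux' p' q := by
  refine LinearMap.ext fun z => ?_
  induction z using TensorProduct.induction_on with
  | zero => simp
  | add z z' h h' => simp only [map_add, h, h']
  | tmul r t => simp [coactAux', add_mul, TensorProduct.add_tmul]

lemma coactAux'_add_right (p : H ⊗[k] (H ⊗[k] H)) (q q' : A ⊗[k] H) :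
    coactAux' p (q + q') = coactAux' p q + coactAux' p q' := by
  refine LinearMap.ext fun z => ?_
  induction z using TensorProduct.induction_on with
  | zero => simp
  | add z z' h h' => simp only [map_add, h, h']
  | tmul r t => simp [coactAux', add_mul, TensorProduct.tmul_add]

lemma coactAux_eq (p : H ⊗[k] (H ⊗[k] H)) (q : A ⊗[k] H) (r : A ⊗[k] H) :
    coactAux p q ((TensorProduct.assoc k A H H).symm
      ((Coalgebra.comul (R := k) (A := H)).lTensor A r)) =
    coactAux' p q ((Coalgebra.comul (R := k) (A := H)).lTensor A r) := by
  induction r using TensorProduct.induction_on with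
  | zero => simp
  | add p p' h h' => simp only [map_add, h, h']
  | tmul α s =>
    rw [LinearMap.lTensor_tmul]
    induction q using TensorProduct.induction_on with
    | zero => simp [coactAux, coactAux']
    | add q q' h h' => rw [coactAux_add_right, coactAux'_add_right, LinearMap.add_apply,
        LinearMap.add_apply, h, h']
    | tmul b g =>
      induction p using TensorProduct.induction_on with
      | zero => simp [coactAux, coactAux']
      | add p p' h h' => rw [coactAux_add_left, coactAux'_add_left, LinearMap.add_apply,
          LinearMap.add_apply, h, h']
      | tmul x p =>
        induction p using TensorProduct.induction_on with
        | zero => simp [coactAux, coactAux']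
        | add p p' h h' => rw [TensorProduct.tmul_add, coactAux_add_left, coactAux'_add_left,
            LinearMap.add_apply, LinearMap.add_apply, h, h']
        | tmul y z =>
          let T : H ⊗[k] (H ⊗[k] H) →ₗ[k] (H ⊗[k] A) ⊗[k] H :=
            TensorProduct.map ((TensorProduct.mk k H A).flip (b * α) ∘ₗ LinearMap.mulLeft k y)
              (LinearMap.mulRight k (HopfAlgebra.antipode k x) ∘ₗ LinearMap.mulLeft k z ∘ₗ
                LinearMap.mul' k H ∘ₗ (TensorProduct.comm k H H).toLinearMap ∘ₗ
                (LinearMap.mulLeft k g).rTensor H) ∘ₗ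
            (TensorProduct.leftComm k H H H).toLinearMap
          have h1 : ∀ w : H ⊗[k] H, coactAux (x ⊗ₜ (y ⊗ₜ z)) (b ⊗ₜ g)
              ((TensorProduct.assoc k A H H).symm (α ⊗ₜ w)) =
              T ((LinearMap.mul' k H ∘ₗ (HopfAlgebra.antipode k).lTensor H).rTensor (H ⊗[k] H)
                ((TensorProduct.assoc k H H (H ⊗[k] H)).symm ((comul₂ (k := k)).lTensor H w))) := by
            intro w
            induction w using TensorProduct.induction_on with
            | zero => simp
            | add p p' h h' => simp only [map_add, TensorProduct.tmul_add, h, h']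
            | tmul β t =>
              simp only [coactAux, LinearMap.comp_apply, TensorProduct.assoc_symm_tmul,
                LinearEquiv.coe_coe, TensorProduct.comm_tmul, TensorProduct.map_tmul,
                LinearMap.lTensor_tmul]
              generalize comul₂ (k := k) t = d
              induction d using TensorProduct.induction_on with
              | zero => simp
              | add p p' h h' => simp only [map_add, TensorProduct.tmul_add,
                  TensorProduct.add_tmul, h, h']
              | tmul t₁ d =>
                induction d using TensorProduct.induction_on with
                | zero => simp
                | add p p' h h' => simp only [map_add, TensorProduct.tmul_add,
                    TensorProduct.add_tmul, h, h']
                | tmul t₂ t₃ =>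
                  simp [T, HopfAlgebra.antipode_mul_antidistrib, mul_assoc]
          rw [h1, mul_antipode_comul₂]
          generalize Coalgebra.comul (R := k) s = w
          induction w using TensorProduct.induction_on with
          | zero => simp
          | add p p' h h' => simp only [map_add, TensorProduct.tmul_add, h, h']
          | tmul u v => simp [T, coactAux', mul_assoc]

lemma freeCoact_twist (h : H) (a : A) (r : A ⊗[k] H) :
    freeCoact k H A (twist k H A h a r) =
      coactAux (comul₂ h) (coact k H A a) ((coact k H A).rTensor H r) := by
  induction r using TensorProduct.induction_on with
  | zero => simp
  | add p p' h h' => simp only [map_add, h, h']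
  | tmul α s =>
    change coactShuffle k H A (comul₂ (h * s) ⊗ₜ coact k H A (a * α)) = _
    rw [comul₂_mul, coact_mul]
    rfl

lemma mkQ_coactAux' (p : H ⊗[k] (H ⊗[k] H)) (q : A ⊗[k] H) (r : A ⊗[k] H) :
    (coeffRel k H A).mkQ.rTensor H (coactAux' p q
      (TensorProduct.assoc k A H H ((coact k H A).rTensor H r))) =
    (coeffRel k H A).mkQ.rTensor H (coactShuffle k H A (p ⊗ₜ (r * q))) := by
  induction r using TensorProduct.induction_on with
  | zero => simp
  | add r r' h h' => simp only [map_add, h, h', add_mul, TensorProduct.tmul_add]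
  | tmul α v =>
    induction q using TensorProduct.induction_on with
    | zero => simp [coactAux']
    | add q q' h h' => rw [coactAux'_add_right, LinearMap.add_apply, map_add, h, h', mul_add,
        TensorProduct.tmul_add, map_add, map_add]
    | tmul b g =>
      induction p using TensorProduct.induction_on with
      | zero => simp [coactAux']
      | add p p' h h' => rw [coactAux'_add_left, LinearMap.add_apply, map_add, h, h',
          TensorProduct.add_tmul, map_add, map_add]
      | tmul x p =>
        induction p using TensorProduct.induction_on with
        | zero => simp [coactAux']
        | add p p' h h' => rw [TensorProduct.tmul_add, coactAux'_add_left, LinearMap.add_apply,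
            map_add, h, h', TensorProduct.add_tmul, map_add, map_add]
        | tmul y z =>
          have h1 : ∀ e : A ⊗[k] H, coactAux' (x ⊗ₜ (y ⊗ₜ z)) (b ⊗ₜ g)
              (TensorProduct.assoc k A H H (e ⊗ₜ v)) =
              twist k H A y b e ⊗ₜ (z * v * g * HopfAlgebra.antipode k x) := by
            intro e
            induction e using TensorProduct.induction_on with
            | zero => simp
            | add e e' h h' => simp only [map_add, TensorProduct.add_tmul, h, h']
            | tmul α u => simp [coactAux', twist]
          rw [LinearMap.rTensor_tmul, h1, LinearMap.rTensor_tmul, mk_coeffRel]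
          simp [mul_assoc]

end lemmas

lemma freeCoact_relation (h : H) (a a' : A) :
    (coeffRel k H A).mkQ.rTensor H (freeCoact k H A (twist k H A h a (coact k H A a'))) =
      (coeffRel k H A).mkQ.rTensor H (freeCoact k H A (h ⊗ₜ (a' * a))) := by
  rw [freeCoact_twist, ← (TensorProduct.assoc k A H H).symm_apply_apply
    ((coact k H A).rTensor H _), coact_coassoc, coactAux_eq, ← coact_coassoc, mkQ_coactAux',
    ← coact_mul]
  rfl

/-- The right coaction `[h ⊗ a] ↦ [h₍₂₎ ⊗ a₍₀₎] ⊗ h₍₃₎ a₍₁₎ S(h₍₁₎)`. -/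
def coeffCoact : Coeff k H A →ₗ[k] Coeff k H A ⊗[k] H :=
  (coeffRel k H A).liftQ ((coeffRel k H A).mkQ.rTensor H ∘ₗ freeCoact k H A)
    (coeffRel_le_ker _ fun h a a' => freeCoact_relation k H A h a a')

end CoefficientModule

section Target

variable (k H A C : Type*) [CommRing k] [Ring H] [HopfAlgebra k H] [Ring A] [Algebra k A]
  [RightComoduleAlgebra k H A] [AddCommGroup C] [Module k C] [Coalgebra k C]
  [RightModuleCoalgebra k H C]

/-- The action `(c₁ ⊗ ⋯ ⊗ cₘ) · (h₁ ⊗ ⋯ ⊗ hₘ) = c₁ · h₁ ⊗ ⋯ ⊗ cₘ · hₘ`. -/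
def tensorAct (m : ℕ) : ⨂[k]^m C →ₗ[k] ⨂[k]^m H →ₗ[k] ⨂[k]^m C :=
  PiTensorProduct.map₂ fun _ => RightModuleCoalgebra.act

/-- The diagonal right action `(c₁ ⊗ ⋯ ⊗ cₘ) · h = c₁ · h₍₁₎ ⊗ ⋯ ⊗ cₘ · h₍ₘ₎`. -/
def diagAct (m : ℕ) (h : H) : ⨂[k]^m C →ₗ[k] ⨂[k]^m C :=
  (tensorAct k H C m).flip (iterComul k H m h)

/-- The relations `w · h ⊗ m = w ⊗ h · m` of the tensor product over `H`. -/
def hopfRel (n : ℕ) : Submodule k (⨂[k]^(n + 1) C ⊗[k] Coeff k H A) :=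
  Submodule.span k {z | ∃ (w : ⨂[k]^(n + 1) C) (h : H) (m : Coeff k H A),
    z = diagAct k H C (n + 1) h w ⊗ₜ[k] m - w ⊗ₜ[k] coeffAct k H A h m}

/-- The module `C^{⊗(n+1)} ⊗_H M`. -/
abbrev HopfCyclicModule (n : ℕ) : Type _ :=
  (⨂[k]^(n + 1) C ⊗[k] Coeff k H A) ⧸ hopfRel k H A C n

/-- `c₀ ⊗ ⋯ ⊗ cₙ₊₁ ↦ ε(cᵢ) c₀ ⊗ ⋯ ĉᵢ ⋯ ⊗ cₙ₊₁`. -/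
def counitAt (n : ℕ) (i : Fin (n + 1)) : ⨂[k]^(n + 1) C →ₗ[k] ⨂[k]^n C :=
  (TensorProduct.lid k (⨂[k]^n C)).toLinearMap ∘ₗ
    (Coalgebra.counit (R := k) (A := C)).rTensor (⨂[k]^n C) ∘ₗ removeAt i

/-- `(c₀ ⊗ ⋯ ⊗ cₙ) ⊗ m ↦ (cₙ · m₍₁₎ ⊗ c₀ ⊗ ⋯ ⊗ cₙ₋₁) ⊗ m₍₀₎`. -/
def freeCyc (n : ℕ) :
    ⨂[k]^(n + 1) C ⊗[k] Coeff k H A →ₗ[k] ⨂[k]^(n + 1) C ⊗[k] Coeff k H A :=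
  (TensorProduct.lift (rotateBy (RightModuleCoalgebra.act (k := k) (H := H) (C := C)).flip n).flip).rTensor
      (Coeff k H A) ∘ₗ
    (TensorProduct.assoc k (⨂[k]^(n + 1) C) H (Coeff k H A)).symm.toLinearMap ∘ₗ
    (TensorProduct.comm k (Coeff k H A) H).toLinearMap.lTensor (⨂[k]^(n + 1) C) ∘ₗ
    (coeffCoact k H A).lTensor (⨂[k]^(n + 1) C)

end Target

section Target

variable (k H A C : Type*) [CommRing k] [Ring H] [HopfAlgebra k H] [Ring A] [Algebra k A]
  [RightComoduleAlgebra k H A] [AddCommGroup C] [Module k C] [Coalgebra k C]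
  [RightModuleCoalgebra k H C]

section lemmas
variable {k H A C} {n : ℕ} {V : Type*} [AddCommGroup V] [Module k V]

lemma removeAt_succ_insertAt_zero (i : Fin (n + 1)) (v : V) (y : ⨂[k]^(n + 1) V) :
    removeAt i.succ (insertAt 0 (v ⊗ₜ y)) =
      (insertAt 0).lTensor V (TensorProduct.leftComm k V V (⨂[k]^n V) (v ⊗ₜ removeAt i y)) := by
  induction y using PiTensorProduct.induction_on with
  | smul_tprod r x =>
    simp only [map_smul, TensorProduct.tmul_smul, insertAt_tmul, removeAt_tprod,
      TensorProduct.leftComm_tmul, LinearMap.lTensor_tmul]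
    have : i.succ.removeNth (Fin.insertNth (α := fun _ => V) 0 v x) =
        Fin.insertNth (α := fun _ => V) 0 v (i.removeNth x) := by
      funext j
      refine Fin.cases ?_ (fun j => ?_) j <;> simp [Fin.removeNth, Fin.succ_succAbove_succ]
    rw [this]
    simp
  | add a b ha hb => simp only [map_add, TensorProduct.tmul_add, ha, hb]

lemma counitAt_succ_insertAt_zero (i : Fin (n + 1)) (v : C) (y : ⨂[k]^(n + 1) C) :
    counitAt k C (n + 1) i.succ (insertAt 0 (v ⊗ₜ y)) = insertAt 0 (v ⊗ₜ counitAt k C n i y) := by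
  simp only [counitAt, LinearMap.comp_apply, removeAt_succ_insertAt_zero]
  generalize removeAt i y = z
  induction z using TensorProduct.induction_on with
  | zero => simp
  | add a b ha hb => simp only [map_add, TensorProduct.tmul_add, ha, hb]
  | tmul c w => simp

lemma dupAt_succ_insertAt_zero (Δ : V →ₗ[k] V ⊗[k] V) (i : Fin (n + 1)) (v : V)
    (y : ⨂[k]^(n + 1) V) :
    dupAt Δ i.succ (insertAt 0 (v ⊗ₜ y)) = insertAt 0 (v ⊗ₜ dupAt Δ i y) := by
  have h1 : ∀ (z : V ⊗[k] V) (w : ⨂[k]^n V), 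
      insertPairAt i.succ (z ⊗ₜ insertAt 0 (v ⊗ₜ w)) = insertAt 0 (v ⊗ₜ insertPairAt i (z ⊗ₜ w)) := by
    intro z w
    induction z using TensorProduct.induction_on with
    | zero => simp
    | add a b ha hb => simp only [map_add, TensorProduct.tmul_add, TensorProduct.add_tmul, ha, hb]
    | tmul c d =>
      induction w using PiTensorProduct.induction_on with
      | smul_tprod r x =>
        simp only [map_smul, TensorProduct.tmul_smul, insertAt_tmul, insertPairAt, LinearMap.comp_apply,
          LinearEquiv.coe_coe, TensorProduct.assoc_tmul, LinearMap.lTensor_tmul]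
        congr 2
        funext j
        refine Fin.cases ?_ (fun j => ?_) j
        · simp
        · simp only [Fin.insertNth_zero', Fin.cons_succ, ← Fin.succ_castSucc,
            Fin.insertNth_succ_cons]
      | add a b ha hb => simp only [map_add, TensorProduct.tmul_add, ha, hb]
  simp only [dupAt, LinearMap.comp_apply, removeAt_succ_insertAt_zero]
  generalize removeAt i y = z
  induction z using TensorProduct.induction_on with
  | zero => simp
  | add a b ha hb => simp only [map_add, TensorProduct.tmul_add, ha, hb]
  | tmul c w =>
    simp only [TensorProduct.leftComm_tmul, LinearMap.lTensor_tmul, LinearMap.rTensor_tmul, h1]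

lemma iterComul_succ (h : H) : iterComul k H (n + 1) h =
    insertAt 0 ((iterComul k H n).lTensor H (Coalgebra.comul (R := k) h)) := rfl

lemma iterComul_zero (h : H) : iterComul k H 0 h = Coalgebra.counit (R := k) h • 1 := by
  simp [iterComul, legs, Algebra.algebraMap_eq_smul_one]

lemma counitAt_zero_iterComul (h : H) :
    counitAt k H n 0 (iterComul k H (n + 1) h) = iterComul k H n h := by
  have h1 : ∀ z : H ⊗[k] H, counitAt k H n 0 (insertAt 0 ((iterComul k H n).lTensor H z)) =
      TensorProduct.lid k _ ((iterComul k H n).lTensor k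
        ((Coalgebra.counit (R := k) (A := H)).rTensor H z)) := by
    intro z
    rw [counitAt, LinearMap.comp_apply, LinearMap.comp_apply, removeAt_insertAt]
    induction z using TensorProduct.induction_on with
    | zero => simp
    | add a b ha hb => simp only [map_add, ha, hb]
    | tmul c w => simp
  rw [iterComul_succ, h1, Coalgebra.rTensor_counit_comul]
  simp

lemma dupAt_zero_iterComul (h : H) :
    dupAt (Coalgebra.comul (R := k)) 0 (iterComul k H (n + 1) h) = iterComul k H (n + 2) h := by
  have h1 : ∀ z : H ⊗[k] H, dupAt (Coalgebra.comul (R := k)) 0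
        (insertAt 0 ((iterComul k H n).lTensor H z)) =
      insertAt 0 ((insertAt 0).lTensor H (((iterComul k H n).lTensor H).lTensor H
        (TensorProduct.assoc k H H H ((Coalgebra.comul (R := k) (A := H)).rTensor H z)))) := by
    intro z
    induction z using TensorProduct.induction_on with
    | zero => simp
    | add a b ha hb => simp only [map_add, ha, hb]
    | tmul c w =>
      rw [LinearMap.lTensor_tmul, dupAt_insertAt, LinearMap.rTensor_tmul, insertPairAt]
      simp only [LinearMap.comp_apply, LinearEquiv.coe_coe]
      congr 2
      generalize Coalgebra.comul (R := k) c = q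
      induction q using TensorProduct.induction_on with
      | zero => simp only [LinearEquiv.map_zero, TensorProduct.zero_tmul, LinearMap.map_zero]
      | add a b ha hb => simp only [map_add, TensorProduct.add_tmul, ha, hb]
      | tmul c d => simp
  have h2 : ∀ z : H ⊗[k] H, (iterComul k H (n + 1)).lTensor H z =
      (insertAt 0).lTensor H (((iterComul k H n).lTensor H).lTensor H
        ((Coalgebra.comul (R := k) (A := H)).lTensor H z)) := by
    intro z
    induction z using TensorProduct.induction_on with
    | zero => simp
    | add a b ha hb => simp only [map_add, ha, hb]
    | tmul c w => rfl
  rw [iterComul_succ, h1, Coalgebra.coassoc_apply, iterComul_succ, h2]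

lemma counitAt_iterComul (i : Fin (n + 1)) (h : H) :
    counitAt k H n i (iterComul k H (n + 1) h) = iterComul k H n h := by
  induction n generalizing h with
  | zero =>
    obtain rfl := Fin.fin_one_eq_zero i
    exact counitAt_zero_iterComul h
  | succ n ih =>
    refine Fin.cases ?_ (fun i => ?_) i
    · exact counitAt_zero_iterComul h
    · rw [iterComul_succ]
      conv_rhs => rw [iterComul_succ]
      generalize Coalgebra.comul (R := k) h = z
      induction z using TensorProduct.induction_on with
      | zero => simp
      | add a b ha hb => simp only [map_add, ha, hb]
      | tmul c w => rw [LinearMap.lTensor_tmul, counitAt_succ_insertAt_zero, ih,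
          LinearMap.lTensor_tmul]

lemma dupAt_iterComul (i : Fin (n + 1)) (h : H) :
    dupAt (Coalgebra.comul (R := k)) i (iterComul k H (n + 1) h) = iterComul k H (n + 2) h := by
  induction n generalizing h with
  | zero =>
    obtain rfl := Fin.fin_one_eq_zero i
    exact dupAt_zero_iterComul h
  | succ n ih =>
    refine Fin.cases ?_ (fun i => ?_) i
    · exact dupAt_zero_iterComul h
    · rw [iterComul_succ]
      conv_rhs => rw [iterComul_succ]
      generalize Coalgebra.comul (R := k) h = z
      induction z using TensorProduct.induction_on with
      | zero => simp
      | add a b ha hb => simp only [map_add, ha, hb]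
      | tmul c w => rw [LinearMap.lTensor_tmul, dupAt_succ_insertAt_zero, ih,
          LinearMap.lTensor_tmul]

lemma tensorAct_tprod (m : ℕ) (c : Fin m → C) (h : Fin m → H) :
    tensorAct k H C m (PiTensorProduct.tprod k c) (PiTensorProduct.tprod k h) =
      PiTensorProduct.tprod k fun i => RightModuleCoalgebra.act (k := k) (c i) (h i) := by
  exact PiTensorProduct.map₂_tprod_tprod _ _ _

lemma tensorAct_insertAt (i : Fin (n + 1)) (c : C) (y : ⨂[k]^n C) (h : H) (u : ⨂[k]^n H) :
    tensorAct k H C (n + 1) (insertAt i (c ⊗ₜ y)) (insertAt i (h ⊗ₜ u)) =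
      insertAt i (RightModuleCoalgebra.act (k := k) c h ⊗ₜ tensorAct k H C n y u) := by
  induction y using PiTensorProduct.induction_on with
  | add a b ha hb => simp only [map_add, TensorProduct.tmul_add, LinearMap.add_apply, ha, hb]
  | smul_tprod r x =>
    induction u using PiTensorProduct.induction_on with
    | add a b ha hb => simp only [map_add, TensorProduct.tmul_add, ha, hb]
    | smul_tprod s z =>
      simp only [map_smul, TensorProduct.tmul_smul, LinearMap.smul_apply, insertAt_tmul,
        tensorAct_tprod]
      congr 3
      funext j
      refine Fin.succAboveCases i ?_ (fun j => ?_) j <;> simp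

lemma removeAt_last_iterComul (h : H) : removeAt (Fin.last n) (iterComul k H (n + 1) h) =
    TensorProduct.comm k _ _ ((iterComul k H n).rTensor H (Coalgebra.comul (R := k) h)) := by
  induction n generalizing h with
  | zero =>
    have h1 : ∀ z : H ⊗[k] H, (iterComul k H 0).lTensor H z = TensorProduct.map LinearMap.id
        (LinearMap.toSpanSingleton k (⨂[k]^0 H) 1) ((Coalgebra.counit (R := k)).lTensor H z) := by
      intro z
      induction z using TensorProduct.induction_on with
      | zero => simp
      | add a b ha hb => simp only [map_add, ha, hb]
      | tmul c w => simp [iterComul_zero]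
    have h2 : ∀ z : H ⊗[k] H, (iterComul k H 0).rTensor H z = TensorProduct.map
        (LinearMap.toSpanSingleton k (⨂[k]^0 H) 1) LinearMap.id
        ((Coalgebra.counit (R := k)).rTensor H z) := by
      intro z
      induction z using TensorProduct.induction_on with
      | zero => simp
      | add a b ha hb => simp only [map_add, ha, hb]
      | tmul c w => simp [iterComul_zero]
    rw [iterComul_succ, Fin.last_zero, removeAt_insertAt, h1, h2, Coalgebra.rTensor_counit_comul,
      Coalgebra.lTensor_counit_comul]
    simp
  | succ n ih =>
    have h1 : ∀ z : H ⊗[k] H, removeAt (Fin.last (n + 1))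
        (insertAt 0 ((iterComul k H (n + 1)).lTensor H z)) =
        TensorProduct.comm k _ _ ((insertAt 0 ∘ₗ (iterComul k H n).lTensor H).rTensor H
          ((TensorProduct.assoc k H H H).symm ((Coalgebra.comul (R := k)).lTensor H z))) := by
      intro z
      induction z using TensorProduct.induction_on with
      | zero => simp
      | add a b ha hb => simp only [map_add, ha, hb]
      | tmul c w =>
        rw [LinearMap.lTensor_tmul, ← Fin.succ_last, removeAt_succ_insertAt_zero, ih,
          LinearMap.lTensor_tmul]
        generalize Coalgebra.comul (R := k) w = q
        induction q using TensorProduct.induction_on with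
        | zero => simp
        | add a b ha hb => simp only [map_add, TensorProduct.tmul_add, ha, hb]
        | tmul x y => simp
    have h2 : ∀ z : H ⊗[k] H, (iterComul k H (n + 1)).rTensor H z =
        (insertAt 0 ∘ₗ (iterComul k H n).lTensor H).rTensor H
          ((Coalgebra.comul (R := k)).rTensor H z) := by
      intro z
      induction z using TensorProduct.induction_on with
      | zero => simp
      | add a b ha hb => simp only [map_add, ha, hb]
      | tmul c w => rfl
    rw [iterComul_succ, h1, h2, ← Coalgebra.coassoc_apply, LinearEquiv.symm_apply_apply]

lemma counitAt_tensorAct (i : Fin (n + 1)) (w : ⨂[k]^(n + 1) C) (u : ⨂[k]^(n + 1) H) :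
    counitAt k C n i (tensorAct k H C (n + 1) w u) =
      tensorAct k H C n (counitAt k C n i w) (counitAt k H n i u) := by
  induction w using insertAt_induction (i := i) with
  | h0 => simp
  | hadd x y hx hy => simp only [map_add, LinearMap.add_apply, hx, hy]
  | h v y =>
    induction u using insertAt_induction (k := k) (V := H) (i := i) with
    | h0 => simp
    | hadd x y hx hy => simp only [map_add, hx, hy]
    | h h u =>
      rw [tensorAct_insertAt]
      simp only [counitAt, LinearMap.comp_apply, removeAt_insertAt, LinearMap.rTensor_tmul,
        LinearEquiv.coe_coe, TensorProduct.lid_tmul, RightModuleCoalgebra.counit_act, map_smul,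
        LinearMap.smul_apply, smul_smul]
      rw [mul_comm]

lemma dupAt_tensorAct (i : Fin (n + 1)) (w : ⨂[k]^(n + 1) C) (u : ⨂[k]^(n + 1) H) :
    dupAt (Coalgebra.comul (R := k)) i (tensorAct k H C (n + 1) w u) =
      tensorAct k H C (n + 2) (dupAt (Coalgebra.comul (R := k)) i w)
        (dupAt (Coalgebra.comul (R := k)) i u) := by
  induction w using insertAt_induction (i := i) with
  | h0 => simp
  | hadd x y hx hy => simp only [map_add, LinearMap.add_apply, hx, hy]
  | h v y =>
    induction u using insertAt_induction (k := k) (V := H) (i := i) with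
    | h0 => simp
    | hadd x y hx hy => simp only [map_add, hx, hy]
    | h h u =>
      rw [tensorAct_insertAt, dupAt_insertAt, dupAt_insertAt, dupAt_insertAt,
        RightModuleCoalgebra.comul_act]
      generalize Coalgebra.comul (R := k) v = p
      generalize Coalgebra.comul (R := k) h = q
      induction p using TensorProduct.induction_on with
      | zero => simp
      | add a b ha hb => simp only [map_add, TensorProduct.add_tmul, LinearMap.add_apply, ha, hb]
      | tmul x x' =>
        induction q using TensorProduct.induction_on with
        | zero => simp
        | add a b ha hb => simp only [map_add, TensorProduct.add_tmul, ha, hb]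
        | tmul z z' => simp [insertPairAt, tensorAct_insertAt]

lemma counitAt_diagAct (i : Fin (n + 1)) (h : H) (w : ⨂[k]^(n + 1) C) :
    counitAt k C n i (diagAct k H C (n + 1) h w) = diagAct k H C n h (counitAt k C n i w) := by
  simp only [diagAct, LinearMap.flip_apply, counitAt_tensorAct, counitAt_iterComul]

lemma dupAt_diagAct (i : Fin (n + 1)) (h : H) (w : ⨂[k]^(n + 1) C) :
    dupAt (Coalgebra.comul (R := k)) i (diagAct k H C (n + 1) h w) =
      diagAct k H C (n + 2) h (dupAt (Coalgebra.comul (R := k)) i w) := by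
  simp only [diagAct, LinearMap.flip_apply, dupAt_tensorAct, dupAt_iterComul]

/-- The map `(x ⊗ (y ⊗ z)) ⊗ (m ⊗ g) ↦ y · m ⊗ z g S(x)`. -/
def aydShuffle : (H ⊗[k] (H ⊗[k] H)) ⊗[k] (Coeff k H A ⊗[k] H) →ₗ[k] Coeff k H A ⊗[k] H :=
  TensorProduct.map (TensorProduct.lift (coeffAct k H A)) (conjMul k H) ∘ₗ
    (TensorProduct.tensorTensorTensorComm k H (H ⊗[k] H) (Coeff k H A) H).toLinearMap ∘ₗ
    (TensorProduct.leftComm k H H H).toLinearMap.rTensor (Coeff k H A ⊗[k] H)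

lemma aydShuffle_tmul (x y z g : H) (m : Coeff k H A) :
    aydShuffle ((x ⊗ₜ (y ⊗ₜ z)) ⊗ₜ (m ⊗ₜ g)) =
      coeffAct k H A y m ⊗ₜ (z * g * HopfAlgebra.antipode k x) := rfl

lemma coeffCoact_coeffAct (h : H) (m : Coeff k H A) :
    coeffCoact k H A (coeffAct k H A h m) = aydShuffle (comul₂ h ⊗ₜ coeffCoact k H A m) := by
  obtain ⟨r, rfl⟩ := Submodule.mkQ_surjective _ m
  induction r using TensorProduct.induction_on with
  | zero => simp
  | add a b ha hb => simp only [map_add, TensorProduct.tmul_add, ha, hb]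
  | tmul h' a =>
    change (coeffRel k H A).mkQ.rTensor H (coactShuffle k H A (comul₂ (h * h') ⊗ₜ coact k H A a)) =
      aydShuffle (comul₂ h ⊗ₜ (coeffRel k H A).mkQ.rTensor H
        (coactShuffle k H A (comul₂ h' ⊗ₜ coact k H A a)))
    rw [comul₂_mul]
    generalize comul₂ (k := k) h = p
    generalize comul₂ (k := k) h' = p'
    generalize coact k H A a = q
    induction q using TensorProduct.induction_on with
    | zero => simp
    | add a b ha hb => simp only [map_add, TensorProduct.tmul_add, ha, hb]
    | tmul b g =>
    induction p using TensorProduct.induction_on with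
    | zero => simp
    | add a b ha hb => simp only [map_add, add_mul, TensorProduct.add_tmul, ha, hb]
    | tmul x p =>
    induction p using TensorProduct.induction_on with
    | zero => simp
    | add a b ha hb => simp only [map_add, add_mul, TensorProduct.tmul_add, TensorProduct.add_tmul,
        ha, hb]
    | tmul y z =>
    induction p' using TensorProduct.induction_on with
    | zero => simp
    | add a b ha hb => simp only [map_add, mul_add, TensorProduct.add_tmul, TensorProduct.tmul_add,
        ha, hb]
    | tmul x' p =>
    induction p using TensorProduct.induction_on with
    | zero => simp
    | add a b ha hb => simp only [map_add, mul_add, TensorProduct.tmul_add, TensorProduct.add_tmul,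
        ha, hb]
    | tmul y' z' =>
      rw [Algebra.TensorProduct.tmul_mul_tmul, Algebra.TensorProduct.tmul_mul_tmul,
        coactShuffle_tmul, coactShuffle_tmul, LinearMap.rTensor_tmul, LinearMap.rTensor_tmul,
        aydShuffle_tmul, HopfAlgebra.antipode_mul_antidistrib]
      simp only [mul_assoc]
      rfl

/-- `S(h₍₁₎) h₍₂₎ ⊗ h₍₃₎ = 1 ⊗ h`. -/
lemma antipode_mul_comul (s : H) :
    (LinearMap.mul' k H ∘ₗ (HopfAlgebra.antipode k).rTensor H).rTensor H
      ((TensorProduct.assoc k H H H).symm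
        ((Coalgebra.comul (R := k)).lTensor H (Coalgebra.comul (R := k) s))) = 1 ⊗ₜ s := by
  rw [← Coalgebra.coassoc_apply, LinearEquiv.symm_apply_apply]
  have : ∀ z : H ⊗[k] H, (LinearMap.mul' k H ∘ₗ (HopfAlgebra.antipode k).rTensor H).rTensor H
      ((Coalgebra.comul (R := k)).rTensor H z) =
      (Algebra.linearMap k H).rTensor H ((Coalgebra.counit (R := k)).rTensor H z) := by
    intro z
    induction z using TensorProduct.induction_on with
    | zero => simp
    | add a b ha hb => simp only [map_add, ha, hb]
    | tmul x y => simp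
  rw [this, Coalgebra.rTensor_counit_comul]
  simp

/-- `x ⊗ (y ⊗ z) ↦ S(x) y₍₁₎ ⊗ (y₍₂₎ ⊗ z)`. -/
def antipodeAux : H ⊗[k] (H ⊗[k] H) →ₗ[k] H ⊗[k] (H ⊗[k] H) :=
  (TensorProduct.assoc k H H H).toLinearMap ∘ₗ
    ((LinearMap.mul' k H ∘ₗ (HopfAlgebra.antipode k).rTensor H).rTensor H ∘ₗ
      (TensorProduct.assoc k H H H).symm.toLinearMap ∘ₗ
      (Coalgebra.comul (R := k)).lTensor H).rTensor H ∘ₗ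
    (TensorProduct.assoc k H H H).symm.toLinearMap

lemma antipodeAux_comul₂ (s : H) :
    antipodeAux (comul₂ (k := k) s) = 1 ⊗ₜ Coalgebra.comul (R := k) s := by
  rw [comul₂, LinearMap.comp_apply, ← Coalgebra.coassoc_apply, antipodeAux, LinearMap.comp_apply,
    LinearMap.comp_apply, LinearEquiv.coe_coe, LinearEquiv.coe_coe, LinearEquiv.symm_apply_apply]
  generalize Coalgebra.comul (R := k) s = z
  induction z using TensorProduct.induction_on with
  | zero => simp
  | add a b ha hb => simp only [map_add, TensorProduct.tmul_add, ha, hb]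
  | tmul x y =>
    rw [LinearMap.rTensor_tmul, LinearMap.rTensor_tmul, LinearMap.comp_apply, LinearMap.comp_apply,
      LinearEquiv.coe_coe, antipode_mul_comul, TensorProduct.assoc_tmul]

lemma mk_hopfRel (w : ⨂[k]^(n + 1) C) (h : H) (m : Coeff k H A) :
    (hopfRel k H A C n).mkQ (diagAct k H C (n + 1) h w ⊗ₜ m) =
      (hopfRel k H A C n).mkQ (w ⊗ₜ coeffAct k H A h m) := by
  rw [← sub_eq_zero, ← map_sub, Submodule.mkQ_apply, Submodule.Quotient.mk_eq_zero]
  exact Submodule.subset_span ⟨w, h, m, rfl⟩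

lemma hopfRel_le_ker {X : Type*} [AddCommGroup X] [Module k X]
    (G : ⨂[k]^(n + 1) C ⊗[k] Coeff k H A →ₗ[k] X)
    (h : ∀ (w : ⨂[k]^(n + 1) C) (h : H) (m : Coeff k H A),
      G (diagAct k H C (n + 1) h w ⊗ₜ m) = G (w ⊗ₜ coeffAct k H A h m)) :
    hopfRel k H A C n ≤ LinearMap.ker G := by
  refine Submodule.span_le.2 ?_
  rintro _ ⟨w, g, m, rfl⟩
  simp [h]

/-- `(m ⊗ g) ↦ (cₙ · g ⊗ c₀ ⊗ ⋯ ⊗ cₙ₋₁) ⊗ m`. -/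
def cycAux (n : ℕ) (w : ⨂[k]^(n + 1) C) :
    Coeff k H A ⊗[k] H →ₗ[k] ⨂[k]^(n + 1) C ⊗[k] Coeff k H A :=
  ((rotateBy (RightModuleCoalgebra.act (k := k) (H := H) (C := C)).flip n).flip w).rTensor
    (Coeff k H A) ∘ₗ (TensorProduct.comm k (Coeff k H A) H).toLinearMap

lemma freeCyc_tmul (w : ⨂[k]^(n + 1) C) (m : Coeff k H A) :
    freeCyc k H A C n (w ⊗ₜ m) = cycAux n w (coeffCoact k H A m) := by
  simp only [freeCyc, LinearMap.comp_apply, LinearMap.lTensor_tmul]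
  generalize coeffCoact k H A m = e
  induction e using TensorProduct.induction_on with
  | zero => simp
  | add a b ha hb => simp only [map_add, TensorProduct.tmul_add, ha, hb]
  | tmul m g => simp [cycAux]

lemma cycAux_insertAt (c : C) (y : ⨂[k]^n C) (m : Coeff k H A) (g : H) :
    cycAux n (insertAt (Fin.last n) (c ⊗ₜ y)) (m ⊗ₜ g) =
      insertAt 0 (RightModuleCoalgebra.act (k := k) c g ⊗ₜ y) ⊗ₜ m := by
  simp [cycAux, rotateBy_apply, rotate, removeAt_insertAt, opAt_insertAt_self]

lemma diagAct_insertAt_zero (c : C) (y : ⨂[k]^n C) (h : H) :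
    diagAct k H C (n + 1) h (insertAt 0 (c ⊗ₜ y)) =
      insertAt 0 (TensorProduct.map (RightModuleCoalgebra.act (k := k) c)
        (tensorAct k H C n y ∘ₗ iterComul k H n) (Coalgebra.comul (R := k) h)) := by
  rw [diagAct, LinearMap.flip_apply, iterComul_succ]
  generalize Coalgebra.comul (R := k) h = z
  induction z using TensorProduct.induction_on with
  | zero => simp
  | add a b ha hb => simp only [map_add, ha, hb]
  | tmul x y => simp [tensorAct_insertAt]

lemma diagAct_insertAt_last (c : C) (y : ⨂[k]^n C) (h : H) :
    diagAct k H C (n + 1) h (insertAt (Fin.last n) (c ⊗ₜ y)) =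
      insertAt (Fin.last n) (TensorProduct.map (RightModuleCoalgebra.act (k := k) c)
        (tensorAct k H C n y ∘ₗ iterComul k H n)
        (TensorProduct.comm k H H (Coalgebra.comul (R := k) h))) := by
  rw [diagAct, LinearMap.flip_apply, ← insertAt_removeAt (Fin.last n) (iterComul k H (n + 1) h),
    removeAt_last_iterComul]
  generalize Coalgebra.comul (R := k) h = z
  induction z using TensorProduct.induction_on with
  | zero => simp
  | add a b ha hb => simp only [map_add, ha, hb]
  | tmul x y => simp [tensorAct_insertAt]

lemma freeCyc_relation (w : ⨂[k]^(n + 1) C) (h : H) (m : Coeff k H A) :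
    (hopfRel k H A C n).mkQ (freeCyc k H A C n (diagAct k H C (n + 1) h w ⊗ₜ m)) =
      (hopfRel k H A C n).mkQ (freeCyc k H A C n (w ⊗ₜ coeffAct k H A h m)) := by
  rw [freeCyc_tmul, freeCyc_tmul, coeffCoact_coeffAct]
  generalize coeffCoact k H A m = e
  induction e using TensorProduct.induction_on with
  | zero => simp
  | add a b ha hb => simp only [map_add, TensorProduct.tmul_add, ha, hb]
  | tmul m g =>
    induction w using insertAt_induction (i := Fin.last n) with
    | h0 => simp [cycAux]
    | hadd x y hx hy =>
      have : ∀ a b : ⨂[k]^(n + 1) C, cycAux (H := H) (A := A) n (a + b) =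
          cycAux n a + cycAux n b := fun a b => by
        simp [cycAux, LinearMap.rTensor_add, LinearMap.add_comp]
      simp only [map_add, this, LinearMap.add_apply, hx, hy]
    | h c y =>
      let L : H ⊗[k] (H ⊗[k] H) →ₗ[k] HopfCyclicModule k H A C n :=
        (hopfRel k H A C n).mkQ ∘ₗ (TensorProduct.mk k _ _).flip m ∘ₗ insertAt 0 ∘ₗ
          TensorProduct.map (RightModuleCoalgebra.act (k := k) c)
            (tensorAct k H C n y ∘ₗ iterComul k H n) ∘ₗ
          (LinearMap.mul' k H ∘ₗ (TensorProduct.comm k H H).toLinearMap ∘ₗ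
            (LinearMap.mulLeft k g).rTensor H).rTensor H ∘ₗ
          (TensorProduct.comm k H (H ⊗[k] H)).toLinearMap ∘ₗ
          (TensorProduct.leftComm k H H H).toLinearMap
      have h1 : ∀ p : H ⊗[k] (H ⊗[k] H), (hopfRel k H A C n).mkQ
          (cycAux n (insertAt (Fin.last n) (c ⊗ₜ y)) (aydShuffle (p ⊗ₜ (m ⊗ₜ g)))) =
          L (antipodeAux p) := by
        intro p
        induction p using TensorProduct.induction_on with
        | zero => simp
        | add a b ha hb => simp only [map_add, TensorProduct.add_tmul, ha, hb]
        | tmul x p =>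
        induction p using TensorProduct.induction_on with
        | zero => simp
        | add a b ha hb => simp only [map_add, TensorProduct.tmul_add, TensorProduct.add_tmul,
            ha, hb]
        | tmul v z =>
          rw [aydShuffle_tmul, cycAux_insertAt, ← mk_hopfRel, diagAct_insertAt_zero]
          simp only [antipodeAux, LinearMap.comp_apply, LinearEquiv.coe_coe,
            TensorProduct.assoc_symm_tmul, LinearMap.rTensor_tmul, LinearMap.lTensor_tmul]
          generalize Coalgebra.comul (R := k) v = q
          induction q using TensorProduct.induction_on with
          | zero => simp
          | add a b ha hb => simp only [map_add, TensorProduct.tmul_add, TensorProduct.add_tmul,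
              ha, hb]
          | tmul v₁ v₂ => simp [L, ← RightModuleCoalgebra.act_mul, mul_assoc]
      rw [h1, antipodeAux_comul₂, diagAct_insertAt_last]
      generalize Coalgebra.comul (R := k) h = q
      induction q using TensorProduct.induction_on with
      | zero => simp [cycAux]
      | add a b ha hb =>
        have : ∀ a b : ⨂[k]^(n + 1) C, cycAux (H := H) (A := A) n (a + b) =
            cycAux n a + cycAux n b := fun a b => by
          simp [cycAux, LinearMap.rTensor_add, LinearMap.add_comp]
        simp only [map_add, TensorProduct.tmul_add, this, LinearMap.add_apply, ha, hb]
      | tmul v₁ v₂ =>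
        simp [L, cycAux_insertAt, ← RightModuleCoalgebra.act_mul]

end lemmas

/-- The class of `(c₀ ⊗ ⋯ ⊗ cₙ) ⊗_H m`. -/
def hopfMk (n : ℕ) (w : ⨂[k]^(n + 1) C) (m : Coeff k H A) : HopfCyclicModule k H A C n :=
  (hopfRel k H A C n).mkQ (w ⊗ₜ m)

/-- The face `dᵢ(c₀ ⊗ ⋯ ⊗ cₙ₊₁ ⊗ m) = ε(cᵢ) c₀ ⊗ ⋯ ĉᵢ ⋯ ⊗ cₙ₊₁ ⊗ m`. -/
def hopfFace (n : ℕ) (i : Fin (n + 2)) :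
    HopfCyclicModule k H A C (n + 1) →ₗ[k] HopfCyclicModule k H A C n :=
  (hopfRel k H A C (n + 1)).liftQ
    ((hopfRel k H A C n).mkQ ∘ₗ (counitAt k C (n + 1) i).rTensor (Coeff k H A))
    (hopfRel_le_ker _ fun w h m => by
      simp only [LinearMap.comp_apply, LinearMap.rTensor_tmul]
      rw [counitAt_diagAct, mk_hopfRel])

/-- The degeneracy `sⱼ(c₀ ⊗ ⋯ ⊗ cₙ ⊗ m) = c₀ ⊗ ⋯ ⊗ Δ(cⱼ) ⊗ ⋯ ⊗ cₙ ⊗ m`. -/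
def hopfDegeneracy (n : ℕ) (j : Fin (n + 1)) :
    HopfCyclicModule k H A C n →ₗ[k] HopfCyclicModule k H A C (n + 1) :=
  (hopfRel k H A C n).liftQ
    ((hopfRel k H A C (n + 1)).mkQ ∘ₗ
      (dupAt (Coalgebra.comul (R := k)) j).rTensor (Coeff k H A))
    (hopfRel_le_ker _ fun w h m => by
      simp only [LinearMap.comp_apply, LinearMap.rTensor_tmul]
      rw [dupAt_diagAct, mk_hopfRel])

/-- The cyclic operator `t(c₀ ⊗ ⋯ ⊗ cₙ ⊗ m) = cₙ · m₍₁₎ ⊗ c₀ ⊗ ⋯ ⊗ cₙ₋₁ ⊗ m₍₀₎`. -/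
def hopfCyc (n : ℕ) : HopfCyclicModule k H A C n →ₗ[k] HopfCyclicModule k H A C n :=
  (hopfRel k H A C n).liftQ ((hopfRel k H A C n).mkQ ∘ₗ freeCyc k H A C n)
    (hopfRel_le_ker _ fun w h m => freeCyc_relation w h m)

end Target

section CyclicModules

/-- The identities of a cyclic `k`-module: `(X, d, s)` is a simplicial module and the operators
`tₙ` satisfy `tₙⁿ⁺¹ = 1` and the compatibility relations with faces and degeneracies. -/
structure IsCyclicModule {k : Type*} [CommRing k] {X : ℕ → Type*} [∀ n, AddCommMonoid (X n)]
    [∀ n, Module k (X n)] (d : ∀ n, Fin (n + 2) → X (n + 1) →ₗ[k] X n)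
    (s : ∀ n, Fin (n + 1) → X n →ₗ[k] X (n + 1)) (t : ∀ n, X n →ₗ[k] X n) : Prop where
  /-- `dᵢ dⱼ₊₁ = dⱼ dᵢ` for `i ≤ j`. -/
  face_face : ∀ (n : ℕ) (i j : Fin (n + 2)), i ≤ j →
    d n i ∘ₗ d (n + 1) j.succ = d n j ∘ₗ d (n + 1) i.castSucc
  /-- `sᵢ sⱼ = sⱼ₊₁ sᵢ` for `i ≤ j`. -/
  degeneracy_degeneracy : ∀ (n : ℕ) (i j : Fin (n + 1)), i ≤ j →
    s (n + 1) i.castSucc ∘ₗ s n j = s (n + 1) j.succ ∘ₗ s n i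
  /-- `dᵢ sⱼ₊₁ = sⱼ dᵢ` for `i ≤ j`. -/
  face_degeneracy_of_le : ∀ (n : ℕ) (i : Fin (n + 2)) (j : Fin (n + 1)), i ≤ j.castSucc →
    d (n + 1) i.castSucc ∘ₗ s (n + 1) j.succ = s n j ∘ₗ d n i
  /-- `dⱼ sⱼ = 1`. -/
  face_degeneracy_self : ∀ (n : ℕ) (j : Fin (n + 1)), d n j.castSucc ∘ₗ s n j = LinearMap.id
  /-- `dⱼ₊₁ sⱼ = 1`. -/
  face_degeneracy_succ : ∀ (n : ℕ) (j : Fin (n + 1)), d n j.succ ∘ₗ s n j = LinearMap.id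
  /-- `dᵢ₊₁ sⱼ = sⱼ dᵢ` for `i > j`. -/
  face_degeneracy_of_gt : ∀ (n : ℕ) (i : Fin (n + 2)) (j : Fin (n + 1)), j.castSucc < i →
    d (n + 1) i.succ ∘ₗ s (n + 1) j.castSucc = s n j ∘ₗ d n i
  /-- `tₙⁿ⁺¹ = 1`. -/
  cyc_pow : ∀ (n : ℕ), t n ^ (n + 1) = 1
  /-- `d₀ t = dₙ₊₁` on `Xₙ₊₁`. -/
  face_zero_cyc : ∀ (n : ℕ), d n 0 ∘ₗ t (n + 1) = d n (Fin.last (n + 1))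
  /-- `dᵢ₊₁ t = t dᵢ`. -/
  face_succ_cyc : ∀ (n : ℕ) (i : Fin (n + 1)), d n i.succ ∘ₗ t (n + 1) = t n ∘ₗ d n i.castSucc
  /-- `s₀ t = t² sₙ` on `Xₙ`. -/
  degeneracy_zero_cyc : ∀ (n : ℕ), s n 0 ∘ₗ t n = t (n + 1) ∘ₗ t (n + 1) ∘ₗ s n (Fin.last n)
  /-- `sᵢ₊₁ t = t sᵢ`. -/
  degeneracy_succ_cyc : ∀ (n : ℕ) (i : Fin n),
    s n i.succ ∘ₗ t n = t (n + 1) ∘ₗ s n i.castSucc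

end CyclicModules

section Maps

variable (k H A C : Type*) [CommRing k] [Ring H] [HopfAlgebra k H] [Ring A] [Algebra k A]
  [RightComoduleAlgebra k H A] [AddCommGroup C] [Module k C] [Coalgebra k C]
  [RightModuleCoalgebra k H C]

/-- The element `a₍₀₎ ⊗ (a₍₁₎ ⊗ ⋯ ⊗ a₍ⱼ₎ ⊗ 1 ⊗ ⋯ ⊗ 1)` of `A ⊗ H^{⊗(n+1)}`. -/
def coactLegs (n j : ℕ) : A →ₗ[k] A ⊗[k] (⨂[k]^(n + 1) H) :=
  (legs k H (n + 1) j).lTensor A ∘ₗ coact k H A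

/-- The element of `C^{⊗(n+1)} ⊗_H M` given by
`(c₀ · a₁₍₁₎⋯aₙ₍₁₎ ⊗ c₁ · a₂₍₂₎⋯aₙ₍₂₎ ⊗ ⋯ ⊗ cₙ₋₁ · aₙ₍ₙ₎ ⊗ cₙ) ⊗_H [1 ⊗ a₀ a₁₍₀₎⋯aₙ₍₀₎]`.
The products in the factors `A, H, …, H` are those of the algebra `A ⊗ H^{⊗(n+1)}`. -/
def phiFormula (n : ℕ) (a : Fin (n + 1) → A) (c : Fin (n + 1) → C) : HopfCyclicModule k H A C n :=
  TensorProduct.lift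
    (LinearMap.mk₂ k
      (fun (b : A) (u : ⨂[k]^(n + 1) H) =>
        hopfMk k H A C n (tensorAct k H C (n + 1) (PiTensorProduct.tprod k c) u)
          ((coeffRel k H A).mkQ (1 ⊗ₜ b)))
      (fun b b' u => by simp [hopfMk, TensorProduct.tmul_add])
      (fun r b u => by simp [hopfMk, TensorProduct.tmul_smul])
      (fun b u u' => by simp [hopfMk, TensorProduct.add_tmul])
      (fun r b u => by simp only [hopfMk, map_smul, ← TensorProduct.smul_tmul']))
    ((List.ofFn fun j : Fin (n + 1) => coactLegs k H A n j (a j)).prod)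

/-- The element of `((A ⊗ C) ⊗_A ⋯ ⊗_A (A ⊗ C)) ⊗_{Aᵉ} A` given by
`((1 ⊗ c₀ · h₍₁₎ S⁻¹(a₍ₙ₊₁₎)) ⊗_A (1 ⊗ c₁ · h₍₂₎ S⁻¹(a₍ₙ₎)) ⊗_A ⋯ ⊗_A
(1 ⊗ cₙ · h₍ₙ₊₁₎ S⁻¹(a₍₁₎))) ⊗_{Aᵉ} a₍₀₎`. -/
def psiFormula (Sinv : H →ₗ[k] H) (n : ℕ) (c : Fin (n + 1) → C) (h : H) (a : A) :
    CoringCyclic (galoisCoring k H A C) n :=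
  TensorProduct.lift
    (LinearMap.mk₂ k
      (fun (b : A) (u : ⨂[k]^(n + 1) H) =>
        coringMk (galoisCoring k H A C) n
          (PiTensorProduct.map (fun _ => TensorProduct.mk k A C 1)
            (tensorAct k H C (n + 1) (diagAct k H C (n + 1) h (PiTensorProduct.tprod k c))
              (PiTensorProduct.reindex k (fun _ => H) Fin.revPerm
                (PiTensorProduct.map (fun _ => Sinv) u)))) b)
      (fun b b' u => by simp [coringMk, TensorProduct.tmul_add])
      (fun r b u => by simp [coringMk, TensorProduct.tmul_smul])
      (fun b u u' => by simp [coringMk, TensorProduct.add_tmul])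
      (fun r b u => by simp only [coringMk, map_smul, ← TensorProduct.smul_tmul']))
    ((iterComul k H (n + 1)).lTensor A (coact k H A a))

end Maps

end HopfCyclic
end

open scoped TensorProduct

noncomputable section

namespace HopfCyclic

set_option linter.unusedSectionVars false

/-! ### Tensor powers of a coalgebra: rotation and the simplicial identities. -/

section Coalgebra

variable {k V : Type*} [CommRing k] [AddCommGroup V] [Module k V] {n : ℕ}

/-! Both `X_n` and `Y_n` are the same quotient of `A ⊗ C^{⊗(n+1)}`. On the source side, the factors
from `A` can be moved to the far left across those from `C`, on which they act through the coaction.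
This gives `(A ⊗ C)^{⊗_A (n+1)} ≅ A ⊗ C^{⊗(n+1)}` (`collect` and `spread`, with `collect_balanced`,
`collect_spread` and `mk_spread_collect`). The left action of `A` becomes multiplication, and the
right action becomes `(b ⊗ u) · a = b a₍₀₎ ⊗ u · a₍₁₎` (`collect_left`, `collect_right`). Tensoring
with `A` over `Aᵉ` then identifies `a z` with `z a`.

On the target side, `H ⊗ A` is a free left `H`-module on `A`, so every element of `Y_n` is a sum of
terms `u ⊗_H [1 ⊗ a]`, and the relation defining `M` becomes `u · a'₍₁₎ ⊗ [1 ⊗ a a'₍₀₎] = u ⊗ [1 ⊗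
a' a]`. This is again `z a' = a' z` (`toHopf_diagRight`, `freeHopfToCoring_relation`). The two
quotients therefore agree, and the inverse of `Φ` can be written without an inverse antipode: `u ⊗_H
[h ⊗ a]` goes to the class of `u · h`, with `1 ∈ A` in each factor, and coefficient `a`.

Compatibility with faces and degeneracies holds before the last quotient is taken
(`collect_freeFace`, `collect_dupAt`): it uses that the coring counit is bilinear, that the coaction
is coassociative and that `C` is a module coalgebra. For the cyclic operators one takes
representatives with all entries `1 ⊗ cᵢ` and coefficient `a`. Then `τ` puts `(1 ⊗ cₙ) a = a₍₀₎ ⊗ cₙ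
· a₍₁₎` in front, which is what the coaction of `[1 ⊗ a]` prescribes for `t`.

The cyclic identities are divided between the two sides. Those in which the rotated factor is not
touched are visible on `Y`, where they concern only the coalgebra `C`. The remaining three, `t^{n+1}
= 1`, `d₀ t = d_{last}` and `s₀ t = t² s_{last}`, are easy on `X`: every class has a representative
with coefficient `1` (`exists_coringMk_one`), on which `τ` is the plain rotation. They pass to `Y`
along `Φ`, and the complete list then returns to `X` along the injective `Φ`.

The formula for `Φ` comes from reading `collect` as a product in the algebra `A ⊗ H^{⊗(n+1)}`
(`collect_tprod`). The formula for `Ψ` is verified by applying `Φ`: the right action of `a₍₀₎`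
produces legs that cancel against `S⁻¹` of the others, by iterating `S⁻¹(h₍₂₎) h₍₁₎ = ε(h)`
(`revMul_comul`). -/

lemma insertPairAt_zero_tmul (v w : V) (y : ⨂[k]^n V) :
    insertPairAt 0 ((v ⊗ₜ[k] w) ⊗ₜ[k] y) = insertAt 0 (v ⊗ₜ insertAt 0 (w ⊗ₜ y)) := rfl

lemma dupAt_zero_insertAt (Δ : V →ₗ[k] V ⊗[k] V) (v : V) (y : ⨂[k]^n V) :
    dupAt Δ 0 (insertAt 0 (v ⊗ₜ y)) =
      insertAt 0 ((insertAt 0).lTensor V (TensorProduct.assoc k V V _ (Δ v ⊗ₜ y))) := by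
  rw [dupAt_insertAt]
  rfl

lemma rotate_insertAt_last (v : V) (y : ⨂[k]^n V) :
    rotate k V n (insertAt (Fin.last n) (v ⊗ₜ y)) = insertAt 0 (v ⊗ₜ y) := by
  rw [rotate, LinearMap.comp_apply, removeAt_insertAt]

lemma insertAt_zero_insertAt_last (v w : V) (y : ⨂[k]^n V) :
    insertAt 0 (v ⊗ₜ insertAt (Fin.last n) (w ⊗ₜ y)) =
      insertAt (Fin.last (n + 1)) (w ⊗ₜ insertAt 0 (v ⊗ₜ[k] y)) := by
  induction y using PiTensorProduct.induction_on with
  | smul_tprod r x =>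
    simp only [map_smul, TensorProduct.tmul_smul, insertAt_tmul, Fin.insertNth_zero',
      Fin.insertNth_last', Fin.cons_snoc_eq_snoc_cons]
  | add a b ha hb => simp only [map_add, TensorProduct.tmul_add, ha, hb]

/-- Subtraction in `Fin (n + 1)` wraps around, so `0 - 1` is the last index. In this form iterating
the rotation is subtracting a multiple of `1` in a cyclic group of order `n + 1`, which gives
`rotate_pow`. -/
lemma rotate_tprod (x : Fin (n + 1) → V) :
    rotate k V n (PiTensorProduct.tprod k x) = PiTensorProduct.tprod k fun i => x (i - 1) := by
  rw [rotate, LinearMap.comp_apply, removeAt_tprod, insertAt_tmul]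
  congr 1
  funext i
  refine Fin.cases ?_ (fun j => ?_) i
  · rw [Fin.insertNth_apply_same, zero_sub, eq_neg_of_add_eq_zero_left (Fin.last_add_one n)]
  · rw [Fin.insertNth_zero', Fin.cons_succ, Fin.removeNth, Fin.succAbove_last,
      eq_sub_of_add_eq (Fin.coeSucc_eq_succ (a := j))]

lemma rotate_iterate_tprod (x : Fin (n + 1) → V) (m : ℕ) :
    (rotate k V n)^[m] (PiTensorProduct.tprod k x) =
      PiTensorProduct.tprod k fun i => x (i - m • 1) := by
  induction m with
  | zero => simp
  | succ m ih =>
    rw [Function.iterate_succ_apply', ih, rotate_tprod]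
    congr 1
    funext i
    rw [succ_nsmul', sub_sub]

lemma rotate_pow (k V : Type*) [CommRing k] [AddCommGroup V] [Module k V] (n : ℕ) :
    rotate k V n ^ (n + 1) = 1 := by
  refine LinearMap.ext fun w => ?_
  rw [Module.End.one_apply]
  induction w using PiTensorProduct.induction_on with
  | smul_tprod r x =>
    rw [map_smul, Module.End.pow_apply, rotate_iterate_tprod]
    have h : (n + 1) • (1 : Fin (n + 1)) = 0 := by
      simpa using card_nsmul_eq_zero (x := (1 : Fin (n + 1)))
    rw [show (fun i => x (i - (n + 1) • 1)) = x from funext fun i => by rw [h, sub_zero]]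
  | add a b ha hb => rw [map_add, ha, hb]

variable {C : Type*} [AddCommGroup C] [Module k C] [Coalgebra k C]

lemma counitAt_insertAt (i : Fin (n + 1)) (c : C) (y : ⨂[k]^n C) :
    counitAt k C n i (insertAt i (c ⊗ₜ y)) = Coalgebra.counit (R := k) c • y := by
  simp only [counitAt, LinearMap.comp_apply, removeAt_insertAt, LinearMap.rTensor_tmul,
    LinearEquiv.coe_coe, TensorProduct.lid_tmul]

/-- The operators obey recursions at the front of the tensor, whereas the cyclic operator removes
the last factor. Exchanging front and back insertions inside the induction shows that an operator at
an earlier position ignores the last factor. -/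
lemma counitAt_castSucc_insertAt_last (i : Fin (n + 1)) (c : C) (y : ⨂[k]^(n + 1) C) :
    counitAt k C (n + 1) i.castSucc (insertAt (Fin.last _) (c ⊗ₜ y)) =
      insertAt (Fin.last _) (c ⊗ₜ counitAt k C n i y) := by
  induction n with
  | zero =>
    obtain rfl := Fin.fin_one_eq_zero i
    induction y using insertAt_induction (i := 0) with
    | h0 => simp
    | hadd x y hx hy => simp only [map_add, TensorProduct.tmul_add, hx, hy]
    | h v y =>
      change counitAt k C 1 0 (insertAt (Fin.last 1) (c ⊗ₜ insertAt 0 (v ⊗ₜ y))) = _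
      rw [← insertAt_zero_insertAt_last, counitAt_insertAt, counitAt_insertAt,
        TensorProduct.tmul_smul, map_smul]
  | succ n ih =>
    induction y using insertAt_induction (i := 0) with
    | h0 => simp
    | hadd x y hx hy => simp only [map_add, TensorProduct.tmul_add, hx, hy]
    | h v y =>
      rw [← insertAt_zero_insertAt_last]
      refine Fin.cases ?_ (fun i => ?_) i
      · rw [Fin.castSucc_zero, counitAt_insertAt, counitAt_insertAt, TensorProduct.tmul_smul,
          map_smul]
      · rw [← Fin.succ_castSucc, counitAt_succ_insertAt_zero, counitAt_succ_insertAt_zero, ih,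
          insertAt_zero_insertAt_last]

lemma dupAt_castSucc_insertAt_last (Δ : V →ₗ[k] V ⊗[k] V) (i : Fin (n + 1)) (c : V)
    (y : ⨂[k]^(n + 1) V) :
    dupAt Δ i.castSucc (insertAt (Fin.last _) (c ⊗ₜ y)) =
      insertAt (Fin.last _) (c ⊗ₜ dupAt Δ i y) := by
  -- Position `0` is treated for every length at once, since it occurs both in the base case and in
  -- the induction step.
  have h0 : ∀ (m : ℕ) (v : V) (y : ⨂[k]^m V),
      dupAt Δ 0 (insertAt (Fin.last _) (c ⊗ₜ insertAt 0 (v ⊗ₜ y))) =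
        insertAt (Fin.last _) (c ⊗ₜ dupAt Δ 0 (insertAt 0 (v ⊗ₜ y))) := by
    intro m v y
    rw [← insertAt_zero_insertAt_last, dupAt_zero_insertAt, dupAt_zero_insertAt]
    generalize Δ v = z
    induction z using TensorProduct.induction_on with
    | zero => simp
    | add a b ha hb => simp only [map_add, TensorProduct.tmul_add, TensorProduct.add_tmul, ha, hb]
    | tmul x x' =>
      simp only [TensorProduct.assoc_tmul, LinearMap.lTensor_tmul, insertAt_zero_insertAt_last]
  induction n with
  | zero =>
    obtain rfl := Fin.fin_one_eq_zero i
    induction y using insertAt_induction (i := 0) with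
    | h0 => simp
    | hadd x y hx hy => simp only [map_add, TensorProduct.tmul_add, hx, hy]
    | h v y => exact h0 _ v y
  | succ n ih =>
    induction y using insertAt_induction (i := 0) with
    | h0 => simp
    | hadd x y hx hy => simp only [map_add, TensorProduct.tmul_add, hx, hy]
    | h v y =>
      refine Fin.cases ?_ (fun i => ?_) i
      · exact h0 _ v y
      · rw [← insertAt_zero_insertAt_last, ← Fin.succ_castSucc, dupAt_succ_insertAt_zero,
          dupAt_succ_insertAt_zero, ih, insertAt_zero_insertAt_last]

/-- As in the identities below, the induction strips off the first factor. If `i = 0`, the first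
factor is evaluated to a scalar which commutes with everything; otherwise both indices are
successors and the statement concerns the remaining factors. -/
lemma counitAt_counitAt {i j : Fin (n + 1)} (h : i ≤ j) (w : ⨂[k]^(n + 2) C) :
    counitAt k C n i (counitAt k C (n + 1) j.succ w) =
      counitAt k C n j (counitAt k C (n + 1) i.castSucc w) := by
  induction n with
  | zero =>
    obtain rfl := Fin.fin_one_eq_zero i
    obtain rfl := Fin.fin_one_eq_zero j
    induction w using insertAt_induction (i := 0) with
    | h0 => simp
    | hadd x y hx hy => simp only [map_add, hx, hy]
    | h c y =>
      rw [counitAt_succ_insertAt_zero, Fin.castSucc_zero, counitAt_insertAt, counitAt_insertAt,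
        map_smul]
  | succ n ih =>
    induction w using insertAt_induction (i := 0) with
    | h0 => simp
    | hadd x y hx hy => simp only [map_add, hx, hy]
    | h c y =>
      rw [counitAt_succ_insertAt_zero]
      induction i using Fin.cases with
      | zero => rw [Fin.castSucc_zero, counitAt_insertAt, counitAt_insertAt, map_smul]
      | succ i =>
        induction j using Fin.cases with
        | zero => exact absurd (Fin.le_zero_iff.1 h) (Fin.succ_ne_zero i)
        | succ j =>
          rw [← Fin.succ_castSucc, counitAt_succ_insertAt_zero, counitAt_succ_insertAt_zero,
            counitAt_succ_insertAt_zero,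
            ih (Fin.succ_le_succ_iff.1 h)]

/-- This is coassociativity of `C` in tensor powers. Both composites factor through the same map `L`
on `C ⊗ (C ⊗ C)`, applied to the two iterated comultiplications of the first factor. -/
lemma dupAt_zero_dupAt_zero (w : ⨂[k]^(n + 1) C) :
    dupAt (Coalgebra.comul (R := k)) 0 (dupAt (Coalgebra.comul (R := k)) 0 w) =
      dupAt (Coalgebra.comul (R := k)) 1 (dupAt (Coalgebra.comul (R := k) (A := C)) 0 w) := by
  induction w using insertAt_induction (i := 0) with
  | h0 => simp
  | hadd x y hx hy => simp only [map_add, hx, hy]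
  | h c y =>
    rw [dupAt_zero_insertAt]
    let L : C ⊗[k] (C ⊗[k] C) →ₗ[k] ⨂[k]^(n + 3) C :=
      insertAt 0 ∘ₗ
        (insertAt 0 ∘ₗ (insertAt 0 ∘ₗ (TensorProduct.mk k C _).flip y).lTensor C).lTensor C
    have h1 : ∀ z : C ⊗[k] C, dupAt (Coalgebra.comul (R := k)) 0
        (insertAt 0 ((insertAt 0).lTensor C (TensorProduct.assoc k C C _ (z ⊗ₜ y)))) =
        L (TensorProduct.assoc k C C C ((Coalgebra.comul (R := k)).rTensor C z)) := by
      intro z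
      induction z using TensorProduct.induction_on with
      | zero => simp
      | add a b ha hb => simp only [map_add, TensorProduct.add_tmul, ha, hb]
      | tmul u v =>
        rw [TensorProduct.assoc_tmul, LinearMap.lTensor_tmul, dupAt_zero_insertAt,
          LinearMap.rTensor_tmul]
        generalize Coalgebra.comul (R := k) u = q
        induction q using TensorProduct.induction_on with
        | zero => simp
        | add a b ha hb => simp only [map_add, TensorProduct.add_tmul, ha, hb]
        | tmul u₁ u₂ => rfl
    have h2 : ∀ z : C ⊗[k] C, dupAt (Coalgebra.comul (R := k)) 1
        (insertAt 0 ((insertAt 0).lTensor C (TensorProduct.assoc k C C _ (z ⊗ₜ y)))) =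
        L ((Coalgebra.comul (R := k)).lTensor C z) := by
      intro z
      induction z using TensorProduct.induction_on with
      | zero => simp
      | add a b ha hb => simp only [map_add, TensorProduct.add_tmul, ha, hb]
      | tmul u v =>
        rw [TensorProduct.assoc_tmul, LinearMap.lTensor_tmul, ← Fin.succ_zero_eq_one,
          dupAt_succ_insertAt_zero, dupAt_zero_insertAt, LinearMap.lTensor_tmul]
        generalize Coalgebra.comul (R := k) v = q
        induction q using TensorProduct.induction_on with
        | zero => simp
        | add a b ha hb => simp only [map_add, TensorProduct.tmul_add, TensorProduct.add_tmul,
            ha, hb]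
        | tmul u₁ u₂ => rfl
    rw [h1, h2, Coalgebra.coassoc_apply]

/-- Only equal positions need coassociativity; at distinct positions the two comultiplications act
on different factors and just shift each other's index. -/
lemma dupAt_dupAt {i j : Fin (n + 1)} (h : i ≤ j) (w : ⨂[k]^(n + 1) C) :
    dupAt (Coalgebra.comul (R := k)) i.castSucc (dupAt (Coalgebra.comul (R := k)) j w) =
      dupAt (Coalgebra.comul (R := k)) j.succ (dupAt (Coalgebra.comul (R := k) (A := C)) i w) := by
  induction n with
  | zero =>
    obtain rfl := Fin.fin_one_eq_zero i
    obtain rfl := Fin.fin_one_eq_zero j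
    exact dupAt_zero_dupAt_zero w
  | succ n ih =>
    induction i using Fin.cases with
    | zero =>
      induction j using Fin.cases with
      | zero => exact dupAt_zero_dupAt_zero w
      | succ j =>
        induction w using insertAt_induction (i := 0) with
        | h0 => simp
        | hadd x y hx hy => simp only [map_add, hx, hy]
        | h c y =>
          rw [dupAt_succ_insertAt_zero, Fin.castSucc_zero, dupAt_zero_insertAt,
            dupAt_zero_insertAt]
          generalize Coalgebra.comul (R := k) c = z
          induction z using TensorProduct.induction_on with
          | zero => simp
          | add a b ha hb => simp only [map_add, TensorProduct.add_tmul, ha, hb]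
          | tmul u v =>
            simp only [TensorProduct.assoc_tmul, LinearMap.lTensor_tmul, dupAt_succ_insertAt_zero]
    | succ i =>
      induction j using Fin.cases with
      | zero => exact absurd (Fin.le_zero_iff.1 h) (Fin.succ_ne_zero i)
      | succ j =>
        induction w using insertAt_induction (i := 0) with
        | h0 => simp
        | hadd x y hx hy => simp only [map_add, hx, hy]
        | h c y =>
          rw [← Fin.succ_castSucc, dupAt_succ_insertAt_zero, dupAt_succ_insertAt_zero,
            dupAt_succ_insertAt_zero, dupAt_succ_insertAt_zero, ih (Fin.succ_le_succ_iff.1 h)]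

/-- The left counit axiom; its right counterpart is `counitAt_one_dupAt_zero`. -/
lemma counitAt_zero_dupAt_zero (w : ⨂[k]^(n + 1) C) :
    counitAt k C (n + 1) 0 (dupAt (Coalgebra.comul (R := k)) 0 w) = w := by
  induction w using insertAt_induction (i := 0) with
  | h0 => simp
  | hadd x y hx hy => simp only [map_add, hx, hy]
  | h c y =>
    have h1 : ∀ z : C ⊗[k] C, counitAt k C (n + 1) 0
        (insertAt 0 ((insertAt 0).lTensor C (TensorProduct.assoc k C C _ (z ⊗ₜ y)))) =
        insertAt 0 (TensorProduct.lid k C ((Coalgebra.counit (R := k)).rTensor C z) ⊗ₜ y) := by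
      intro z
      induction z using TensorProduct.induction_on with
      | zero => simp
      | add a b ha hb => simp only [map_add, TensorProduct.add_tmul, ha, hb]
      | tmul u v =>
        rw [TensorProduct.assoc_tmul, LinearMap.lTensor_tmul, counitAt_insertAt,
          LinearMap.rTensor_tmul, TensorProduct.lid_tmul, ← TensorProduct.smul_tmul', map_smul]
    rw [dupAt_zero_insertAt, h1, Coalgebra.rTensor_counit_comul]
    simp

lemma counitAt_one_dupAt_zero (w : ⨂[k]^(n + 1) C) :
    counitAt k C (n + 1) 1 (dupAt (Coalgebra.comul (R := k)) 0 w) = w := by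
  induction w using insertAt_induction (i := 0) with
  | h0 => simp
  | hadd x y hx hy => simp only [map_add, hx, hy]
  | h c y =>
    have h1 : ∀ z : C ⊗[k] C, counitAt k C (n + 1) 1
        (insertAt 0 ((insertAt 0).lTensor C (TensorProduct.assoc k C C _ (z ⊗ₜ y)))) =
        insertAt 0 (TensorProduct.rid k C ((Coalgebra.counit (R := k)).lTensor C z) ⊗ₜ y) := by
      intro z
      induction z using TensorProduct.induction_on with
      | zero => simp
      | add a b ha hb => simp only [map_add, TensorProduct.add_tmul, ha, hb]
      | tmul u v =>
        rw [TensorProduct.assoc_tmul, LinearMap.lTensor_tmul, ← Fin.succ_zero_eq_one,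
          counitAt_succ_insertAt_zero, counitAt_insertAt, LinearMap.lTensor_tmul,
          TensorProduct.rid_tmul, ← TensorProduct.smul_tmul', map_smul, TensorProduct.tmul_smul,
          map_smul]
    rw [dupAt_zero_insertAt, h1, Coalgebra.lTensor_counit_comul]
    simp

lemma counitAt_castSucc_dupAt (j : Fin (n + 1)) (w : ⨂[k]^(n + 1) C) :
    counitAt k C (n + 1) j.castSucc (dupAt (Coalgebra.comul (R := k)) j w) = w := by
  induction n with
  | zero =>
    obtain rfl := Fin.fin_one_eq_zero j
    exact counitAt_zero_dupAt_zero w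
  | succ n ih =>
    induction j using Fin.cases with
    | zero => exact counitAt_zero_dupAt_zero w
    | succ j =>
      induction w using insertAt_induction (i := 0) with
      | h0 => simp
      | hadd x y hx hy => simp only [map_add, hx, hy]
      | h c y => rw [dupAt_succ_insertAt_zero, ← Fin.succ_castSucc, counitAt_succ_insertAt_zero, ih]

lemma counitAt_succ_dupAt (j : Fin (n + 1)) (w : ⨂[k]^(n + 1) C) :
    counitAt k C (n + 1) j.succ (dupAt (Coalgebra.comul (R := k)) j w) = w := by
  induction n with
  | zero =>
    obtain rfl := Fin.fin_one_eq_zero j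
    exact counitAt_one_dupAt_zero w
  | succ n ih =>
    induction j using Fin.cases with
    | zero => exact counitAt_one_dupAt_zero w
    | succ j =>
      induction w using insertAt_induction (i := 0) with
      | h0 => simp
      | hadd x y hx hy => simp only [map_add, hx, hy]
      | h c y => rw [dupAt_succ_insertAt_zero, counitAt_succ_insertAt_zero, ih]

lemma counitAt_castSucc_dupAt_succ {i : Fin (n + 2)} {j : Fin (n + 1)} (h : i ≤ j.castSucc)
    (w : ⨂[k]^(n + 2) C) :
    counitAt k C (n + 2) i.castSucc (dupAt (Coalgebra.comul (R := k)) j.succ w) =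
      dupAt (Coalgebra.comul (R := k)) j (counitAt k C (n + 1) i w) := by
  induction n with
  | zero =>
    obtain rfl := Fin.fin_one_eq_zero j
    obtain rfl := Fin.le_zero_iff.1 h
    induction w using insertAt_induction (i := 0) with
    | h0 => simp
    | hadd x y hx hy => simp only [map_add, hx, hy]
    | h c y => rw [dupAt_succ_insertAt_zero, Fin.castSucc_zero, counitAt_insertAt,
        counitAt_insertAt, map_smul]
  | succ n ih =>
    induction w using insertAt_induction (i := 0) with
    | h0 => simp
    | hadd x y hx hy => simp only [map_add, hx, hy]
    | h c y =>
      rw [dupAt_succ_insertAt_zero]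
      induction i using Fin.cases with
      | zero => rw [Fin.castSucc_zero, counitAt_insertAt, counitAt_insertAt, map_smul]
      | succ i =>
        induction j using Fin.cases with
        | zero => exact absurd (Fin.le_zero_iff.1 h) (Fin.succ_ne_zero i)
        | succ j =>
          rw [← Fin.succ_castSucc, counitAt_succ_insertAt_zero, counitAt_succ_insertAt_zero,
            dupAt_succ_insertAt_zero]
          rw [← Fin.succ_castSucc] at h
          rw [ih (Fin.succ_le_succ_iff.1 h)]

lemma counitAt_succ_succ_dupAt_zero (i : Fin (n + 1)) (w : ⨂[k]^(n + 2) C) :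
    counitAt k C (n + 2) i.succ.succ (dupAt (Coalgebra.comul (R := k)) 0 w) =
      dupAt (Coalgebra.comul (R := k)) 0 (counitAt k C (n + 1) i.succ w) := by
  induction w using insertAt_induction (i := 0) with
  | h0 => simp
  | hadd x y hx hy => simp only [map_add, hx, hy]
  | h c y =>
    rw [counitAt_succ_insertAt_zero, dupAt_zero_insertAt, dupAt_zero_insertAt]
    generalize Coalgebra.comul (R := k) c = z
    induction z using TensorProduct.induction_on with
    | zero => simp
    | add a b ha hb => simp only [map_add, TensorProduct.add_tmul, ha, hb]
    | tmul u v => simp only [TensorProduct.assoc_tmul, LinearMap.lTensor_tmul,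
        counitAt_succ_insertAt_zero]

lemma counitAt_succ_dupAt_castSucc {i : Fin (n + 2)} {j : Fin (n + 1)} (h : j.castSucc < i)
    (w : ⨂[k]^(n + 2) C) :
    counitAt k C (n + 2) i.succ (dupAt (Coalgebra.comul (R := k)) j.castSucc w) =
      dupAt (Coalgebra.comul (R := k)) j (counitAt k C (n + 1) i w) := by
  induction n with
  | zero =>
    obtain rfl := Fin.fin_one_eq_zero j
    -- The index `i` lies above another one, so it is a successor, and the front recursion for
    -- counits is available.
    obtain ⟨i, rfl⟩ := Fin.exists_succ_eq.2 (Fin.ne_zero_of_lt h)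
    exact counitAt_succ_succ_dupAt_zero i w
  | succ n ih =>
    obtain ⟨i, rfl⟩ := Fin.exists_succ_eq.2 (Fin.ne_zero_of_lt h)
    induction j using Fin.cases with
    | zero => exact counitAt_succ_succ_dupAt_zero i w
    | succ j =>
      rw [← Fin.succ_castSucc, Fin.succ_lt_succ_iff] at h
      induction w using insertAt_induction (i := 0) with
      | h0 => simp
      | hadd x y hx hy => simp only [map_add, hx, hy]
      | h c y =>
        rw [← Fin.succ_castSucc, dupAt_succ_insertAt_zero, counitAt_succ_insertAt_zero,
          counitAt_succ_insertAt_zero, dupAt_succ_insertAt_zero, ih h]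

end Coalgebra

/-! ### The diagonal action of `H` and the induced right action of `A` on `A ⊗ C^{⊗m}`. -/

section DiagonalAction

variable {k H A C : Type*} [CommRing k] [Ring H] [HopfAlgebra k H] [Ring A] [Algebra k A]
  [RightComoduleAlgebra k H A] [AddCommGroup C] [Module k C] [Coalgebra k C]
  [RightModuleCoalgebra k H C] {n m : ℕ}

/-- With `insertAt_one`, insertion is a unital algebra map. This makes the iterated comultiplication
multiplicative, and later turns collecting the factors from `A` into a product in an algebra. -/
lemma insertAt_mul (i : Fin (n + 1)) (x y : H ⊗[k] (⨂[k]^n H)) :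
    insertAt i (x * y) = insertAt i x * insertAt i y := by
  induction x using TensorProduct.induction_on with
  | zero => simp
  | add a b ha hb => simp only [map_add, add_mul, ha, hb]
  | tmul g u =>
  induction y using TensorProduct.induction_on with
  | zero => simp
  | add a b ha hb => simp only [map_add, mul_add, ha, hb]
  | tmul h v =>
  induction u using PiTensorProduct.induction_on with
  | add a b ha hb => simp only [map_add, TensorProduct.tmul_add, add_mul, ha, hb]
  | smul_tprod r x =>
  induction v using PiTensorProduct.induction_on with
  | add a b ha hb => simp only [map_add, TensorProduct.tmul_add, mul_add, ha, hb]
  | smul_tprod s y =>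
    simp only [Algebra.TensorProduct.tmul_mul_tmul, TensorProduct.tmul_smul, map_smul,
      smul_mul_assoc, mul_smul_comm, insertAt_tmul, PiTensorProduct.tprod_mul_tprod]
    congr 3
    funext j
    refine Fin.succAboveCases i ?_ (fun j => ?_) j <;> simp

lemma insertAt_one (i : Fin (n + 1)) : insertAt i (1 : H ⊗[k] (⨂[k]^n H)) = 1 := by
  rw [Algebra.TensorProduct.one_def, PiTensorProduct.one_def, PiTensorProduct.one_def,
    insertAt_tmul]
  congr 1
  funext j
  refine Fin.succAboveCases i ?_ (fun j => ?_) j <;> simp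

lemma iterComul_mul (g h : H) :
    iterComul k H m (g * h) = iterComul k H m g * iterComul k H m h := by
  induction m generalizing g h with
  | zero => simp [iterComul_zero, mul_comm, smul_smul]
  | succ m ih =>
    rw [iterComul_succ, iterComul_succ, iterComul_succ, Bialgebra.comul_mul, ← insertAt_mul]
    congr 1
    generalize Coalgebra.comul (R := k) g = x
    generalize Coalgebra.comul (R := k) h = y
    induction x using TensorProduct.induction_on with
    | zero => simp
    | add a b ha hb => simp only [map_add, add_mul, ha, hb]
    | tmul g u =>
    induction y using TensorProduct.induction_on with
    | zero => simp
    | add a b ha hb => simp only [map_add, mul_add, ha, hb]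
    | tmul h v => simp [ih]

lemma iterComul_one : iterComul k H m 1 = 1 := by
  induction m with
  | zero => simp [iterComul_zero]
  | succ m ih =>
    rw [iterComul_succ, Bialgebra.comul_one, Algebra.TensorProduct.one_def, LinearMap.lTensor_tmul,
      ih, ← Algebra.TensorProduct.one_def, insertAt_one]

lemma tensorAct_mul (w : ⨂[k]^m C) (u v : ⨂[k]^m H) :
    tensorAct k H C m w (u * v) = tensorAct k H C m (tensorAct k H C m w u) v := by
  induction w using PiTensorProduct.induction_on with
  | add a b ha hb => simp only [map_add, LinearMap.add_apply, ha, hb]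
  | smul_tprod r c =>
  induction u using PiTensorProduct.induction_on with
  | add a b ha hb => simp only [map_add, add_mul, LinearMap.add_apply, ha, hb]
  | smul_tprod s x =>
  induction v using PiTensorProduct.induction_on with
  | add a b ha hb => simp only [map_add, mul_add, ha, hb]
  | smul_tprod t y =>
    simp only [map_smul, smul_mul_assoc, mul_smul_comm, LinearMap.smul_apply,
      PiTensorProduct.tprod_mul_tprod, tensorAct_tprod, Pi.mul_apply, RightModuleCoalgebra.act_mul]

lemma tensorAct_one (w : ⨂[k]^m C) : tensorAct k H C m w 1 = w := by
  induction w using PiTensorProduct.induction_on with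
  | add a b ha hb => simp only [map_add, LinearMap.add_apply, ha, hb]
  | smul_tprod r c =>
    simp [PiTensorProduct.one_def, tensorAct_tprod, RightModuleCoalgebra.act_one]

/-- The diagonal action is a right action because iterated comultiplication is an algebra map and
`H^{⊗m}` acts on `C^{⊗m}` factor by factor. -/
lemma diagAct_mul (g h : H) (w : ⨂[k]^m C) :
    diagAct k H C m (g * h) w = diagAct k H C m h (diagAct k H C m g w) := by
  simp only [diagAct, LinearMap.flip_apply, iterComul_mul, tensorAct_mul]

lemma diagAct_one (w : ⨂[k]^m C) : diagAct k H C m 1 w = w := by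
  simp only [diagAct, LinearMap.flip_apply, iterComul_one, tensorAct_one]

lemma diagAct_zero (h : H) (w : ⨂[k]^0 C) :
    diagAct k H C 0 h w = Coalgebra.counit (R := k) h • w := by
  simp only [diagAct, iterComul_zero, map_smul, LinearMap.smul_apply, LinearMap.flip_apply,
    tensorAct_one]

/-- The diagonal action `w ⊗ h ↦ w · h` as a bilinear map. -/
def diagActBilin (k H C : Type*) [CommRing k] [Ring H] [HopfAlgebra k H] [AddCommGroup C]
    [Module k C] [Coalgebra k C] [RightModuleCoalgebra k H C] (m : ℕ) :
    ⨂[k]^m C →ₗ[k] H →ₗ[k] ⨂[k]^m C :=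
  (tensorAct k H C m).compl₂ (iterComul k H m)

@[simp] lemma diagActBilin_apply (w : ⨂[k]^m C) (h : H) :
    diagActBilin k H C m w h = diagAct k H C m h w := rfl

/-- The right action `(b ⊗ u) · a = b a₍₀₎ ⊗ u · a₍₁₎` on `A ⊗ C^{⊗m}`. -/
def diagRight (k H A C : Type*) [CommRing k] [Ring H] [HopfAlgebra k H] [Ring A] [Algebra k A]
    [RightComoduleAlgebra k H A] [AddCommGroup C] [Module k C] [Coalgebra k C]
    [RightModuleCoalgebra k H C] (m : ℕ) (a : A) : A ⊗[k] (⨂[k]^m C) →ₗ[k] A ⊗[k] (⨂[k]^m C) :=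
  (TensorProduct.map₂ (LinearMap.mul k A) (diagActBilin k H C m)).flip (coact k H A a)

lemma diagRight_tmul (a b : A) (u : ⨂[k]^m C) : diagRight k H A C m a (b ⊗ₜ u) =
    TensorProduct.map (LinearMap.mulLeft k b) (diagActBilin k H C m u) (coact k H A a) := rfl

/-- `a ⊗ c ↦ a ⊗ (c ⊗ u)`. -/
def attach (A : Type*) [Ring A] [Algebra k A] (u : ⨂[k]^m C) :
    A ⊗[k] C →ₗ[k] A ⊗[k] (⨂[k]^(m + 1) C) :=
  (insertAt 0 ∘ₗ (TensorProduct.mk k C _).flip u).lTensor A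

@[simp] lemma attach_tmul (u : ⨂[k]^m C) (a : A) (c : C) :
    attach A u (a ⊗ₜ c) = a ⊗ₜ[k] insertAt 0 (c ⊗ₜ u) := rfl

/-- `v ⊗ (b ⊗ u) ↦ v b ⊗ u`. -/
def pushFront (k H A C : Type*) [CommRing k] [Ring H] [HopfAlgebra k H] [Ring A] [Algebra k A]
    [RightComoduleAlgebra k H A] [AddCommGroup C] [Module k C] [Coalgebra k C]
    [RightModuleCoalgebra k H C] (m : ℕ) :
    (A ⊗[k] C) ⊗[k] (A ⊗[k] (⨂[k]^m C)) →ₗ[k] A ⊗[k] (⨂[k]^(m + 1) C) :=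
  (insertAt 0).lTensor A ∘ₗ (TensorProduct.assoc k A C (⨂[k]^m C)).toLinearMap ∘ₗ
    (TensorProduct.lift (rightAct k H A C).flip).rTensor (⨂[k]^m C) ∘ₗ
      (TensorProduct.assoc k (A ⊗[k] C) A (⨂[k]^m C)).symm.toLinearMap

lemma pushFront_tmul (v : A ⊗[k] C) (b : A) (u : ⨂[k]^m C) :
    pushFront k H A C m (v ⊗ₜ (b ⊗ₜ u)) = attach A u (rightAct k H A C b v) := by
  simp only [pushFront, LinearMap.comp_apply, LinearEquiv.coe_coe, TensorProduct.assoc_symm_tmul,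
    LinearMap.rTensor_tmul, TensorProduct.lift.tmul, LinearMap.flip_apply]
  generalize rightAct k H A C b v = z
  induction z using TensorProduct.induction_on with
  | zero => simp
  | add a b ha hb => simp only [map_add, TensorProduct.add_tmul, ha, hb]
  | tmul a c => simp

lemma attach_leftAct (u : ⨂[k]^m C) (a : A) (v : A ⊗[k] C) :
    attach A u (leftAct k A C a v) =
      (LinearMap.mulLeft k a).rTensor _ (attach A u v) := by
  induction v using TensorProduct.induction_on with
  | zero => simp
  | add a b ha hb => simp only [map_add, ha, hb]
  | tmul a c => simp

lemma pushFront_leftAct (a : A) (v : A ⊗[k] C) (z : A ⊗[k] (⨂[k]^m C)) :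
    pushFront k H A C m (leftAct k A C a v ⊗ₜ z) =
      (LinearMap.mulLeft k a).rTensor _ (pushFront k H A C m (v ⊗ₜ z)) := by
  induction z using TensorProduct.induction_on with
  | zero => simp
  | add x y hx hy => simp only [map_add, TensorProduct.tmul_add, hx, hy]
  | tmul b u =>
    rw [pushFront_tmul, pushFront_tmul, ← attach_leftAct]
    exact congrArg _ (LinearMap.congr_fun (left_right_comm a b) v).symm

/-- This is what lets `collect` descend to tensor products over `A`: an element of `A` between `v`
and `z` may be attached to either, since `A` acts on the coring associatively. -/
lemma pushFront_rightAct (a : A) (v : A ⊗[k] C) (z : A ⊗[k] (⨂[k]^m C)) :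
    pushFront k H A C m (rightAct k H A C a v ⊗ₜ z) =
      pushFront k H A C m (v ⊗ₜ (LinearMap.mulLeft k a).rTensor _ z) := by
  induction z using TensorProduct.induction_on with
  | zero => simp
  | add x y hx hy => simp only [map_add, TensorProduct.tmul_add, hx, hy]
  | tmul b u =>
    rw [LinearMap.rTensor_tmul, pushFront_tmul, pushFront_tmul, LinearMap.mulLeft_apply,
      rightAct_mul, LinearMap.comp_apply]

/-- On the left `a` first acts on `u`, and the resulting `a₍₀₎` is then pushed through `v`, with a
second coaction. On the right one coaction is taken and `a₍₁₎` is comultiplied over the factors.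
Coassociativity of the coaction equates the two. -/
lemma diagRight_attach (a : A) (v : A ⊗[k] C) (u : ⨂[k]^m C) :
    pushFront k H A C m (v ⊗ₜ diagRight k H A C m a (1 ⊗ₜ u)) =
      diagRight k H A C (m + 1) a (attach A u v) := by
  induction v using TensorProduct.induction_on with
  | zero => simp
  | add x y hx hy => simp only [map_add, TensorProduct.add_tmul, hx, hy]
  | tmul b c =>
    let L : A ⊗[k] (H ⊗[k] H) →ₗ[k] A ⊗[k] (⨂[k]^(m + 1) C) :=
      TensorProduct.map (LinearMap.mulLeft k b) (insertAt 0 ∘ₗ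
        TensorProduct.map (RightModuleCoalgebra.act (k := k) c) (diagActBilin k H C m u))
    have h1 : ∀ q : A ⊗[k] H, pushFront k H A C m ((b ⊗ₜ c) ⊗ₜ
        TensorProduct.map (LinearMap.mulLeft k 1) (diagActBilin k H C m u) q) =
        L (TensorProduct.assoc k A H H ((coact k H A).rTensor H q)) := by
      intro q
      induction q using TensorProduct.induction_on with
      | zero => simp
      | add x y hx hy => simp only [map_add, TensorProduct.tmul_add, hx, hy]
      | tmul a' g =>
        rw [TensorProduct.map_tmul, pushFront_tmul, LinearMap.mulLeft_apply, one_mul,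
          rightAct_tmul, LinearMap.rTensor_tmul]
        generalize coact k H A a' = r
        induction r using TensorProduct.induction_on with
        | zero => simp
        | add x y hx hy => simp only [map_add, TensorProduct.add_tmul, hx, hy]
        | tmul x y => simp [L]
    have h2 : ∀ q : A ⊗[k] H, L ((Coalgebra.comul (R := k)).lTensor A q) =
        TensorProduct.map (LinearMap.mulLeft k b)
          (diagActBilin k H C (m + 1) (insertAt 0 (c ⊗ₜ u))) q := by
      intro q
      induction q using TensorProduct.induction_on with
      | zero => simp
      | add x y hx hy => simp only [map_add, hx, hy]
      | tmul a' g =>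
        rw [TensorProduct.map_tmul, diagActBilin_apply, diagAct_insertAt_zero]
        rfl
    rw [diagRight_tmul, h1, coact_coassoc, h2, attach_tmul, diagRight_tmul]

lemma diagRight_mul_left (a b : A) (z : A ⊗[k] (⨂[k]^m C)) :
    diagRight k H A C m a ((LinearMap.mulLeft k b).rTensor _ z) =
      (LinearMap.mulLeft k b).rTensor _ (diagRight k H A C m a z) := by
  induction z using TensorProduct.induction_on with
  | zero => simp
  | add x y hx hy => simp only [map_add, hx, hy]
  | tmul c u =>
    rw [LinearMap.rTensor_tmul, diagRight_tmul, diagRight_tmul]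
    generalize coact k H A a = q
    induction q using TensorProduct.induction_on with
    | zero => simp
    | add x y hx hy => simp only [map_add, hx, hy]
    | tmul a' g => simp

/-- The coefficient `b` of a pure tensor `b ⊗ u` can be absorbed into `v`, which reduces to `b = 1`,
the case of `diagRight_attach`. -/
lemma pushFront_diagRight (a : A) (v : A ⊗[k] C) (z : A ⊗[k] (⨂[k]^m C)) :
    pushFront k H A C m (v ⊗ₜ diagRight k H A C m a z) =
      diagRight k H A C (m + 1) a (pushFront k H A C m (v ⊗ₜ z)) := by
  induction z using TensorProduct.induction_on with
  | zero => simp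
  | add x y hx hy => simp only [map_add, TensorProduct.tmul_add, hx, hy]
  | tmul b u =>
    rw [pushFront_tmul, ← diagRight_attach, pushFront_rightAct, ← diagRight_mul_left,
      LinearMap.rTensor_tmul, LinearMap.mulLeft_apply, mul_one]

/-- On the empty tensor power `H` acts by its counit, so the action collapses by counitality of the
coaction. It starts the induction for `collect_right`. -/
lemma diagRight_zero (a b : A) (u : ⨂[k]^0 C) :
    diagRight k H A C 0 a (b ⊗ₜ u) = (b * a) ⊗ₜ u := by
  have h1 : ∀ q : A ⊗[k] H,
      TensorProduct.map (LinearMap.mulLeft k b) (diagActBilin k H C 0 u) q =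
        (b * TensorProduct.rid k A ((Coalgebra.counit (R := k)).lTensor A q)) ⊗ₜ u := by
    intro q
    induction q using TensorProduct.induction_on with
    | zero => simp
    | add x y hx hy => simp only [map_add, mul_add, TensorProduct.add_tmul, hx, hy]
    | tmul a' g => simp [diagAct_zero, TensorProduct.smul_tmul']
  rw [diagRight_tmul, h1, coact_counit]

end DiagonalAction

/-! ### The tensor power of the Galois coring over `A` as `A ⊗ C^{⊗(n+1)}`. -/

section Collect

variable (k H A C : Type*) [CommRing k] [Ring H] [HopfAlgebra k H] [Ring A] [Algebra k A]
  [RightComoduleAlgebra k H A] [AddCommGroup C] [Module k C] [Coalgebra k C]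
  [RightModuleCoalgebra k H C]

/-- The map `(A ⊗ C)^{⊗m} → A ⊗ C^{⊗m}` moving all factors from `A` to the left across the factors
from `C`, on which they act through the coaction. -/
def collect : (m : ℕ) → (⨂[k]^m (A ⊗[k] C) →ₗ[k] A ⊗[k] (⨂[k]^m C))
  | 0 => TensorProduct.mk k A _ 1 ∘ₗ
      (PiTensorProduct.isEmptyEquiv (R := k) (s := fun _ : Fin 0 => C) (Fin 0)).symm.toLinearMap ∘ₗ
      (PiTensorProduct.isEmptyEquiv (R := k) (s := fun _ : Fin 0 => A ⊗[k] C) (Fin 0)).toLinearMap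
  | m + 1 => pushFront k H A C m ∘ₗ (collect m).lTensor (A ⊗[k] C) ∘ₗ removeAt 0

/-- `a ⊗ (c₀ ⊗ ⋯ ⊗ cₙ) ↦ (a ⊗ c₀) ⊗ (1 ⊗ c₁) ⊗ ⋯ ⊗ (1 ⊗ cₙ)`. -/
def spread (m : ℕ) : A ⊗[k] (⨂[k]^(m + 1) C) →ₗ[k] ⨂[k]^(m + 1) (A ⊗[k] C) :=
  TensorProduct.lift ((opAt 0 ∘ₗ leftAct k A C).compl₂
    (PiTensorProduct.map fun _ => TensorProduct.mk k A C 1))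

section lemmas
variable {k H A C} {n m : ℕ}

lemma collect_insertAt (v : A ⊗[k] C) (y : ⨂[k]^m (A ⊗[k] C)) :
    collect k H A C (m + 1) (insertAt 0 (v ⊗ₜ y)) =
      pushFront k H A C m (v ⊗ₜ collect k H A C m y) := by
  rw [collect, LinearMap.comp_apply, LinearMap.comp_apply, removeAt_insertAt,
    LinearMap.lTensor_tmul]

lemma collect_left (a : A) (w : ⨂[k]^(m + 1) (A ⊗[k] C)) :
    collect k H A C (m + 1) (opAt 0 (leftAct k A C a) w) =
      (LinearMap.mulLeft k a).rTensor _ (collect k H A C (m + 1) w) := by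
  induction w using insertAt_induction (k := k) (V := A ⊗[k] C) (i := 0) with
  | h0 => simp
  | hadd x y hx hy => simp only [map_add, hx, hy]
  | h v y => rw [opAt_insertAt_self, collect_insertAt, collect_insertAt, pushFront_leftAct]

/-- An element entering at the right end is carried leftwards through every factor, leaving one leg
of its coaction in each. `pushFront_diagRight` is one such passage. -/
lemma collect_right (a : A) (w : ⨂[k]^(m + 1) (A ⊗[k] C)) :
    collect k H A C (m + 1) (opAt (Fin.last m) (rightAct k H A C a) w) =
      diagRight k H A C (m + 1) a (collect k H A C (m + 1) w) := by
  induction m with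
  | zero =>
    induction w using insertAt_induction (k := k) (V := A ⊗[k] C) (i := 0) with
    | h0 => simp
    | hadd x y hx hy => simp only [map_add, hx, hy]
    | h v y =>
      rw [Fin.last_zero, opAt_insertAt_self, collect_insertAt, collect_insertAt,
        pushFront_rightAct, ← pushFront_diagRight]
      simp only [collect, LinearMap.comp_apply, TensorProduct.mk_apply, diagRight_zero, one_mul,
        LinearMap.rTensor_tmul, LinearMap.mulLeft_apply, mul_one]
  | succ m ih =>
    induction w using insertAt_induction (k := k) (V := A ⊗[k] C) (i := 0) with
    | h0 => simp
    | hadd x y hx hy => simp only [map_add, hx, hy]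
    | h v y =>
      rw [show Fin.last (m + 1) = (0 : Fin (m + 2)).succAbove (Fin.last m) by simp,
        opAt_insertAt, collect_insertAt, ih, collect_insertAt, pushFront_diagRight]

/-- The relation between the first two factors is `pushFront_rightAct`; a later one lies in the tail
and is handled by induction. -/
lemma collect_balanced (i : Fin n) (a : A) (w : ⨂[k]^(n + 1) (A ⊗[k] C)) :
    collect k H A C (n + 1) (opAt i.castSucc (rightAct k H A C a) w) =
      collect k H A C (n + 1) (opAt i.succ (leftAct k A C a) w) := by
  induction n with
  | zero => exact i.elim0
  | succ n ih =>
    induction w using insertAt_induction (k := k) (V := A ⊗[k] C) (i := 0) with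
    | h0 => simp
    | hadd x y hx hy => simp only [map_add, hx, hy]
    | h v y =>
      rw [show i.succ = (0 : Fin (n + 2)).succAbove i by simp, opAt_insertAt, collect_insertAt]
      induction i using Fin.cases with
      | zero =>
        rw [Fin.castSucc_zero, opAt_insertAt_self, collect_insertAt, collect_left,
          pushFront_rightAct]
      | succ i =>
        rw [show i.succ.castSucc = (0 : Fin (n + 2)).succAbove i.castSucc by simp,
          opAt_insertAt, collect_insertAt, ih]

lemma spread_tmul (a : A) (u : ⨂[k]^(n + 1) C) : spread k A C n (a ⊗ₜ u) =
    opAt 0 (leftAct k A C a) (PiTensorProduct.map (fun _ => TensorProduct.mk k A C 1) u) := rfl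

lemma map_insertAt {V W : Type*} [AddCommGroup V] [Module k V] [AddCommGroup W] [Module k W]
    (f : V →ₗ[k] W) (i : Fin (n + 1)) (v : V) (u : ⨂[k]^n V) :
    PiTensorProduct.map (fun _ => f) (insertAt i (v ⊗ₜ u)) =
      insertAt i (f v ⊗ₜ[k] PiTensorProduct.map (fun _ => f) u) := by
  induction u using PiTensorProduct.induction_on with
  | smul_tprod r x =>
    simp only [map_smul, TensorProduct.tmul_smul, insertAt_tmul, PiTensorProduct.map_tprod]
    congr 2
    funext j
    refine Fin.succAboveCases i ?_ (fun j => ?_) j <;> simp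
  | add a b ha hb => simp only [map_add, TensorProduct.tmul_add, ha, hb]

lemma spread_insertAt (a : A) (c : C) (u : ⨂[k]^n C) : spread k A C n (a ⊗ₜ insertAt 0 (c ⊗ₜ u)) =
    insertAt 0 ((a ⊗ₜ c) ⊗ₜ PiTensorProduct.map (fun _ => TensorProduct.mk k A C 1) u) := by
  rw [spread_tmul, map_insertAt, opAt_insertAt_self, TensorProduct.mk_apply, leftAct_tmul, mul_one]

lemma spread_attach (v : A ⊗[k] C) (u : ⨂[k]^n C) : spread k A C n (attach A u v) =
    insertAt 0 (v ⊗ₜ PiTensorProduct.map (fun _ => TensorProduct.mk k A C 1) u) := by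
  induction v using TensorProduct.induction_on with
  | zero => simp
  | add x y hx hy => simp only [map_add, TensorProduct.add_tmul, hx, hy]
  | tmul a c => rw [attach_tmul, spread_insertAt]

/-- When every factor has entry `1` in `A`, the actions involved are trivial and nothing has to be
moved. These tensors serve as normal forms below. -/
lemma collect_map (u : ⨂[k]^m C) :
    collect k H A C m (PiTensorProduct.map (fun _ => TensorProduct.mk k A C 1) u) = 1 ⊗ₜ u := by
  induction m with
  | zero =>
    induction u using PiTensorProduct.induction_on with
    | smul_tprod r x =>
      simp only [map_smul, PiTensorProduct.map_tprod, collect, LinearMap.comp_apply,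
        LinearEquiv.coe_coe, PiTensorProduct.isEmptyEquiv_apply_tprod, TensorProduct.mk_apply,
        TensorProduct.tmul_smul]
      congr 2
      rw [LinearEquiv.symm_apply_eq, PiTensorProduct.isEmptyEquiv_apply_tprod]
    | add a b ha hb => simp only [map_add, TensorProduct.tmul_add, ha, hb]
  | succ m ih =>
    induction u using insertAt_induction (i := 0) with
    | h0 => simp
    | hadd x y hx hy => simp only [map_add, TensorProduct.tmul_add, hx, hy]
    | h c u =>
      rw [map_insertAt, collect_insertAt, ih, pushFront_tmul, rightAct_one, LinearMap.id_apply,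
        TensorProduct.mk_apply, attach_tmul]

lemma collect_spread (z : A ⊗[k] (⨂[k]^(n + 1) C)) :
    collect k H A C (n + 1) (spread k A C n z) = z := by
  induction z using TensorProduct.induction_on with
  | zero => simp
  | add x y hx hy => simp only [map_add, hx, hy]
  | tmul a u =>
    rw [spread_tmul, collect_left, collect_map, LinearMap.rTensor_tmul, LinearMap.mulLeft_apply,
      mul_one]

/-- Inserting a factor in front is compatible with the relations of the tensor product over `A`. -/
lemma mk_balanced_insertAt_zero {V : Type*} [AddCommGroup V] [Module k V] (S : Coring k A V) (v : V)
    {y y' : ⨂[k]^(n + 1) V} (h : (balanced S n).mkQ y = (balanced S n).mkQ y') :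
    (balanced S (n + 1)).mkQ (insertAt 0 (v ⊗ₜ y)) =
      (balanced S (n + 1)).mkQ (insertAt 0 (v ⊗ₜ y')) := by
  let G := (balanced S (n + 1)).mkQ ∘ₗ insertAt 0 ∘ₗ TensorProduct.mk k V _ v
  have hG : balanced S n ≤ LinearMap.ker G := balanced_le_ker G fun i a w => by
    simp only [G, LinearMap.comp_apply, TensorProduct.mk_apply, ← opAt_insertAt]
    simpa using mk_balanced (S := S) i.succ a (insertAt 0 (v ⊗ₜ w))
  have : G (y - y') = 0 := hG ((Submodule.Quotient.eq _).1 h)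
  rwa [map_sub, sub_eq_zero] at this

/-- Together with `collect_spread` this identifies the tensor power over `A`. The tail may be
replaced by its normal form by induction; its coefficient `b` then passes to the first factor by one
balancing relation. -/
lemma mk_spread_collect (w : ⨂[k]^(n + 1) (A ⊗[k] C)) :
    (balanced (galoisCoring k H A C) n).mkQ (spread k A C n (collect k H A C (n + 1) w)) =
      (balanced (galoisCoring k H A C) n).mkQ w := by
  induction n with
  | zero =>
    congr 1
    induction w using insertAt_induction (k := k) (V := A ⊗[k] C) (i := 0) with
    | h0 => simp
    | hadd x y hx hy => simp only [map_add, hx, hy]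
    | h v y =>
      rw [collect_insertAt]
      induction y using PiTensorProduct.induction_on with
      | add a b ha hb => simp only [map_add, TensorProduct.tmul_add, ha, hb]
      | smul_tprod r x =>
        -- There is only one empty tuple, so the tail is a scalar multiple of the image of the empty
        -- tensor over `C`, and `collect_map` applies to it.
        rw [show PiTensorProduct.tprod k x = PiTensorProduct.map
            (fun _ => TensorProduct.mk k A C 1) (PiTensorProduct.tprod k fun i => i.elim0) by
          rw [PiTensorProduct.map_tprod]; congr 1; exact Subsingleton.elim _ _, ← map_smul,
          collect_map, pushFront_tmul, rightAct_one, LinearMap.id_apply, spread_attach]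
  | succ n ih =>
    induction w using insertAt_induction (k := k) (V := A ⊗[k] C) (i := 0) with
    | h0 => simp
    | hadd x y hx hy => simp only [map_add, hx, hy]
    | h v y =>
      rw [← mk_balanced_insertAt_zero _ v (ih y), collect_insertAt]
      generalize collect k H A C (n + 1) y = z
      induction z using TensorProduct.induction_on with
      | zero => simp
      | add x y hx hy => simp only [map_add, TensorProduct.tmul_add, hx, hy]
      | tmul b u =>
        rw [pushFront_tmul, spread_attach, spread_tmul, ← opAt_insertAt, ← opAt_insertAt_self,
          Fin.zero_succAbove]
        -- What remains is the relation between the first two factors, where `b` acts on `v` from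
        -- the right or on its neighbour from the left.
        exact mk_balanced (S := galoisCoring k H A C) 0 b _

end lemmas

end Collect

/-! ### The cyclic identities which are easily seen on the coring side. -/

section CoringIdentities

variable {k A V : Type*} [CommRing k] [Ring A] [Algebra k A] [AddCommGroup V] [Module k V]
  {n : ℕ}

lemma opAt_id (i : Fin n) (w : ⨂[k]^n V) : opAt i LinearMap.id w = w := by
  induction w using PiTensorProduct.induction_on with
  | smul_tprod r x => simp
  | add a b ha hb => simp only [map_add, ha, hb]

lemma insertAt_zero_insertAt (i : Fin (n + 1)) (v w : V) (y : ⨂[k]^n V) :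
    insertAt 0 (v ⊗ₜ insertAt i (w ⊗ₜ y)) = insertAt i.succ (w ⊗ₜ insertAt 0 (v ⊗ₜ[k] y)) := by
  induction y using PiTensorProduct.induction_on with
  | smul_tprod r x =>
    simp only [map_smul, TensorProduct.tmul_smul, insertAt_tmul, Fin.insertNth_zero',
      Fin.insertNth_succ_cons]
  | add a b ha hb => simp only [map_add, TensorProduct.tmul_add, ha, hb]

/-- Both sides are the tensor ending in `⋯ ⊗ v ⊗ w`. The right-hand form exposes `w` as the last
factor, ready to be rotated after a comultiplication in last position. -/
lemma insertAt_castSucc_last (v w : V) (y : ⨂[k]^n V) :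
    insertAt (Fin.last n).castSucc (v ⊗ₜ insertAt (Fin.last n) (w ⊗ₜ y)) =
      insertAt (Fin.last (n + 1)) (w ⊗ₜ insertAt (Fin.last n) (v ⊗ₜ[k] y)) := by
  induction n with
  | zero =>
    rw [Fin.last_zero, Fin.castSucc_zero]
    exact insertAt_zero_insertAt_last v w y
  | succ n ih =>
    induction y using insertAt_induction (i := 0) with
    | h0 => simp
    | hadd x y hx hy => simp only [map_add, TensorProduct.tmul_add, hx, hy]
    | h u y =>
      rw [← Fin.succ_last, ← insertAt_zero_insertAt, ← insertAt_zero_insertAt, ← Fin.succ_castSucc,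
        ← insertAt_zero_insertAt, ih, ← Fin.succ_last (n + 1), ← insertAt_zero_insertAt]

variable {S : Coring k A V}

lemma coringFace_mk (i : Fin (n + 2)) (w : ⨂[k]^(n + 2) V) (b : A) :
    coringFace S n i (coringMk S (n + 1) w b) = coringMk S n (freeFace S n i w) b := rfl

lemma coringDegeneracy_mk (j : Fin (n + 1)) (w : ⨂[k]^(n + 1) V) (b : A) :
    coringDegeneracy S n j (coringMk S n w b) = coringMk S (n + 1) (dupAt S.comul j w) b := rfl

lemma coringCyc_mk (w : ⨂[k]^(n + 1) V) (b : A) :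
    coringCyc S n (coringMk S n w b) = coringMk S n (rotateBy S.right n b w) 1 := rfl

lemma coringCyc_mk_one (w : ⨂[k]^(n + 1) V) :
    coringCyc S n (coringMk S n w 1) = coringMk S n (rotate k V n w) 1 := by
  rw [coringCyc_mk, rotateBy_apply, S.right_one, opAt_id]

lemma coringMk_add (w w' : ⨂[k]^(n + 1) V) (b : A) :
    coringMk S n (w + w') b = coringMk S n w b + coringMk S n w' b := by
  simp only [coringMk, map_add, TensorProduct.add_tmul]

lemma coringMk_zero (b : A) : coringMk S n 0 b = 0 := by
  simp only [coringMk, map_zero, TensorProduct.zero_tmul]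

/-- The coefficient `b` is absorbed into the last factor by the right action. With coefficient `1`
the twist in the cyclic operator disappears, and identities on the quotient can be tested by plain
rotations of tensors. -/
lemma exists_coringMk_one (x : CoringCyclic S n) : ∃ w, coringMk S n w 1 = x := by
  obtain ⟨z, rfl⟩ := Submodule.mkQ_surjective _ x
  induction z using TensorProduct.induction_on with
  | zero => exact ⟨0, by rw [coringMk_zero, map_zero]⟩
  | add x y hx hy =>
    obtain ⟨w, hw⟩ := hx
    obtain ⟨w', hw'⟩ := hy
    exact ⟨w + w', by rw [coringMk_add, hw, hw', map_add]⟩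
  | tmul p b =>
    obtain ⟨w, rfl⟩ := Submodule.mkQ_surjective _ p
    exact ⟨opAt (Fin.last n) (S.right b) w, by rw [coringMk_right, mul_one]; rfl⟩

/-- The bilinear map `(w, b) ↦ coringMk w b`. -/
def coringMkBilin (S : Coring k A V) (n : ℕ) : ⨂[k]^(n + 1) V →ₗ[k] A →ₗ[k] CoringCyclic S n :=
  (TensorProduct.mk k (CoringPow S n) A).compr₂ (envelopingRel S n).mkQ ∘ₗ (balanced S n).mkQ

/-- A bilinear map respecting the relations of `V ⊗_A ⋯ ⊗_A V` and of `- ⊗_{Aᵉ} A` induces a linear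
map on the quotient. -/
def coringLift {X : Type*} [AddCommGroup X] [Module k X] (f : ⨂[k]^(n + 1) V →ₗ[k] A →ₗ[k] X)
    (hf : ∀ (i : Fin n) (a : A) (w : ⨂[k]^(n + 1) V),
      f (opAt i.castSucc (S.right a) w) = f (opAt i.succ (S.left a) w))
    (hf' : ∀ (a' a'' : A) (w : ⨂[k]^(n + 1) V) (b : A),
      f (opAt 0 (S.left a'') (opAt (Fin.last n) (S.right a') w)) b = f w (a' * b * a'')) :
    CoringCyclic S n →ₗ[k] X :=
  (envelopingRel S n).liftQ
    (TensorProduct.lift ((balanced S n).liftQ f (balanced_le_ker _ hf)))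
    (enveloping_le_ker _ hf')

/-- Rotation preserves representatives with coefficient `1`, so powers of the cyclic operator are
powers of `rotate`. -/
lemma coringCyc_pow (S : Coring k A V) (n : ℕ) : coringCyc S n ^ (n + 1) = 1 := by
  have h : ∀ (m : ℕ) (w : ⨂[k]^(n + 1) V), (coringCyc S n ^ m) (coringMk S n w 1) =
      coringMk S n ((rotate k V n ^ m) w) 1 := by
    intro m
    induction m with
    | zero => exact fun w => rfl
    | succ m ih => exact fun w => by rw [pow_succ, pow_succ, Module.End.mul_apply,
        Module.End.mul_apply, coringCyc_mk_one, ih]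
  refine LinearMap.ext fun x => ?_
  obtain ⟨w, rfl⟩ := exists_coringMk_one x
  rw [h, rotate_pow]
  rfl

/-- On one side `ε(v)` multiplies the remaining tensor from the left, on the other from the right.
Over `Aᵉ` both actions move `ε(v)` into the coefficient, where they agree. -/
lemma coringFace_zero_cyc (x : CoringCyclic S (n + 1)) :
    coringFace S n 0 (coringCyc S (n + 1) x) = coringFace S n (Fin.last (n + 1)) x := by
  obtain ⟨w, rfl⟩ := exists_coringMk_one x
  rw [coringCyc_mk_one, coringFace_mk, coringFace_mk]
  induction w using insertAt_induction (i := Fin.last _) with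
  | h0 => simp
  | hadd x y hx hy => simp only [map_add, coringMk_add, hx, hy]
  | h v y =>
    rw [rotate_insertAt_last, freeFace_last, coringMk_right]
    have := freeFace_castSucc (S := S) 0 v y
    rw [Fin.castSucc_zero] at this
    rw [this, coringMk_left, one_mul, mul_one]

lemma coringDegeneracy_zero_cyc (x : CoringCyclic S n) :
    coringDegeneracy S n 0 (coringCyc S n x) =
      coringCyc S (n + 1) (coringCyc S (n + 1) (coringDegeneracy S n (Fin.last n) x)) := by
  obtain ⟨w, rfl⟩ := exists_coringMk_one x
  rw [coringDegeneracy_mk, coringCyc_mk_one, coringCyc_mk_one, coringCyc_mk_one,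
    coringDegeneracy_mk]
  -- With coefficient `1` the identity already holds in the tensor power over `k`: duplicating the
  -- last factor and rotating twice brings both copies to the front in the right order.
  congr 1
  induction w using insertAt_induction (i := Fin.last _) with
  | h0 => simp
  | hadd x y hx hy => simp only [map_add, hx, hy]
  | h v y =>
    rw [rotate_insertAt_last, dupAt_insertAt, dupAt_insertAt]
    generalize S.comul v = z
    induction z using TensorProduct.induction_on with
    | zero => simp
    | add x y hx hy => simp only [map_add, TensorProduct.add_tmul, hx, hy]
    | tmul v v' =>
      rw [insertPairAt_zero_tmul, insertPairAt, LinearMap.comp_apply, LinearMap.comp_apply,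
        LinearEquiv.coe_coe, TensorProduct.assoc_tmul, LinearMap.lTensor_tmul,
        insertAt_castSucc_last, rotate_insertAt_last, insertAt_zero_insertAt_last,
        rotate_insertAt_last]

/-- The counterpart for the coring of `counitAt_succ_insertAt_zero`, so that faces on both sides
obey the same front recursion. Since `y` has at least two factors, the absorbing neighbour always
lies in the tail. -/
lemma freeFace_succ_insertAt_zero (i : Fin (n + 2)) (v : V) (y : ⨂[k]^(n + 2) V) :
    freeFace S (n + 1) i.succ (insertAt 0 (v ⊗ₜ y)) = insertAt 0 (v ⊗ₜ freeFace S n i y) := by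
  induction y using insertAt_induction (i := i) with
  | h0 => simp
  | hadd x y hx hy => simp only [map_add, TensorProduct.tmul_add, hx, hy]
  | h x t =>
    rw [insertAt_zero_insertAt]
    induction i using Fin.lastCases with
    | last =>
      rw [Fin.succ_last, freeFace_last, freeFace_last, ← opAt_insertAt, Fin.zero_succAbove,
        Fin.succ_last]
    | cast j =>
      rw [Fin.succ_castSucc, freeFace_castSucc, freeFace_castSucc, ← opAt_insertAt,
        Fin.zero_succAbove]

end CoringIdentities

/-! ### The cyclic identities on the target which do not touch the rotated factor. -/

section HopfIdentities

variable {k H A C : Type*} [CommRing k] [Ring H] [HopfAlgebra k H] [Ring A] [Algebra k A]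
  [RightComoduleAlgebra k H A] [AddCommGroup C] [Module k C] [Coalgebra k C]
  [RightModuleCoalgebra k H C] {n : ℕ}

lemma hopfFace_mk (i : Fin (n + 2)) (w : ⨂[k]^(n + 2) C) (m : Coeff k H A) :
    hopfFace k H A C n i (hopfMk k H A C (n + 1) w m) =
      hopfMk k H A C n (counitAt k C (n + 1) i w) m := rfl

lemma hopfDegeneracy_mk (j : Fin (n + 1)) (w : ⨂[k]^(n + 1) C) (m : Coeff k H A) :
    hopfDegeneracy k H A C n j (hopfMk k H A C n w m) =
      hopfMk k H A C (n + 1) (dupAt (Coalgebra.comul (R := k)) j w) m := rfl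

lemma hopfCyc_mk (w : ⨂[k]^(n + 1) C) (m : Coeff k H A) :
    hopfCyc k H A C n (hopfMk k H A C n w m) =
      (hopfRel k H A C n).mkQ (cycAux n w (coeffCoact k H A m)) := by
  rw [← freeCyc_tmul]
  rfl

lemma hopfMk_diagAct (w : ⨂[k]^(n + 1) C) (h : H) (m : Coeff k H A) :
    hopfMk k H A C n (diagAct k H C (n + 1) h w) m = hopfMk k H A C n w (coeffAct k H A h m) :=
  mk_hopfRel w h m

lemma hopfCyclicModule_ext {X : Type*} [AddCommGroup X] [Module k X]
    {f g : HopfCyclicModule k H A C n →ₗ[k] X}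
    (h : ∀ w m, f (hopfMk k H A C n w m) = g (hopfMk k H A C n w m)) : f = g :=
  Submodule.linearMap_qext _ (TensorProduct.ext' h)

/-- The rotated factor stays untouched, so nothing about the coaction is needed: the identity holds
with any `e ∈ M ⊗ H` in place of a coacted element. -/
lemma hopfFace_mkQ_cycAux (i : Fin (n + 1)) (w : ⨂[k]^(n + 2) C) (e : Coeff k H A ⊗[k] H) :
    hopfFace k H A C n i.succ ((hopfRel k H A C (n + 1)).mkQ (cycAux (n + 1) w e)) =
      (hopfRel k H A C n).mkQ (cycAux n (counitAt k C (n + 1) i.castSucc w) e) := by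
  induction e using TensorProduct.induction_on with
  | zero => simp
  | add x y hx hy => simp only [map_add, hx, hy]
  | tmul m g =>
    induction w using insertAt_induction (i := Fin.last _) with
    | h0 => simp [cycAux]
    | hadd x y hx hy =>
      simp only [cycAux, map_add, LinearMap.add_apply, LinearMap.comp_apply, LinearEquiv.coe_coe,
        TensorProduct.comm_tmul, LinearMap.rTensor_tmul, TensorProduct.add_tmul] at hx hy ⊢
      rw [hx, hy]
    | h c y =>
      rw [cycAux_insertAt, counitAt_castSucc_insertAt_last, cycAux_insertAt,
        ← counitAt_succ_insertAt_zero]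
      rfl

lemma hopfDegeneracy_mkQ_cycAux (j : Fin n) (w : ⨂[k]^(n + 1) C) (e : Coeff k H A ⊗[k] H) :
    hopfDegeneracy k H A C n j.succ ((hopfRel k H A C n).mkQ (cycAux n w e)) =
      (hopfRel k H A C (n + 1)).mkQ
        (cycAux (n + 1) (dupAt (Coalgebra.comul (R := k)) j.castSucc w) e) := by
  induction e using TensorProduct.induction_on with
  | zero => simp
  | add x y hx hy => simp only [map_add, hx, hy]
  | tmul m g =>
    induction w using insertAt_induction (i := Fin.last _) with
    | h0 => simp [cycAux]
    | hadd x y hx hy =>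
      simp only [cycAux, map_add, LinearMap.add_apply, LinearMap.comp_apply, LinearEquiv.coe_coe,
        TensorProduct.comm_tmul, LinearMap.rTensor_tmul, TensorProduct.add_tmul] at hx hy ⊢
      rw [hx, hy]
    | h c y =>
      -- An element of `Fin n` forces `n > 0`, so a duplicated factor remains after removal of the
      -- last one.
      obtain ⟨n, rfl⟩ : ∃ m, n = m + 1 := ⟨n - 1, by have := j.2; omega⟩
      rw [cycAux_insertAt, dupAt_castSucc_insertAt_last, cycAux_insertAt,
        ← dupAt_succ_insertAt_zero]
      rfl

/-- The cyclic identities of the target, given the three which involve the last tensor factor. -/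
lemma isCyclicModule_hopf
    (cyc_pow : ∀ n, hopfCyc k H A C n ^ (n + 1) = 1)
    (face_zero_cyc : ∀ n, hopfFace k H A C n 0 ∘ₗ hopfCyc k H A C (n + 1) =
      hopfFace k H A C n (Fin.last (n + 1)))
    (degeneracy_zero_cyc : ∀ n, hopfDegeneracy k H A C n 0 ∘ₗ hopfCyc k H A C n =
      hopfCyc k H A C (n + 1) ∘ₗ hopfCyc k H A C (n + 1) ∘ₗ
        hopfDegeneracy k H A C n (Fin.last n)) :
    IsCyclicModule (hopfFace k H A C) (hopfDegeneracy k H A C) (hopfCyc k H A C) where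
  face_face n i j h := hopfCyclicModule_ext fun w m => by
    simp only [LinearMap.comp_apply, hopfFace_mk, counitAt_counitAt h]
  degeneracy_degeneracy n i j h := hopfCyclicModule_ext fun w m => by
    simp only [LinearMap.comp_apply, hopfDegeneracy_mk, dupAt_dupAt h]
  face_degeneracy_of_le n i j h := hopfCyclicModule_ext fun w m => by
    simp only [LinearMap.comp_apply, hopfFace_mk, hopfDegeneracy_mk,
      counitAt_castSucc_dupAt_succ h]
  face_degeneracy_self n j := hopfCyclicModule_ext fun w m => by
    simp only [LinearMap.comp_apply, hopfFace_mk, hopfDegeneracy_mk, counitAt_castSucc_dupAt,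
      LinearMap.id_apply]
  face_degeneracy_succ n j := hopfCyclicModule_ext fun w m => by
    simp only [LinearMap.comp_apply, hopfFace_mk, hopfDegeneracy_mk, counitAt_succ_dupAt,
      LinearMap.id_apply]
  face_degeneracy_of_gt n i j h := hopfCyclicModule_ext fun w m => by
    simp only [LinearMap.comp_apply, hopfFace_mk, hopfDegeneracy_mk,
      counitAt_succ_dupAt_castSucc h]
  cyc_pow := cyc_pow
  face_zero_cyc := face_zero_cyc
  face_succ_cyc n i := hopfCyclicModule_ext fun w m => by
    rw [LinearMap.comp_apply, LinearMap.comp_apply, hopfFace_mk, hopfCyc_mk, hopfCyc_mk,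
      hopfFace_mkQ_cycAux]
  degeneracy_zero_cyc := degeneracy_zero_cyc
  degeneracy_succ_cyc n j := hopfCyclicModule_ext fun w m => by
    rw [LinearMap.comp_apply, LinearMap.comp_apply, hopfDegeneracy_mk, hopfCyc_mk, hopfCyc_mk,
      hopfDegeneracy_mkQ_cycAux]

end HopfIdentities

/-! ### Transport of the cyclic identities along injective maps. -/

section Transport

variable {k : Type*} [CommRing k] {X Y : ℕ → Type*} [∀ n, AddCommMonoid (X n)]
  [∀ n, Module k (X n)] [∀ n, AddCommMonoid (Y n)] [∀ n, Module k (Y n)]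
  {d : ∀ n, Fin (n + 2) → X (n + 1) →ₗ[k] X n} {s : ∀ n, Fin (n + 1) → X n →ₗ[k] X (n + 1)}
  {t : ∀ n, X n →ₗ[k] X n}
  {d' : ∀ n, Fin (n + 2) → Y (n + 1) →ₗ[k] Y n} {s' : ∀ n, Fin (n + 1) → Y n →ₗ[k] Y (n + 1)}
  {t' : ∀ n, Y n →ₗ[k] Y n}

lemma pow_apply_of_semiconj {M N : Type*} [AddCommMonoid M] [Module k M] [AddCommMonoid N]
    [Module k N] {f : M →ₗ[k] M} {g : N →ₗ[k] N} (φ : M →ₗ[k] N) (h : ∀ x, φ (f x) = g (φ x))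
    (m : ℕ) (x : M) : φ ((f ^ m) x) = (g ^ m) (φ x) := by
  rw [Module.End.pow_apply, Module.End.pow_apply]
  exact Function.Semiconj.iterate_right h m x

/-- The identities of a cyclic module pull back along injective maps commuting with the
operators. -/
lemma IsCyclicModule.of_injective (hY : IsCyclicModule d' s' t') (Φ : ∀ n, X n →ₗ[k] Y n)
    (hΦ : ∀ n, Function.Injective (Φ n))
    (hd : ∀ n i x, Φ n (d n i x) = d' n i (Φ (n + 1) x))
    (hs : ∀ n j x, Φ (n + 1) (s n j x) = s' n j (Φ n x))
    (ht : ∀ n x, Φ n (t n x) = t' n (Φ n x)) : IsCyclicModule d s t where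
  face_face n i j h := LinearMap.ext fun x => hΦ _ <| by
    simpa only [LinearMap.comp_apply, hd] using LinearMap.congr_fun (hY.face_face n i j h) (Φ _ x)
  degeneracy_degeneracy n i j h := LinearMap.ext fun x => hΦ _ <| by
    simpa only [LinearMap.comp_apply, hs] using
      LinearMap.congr_fun (hY.degeneracy_degeneracy n i j h) (Φ _ x)
  face_degeneracy_of_le n i j h := LinearMap.ext fun x => hΦ _ <| by
    simpa only [LinearMap.comp_apply, hs, hd] using
      LinearMap.congr_fun (hY.face_degeneracy_of_le n i j h) (Φ _ x)
  face_degeneracy_self n j := LinearMap.ext fun x => hΦ _ <| by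
    simpa only [LinearMap.comp_apply, hs, hd, LinearMap.id_apply] using
      LinearMap.congr_fun (hY.face_degeneracy_self n j) (Φ _ x)
  face_degeneracy_succ n j := LinearMap.ext fun x => hΦ _ <| by
    simpa only [LinearMap.comp_apply, hs, hd, LinearMap.id_apply] using
      LinearMap.congr_fun (hY.face_degeneracy_succ n j) (Φ _ x)
  face_degeneracy_of_gt n i j h := LinearMap.ext fun x => hΦ _ <| by
    simpa only [LinearMap.comp_apply, hs, hd] using
      LinearMap.congr_fun (hY.face_degeneracy_of_gt n i j h) (Φ _ x)
  cyc_pow n := LinearMap.ext fun x => hΦ _ <| by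
    rw [pow_apply_of_semiconj (Φ n) (ht n), hY.cyc_pow]
    rfl
  face_zero_cyc n := LinearMap.ext fun x => hΦ _ <| by
    simpa only [LinearMap.comp_apply, ht, hd] using
      LinearMap.congr_fun (hY.face_zero_cyc n) (Φ _ x)
  face_succ_cyc n i := LinearMap.ext fun x => hΦ _ <| by
    simpa only [LinearMap.comp_apply, ht, hd] using
      LinearMap.congr_fun (hY.face_succ_cyc n i) (Φ _ x)
  degeneracy_zero_cyc n := LinearMap.ext fun x => hΦ _ <| by
    simpa only [LinearMap.comp_apply, ht, hs] using
      LinearMap.congr_fun (hY.degeneracy_zero_cyc n) (Φ _ x)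
  degeneracy_succ_cyc n i := LinearMap.ext fun x => hΦ _ <| by
    simpa only [LinearMap.comp_apply, ht, hs] using
      LinearMap.congr_fun (hY.degeneracy_succ_cyc n i) (Φ _ x)

end Transport

/-! ### The linear isomorphism between source and target. -/

section Isomorphism

variable (k H A C : Type*) [CommRing k] [Ring H] [HopfAlgebra k H] [Ring A] [Algebra k A]
  [RightComoduleAlgebra k H A] [AddCommGroup C] [Module k C] [Coalgebra k C]
  [RightModuleCoalgebra k H C]

/-- `a ⊗ u ↦ u ⊗_H [1 ⊗ a]`. -/
def toHopf (n : ℕ) : A ⊗[k] (⨂[k]^(n + 1) C) →ₗ[k] HopfCyclicModule k H A C n :=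
  (hopfRel k H A C n).mkQ ∘ₗ
    ((coeffRel k H A).mkQ ∘ₗ TensorProduct.mk k H A 1).lTensor (⨂[k]^(n + 1) C) ∘ₗ
    (TensorProduct.comm k A (⨂[k]^(n + 1) C)).toLinearMap

section lemmas
variable {k H A C} {n m : ℕ}

lemma toHopf_tmul (a : A) (u : ⨂[k]^(n + 1) C) : toHopf k H A C n (a ⊗ₜ u) =
    hopfMk k H A C n u ((coeffRel k H A).mkQ (1 ⊗ₜ a)) := rfl

lemma coeffAct_mkQ (g h : H) (a : A) : coeffAct k H A g ((coeffRel k H A).mkQ (h ⊗ₜ a)) =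
    (coeffRel k H A).mkQ ((g * h) ⊗ₜ a) := rfl

/-- Since `[h ⊗ a] = h · [1 ⊗ a]`, the element `h` crosses the tensor product over `H`. Hence
`toHopf` is surjective and elements of the form `u ⊗_H [1 ⊗ a]` suffice. -/
lemma hopfMk_mkQ (w : ⨂[k]^(n + 1) C) (h : H) (a : A) :
    hopfMk k H A C n w ((coeffRel k H A).mkQ (h ⊗ₜ a)) =
      toHopf k H A C n (a ⊗ₜ diagAct k H C (n + 1) h w) := by
  rw [toHopf_tmul, hopfMk_diagAct, coeffAct_mkQ, mul_one]

/-- Left and right actions of `A` on `A ⊗ C^{⊗(n+1)}` become equal in the target. For `z = b ⊗ u`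
this is the defining relation of `M` with `h = 1`, once `a₍₁₎` has crossed the tensor product over
`H`. -/
lemma toHopf_diagRight (a : A) (z : A ⊗[k] (⨂[k]^(n + 1) C)) :
    toHopf k H A C n (diagRight k H A C (n + 1) a z) =
      toHopf k H A C n ((LinearMap.mulLeft k a).rTensor _ z) := by
  induction z using TensorProduct.induction_on with
  | zero => simp
  | add x y hx hy => simp only [map_add, hx, hy]
  | tmul b u =>
    have h1 : ∀ q : A ⊗[k] H, toHopf k H A C n (TensorProduct.map (LinearMap.mulLeft k b)
        (diagActBilin k H C (n + 1) u) q) =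
        hopfMk k H A C n u ((coeffRel k H A).mkQ (twist k H A 1 b q)) := by
      intro q
      induction q using TensorProduct.induction_on with
      | zero => simp [hopfMk]
      | add x y hx hy =>
        simp only [map_add, hx, hy]
        simp only [hopfMk, TensorProduct.tmul_add, map_add]
      | tmul a' g =>
        rw [TensorProduct.map_tmul, diagActBilin_apply, ← hopfMk_mkQ]
        simp [twist]
    rw [diagRight_tmul, h1, mk_coeffRel]
    rfl

lemma rTensor_mulLeft_mul {X : Type*} [AddCommGroup X] [Module k X] (a b : A) (z : A ⊗[k] X) :
    (LinearMap.mulLeft k (a * b)).rTensor X z =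
      (LinearMap.mulLeft k a).rTensor X ((LinearMap.mulLeft k b).rTensor X z) := by
  rw [LinearMap.mulLeft_mul, LinearMap.rTensor_comp, LinearMap.comp_apply]

lemma toHopf_surjective (y : HopfCyclicModule k H A C n) : ∃ z, toHopf k H A C n z = y := by
  obtain ⟨x, rfl⟩ := Submodule.mkQ_surjective _ y
  induction x using TensorProduct.induction_on with
  | zero => exact ⟨0, by simp⟩
  | add x y hx hy =>
    obtain ⟨z, hz⟩ := hx
    obtain ⟨z', hz'⟩ := hy
    exact ⟨z + z', by simp only [map_add, hz, hz']⟩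
  | tmul w m =>
    obtain ⟨q, rfl⟩ := Submodule.mkQ_surjective _ m
    induction q using TensorProduct.induction_on with
    | zero => exact ⟨0, by simp⟩
    | add x y hx hy =>
      obtain ⟨z, hz⟩ := hx
      obtain ⟨z', hz'⟩ := hy
      exact ⟨z + z', by simp only [map_add, TensorProduct.tmul_add, hz, hz']⟩
    | tmul h a => exact ⟨_, (hopfMk_mkQ w h a).symm⟩

end lemmas

/-- The map `(x₀ ⊗ ⋯ ⊗ xₙ) ⊗ b ↦ u ⊗_H [1 ⊗ b a]`, where `a ⊗ u` is obtained from
`x₀ ⊗ ⋯ ⊗ xₙ` by collecting the factors from `A`. -/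
def freeCoringToHopf (n : ℕ) :
    ⨂[k]^(n + 1) (A ⊗[k] C) →ₗ[k] A →ₗ[k] HopfCyclicModule k H A C n :=
  ((LinearMap.rTensorHom (⨂[k]^(n + 1) C) ∘ₗ LinearMap.mul k A).compr₂
    (toHopf k H A C n)).flip ∘ₗ collect k H A C (n + 1)

lemma freeCoringToHopf_apply (n : ℕ) (w : ⨂[k]^(n + 1) (A ⊗[k] C)) (b : A) :
    freeCoringToHopf k H A C n w b =
      toHopf k H A C n ((LinearMap.mulLeft k b).rTensor _ (collect k H A C (n + 1) w)) := rfl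

/-- The map on the quotient induced by `freeCoringToHopf`. -/
def coringToHopf (n : ℕ) :
    CoringCyclic (galoisCoring k H A C) n →ₗ[k] HopfCyclicModule k H A C n :=
  coringLift (freeCoringToHopf k H A C n)
    (fun i a w => LinearMap.ext fun b => congrArg (fun z => toHopf k H A C n
      ((LinearMap.mulLeft k b).rTensor _ z)) (collect_balanced i a w))
    (fun a' a'' w b => by
      -- After collecting, `a'` acts from the right and commutes with the left multiplications by
      -- `b` and `a''`. In the target it may act from the left instead, which produces
      -- multiplication by `a' b a''`.
      change freeCoringToHopf k H A C n
        (opAt 0 (leftAct k A C a'') (opAt (Fin.last n) (rightAct k H A C a') w)) b = _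
      rw [freeCoringToHopf_apply, freeCoringToHopf_apply, collect_left, collect_right,
        ← diagRight_mul_left, ← diagRight_mul_left,
        toHopf_diagRight, rTensor_mulLeft_mul, rTensor_mulLeft_mul])

/-- The map `(c₀ ⊗ ⋯ ⊗ cₙ) ⊗_H [h ⊗ a] ↦
((1 ⊗ c₀ · h₍₁₎) ⊗_A ⋯ ⊗_A (1 ⊗ cₙ · h₍ₙ₊₁₎)) ⊗_{Aᵉ} a` before passing to the quotients. -/
def freeHopfToCoring (n : ℕ) :
    ⨂[k]^(n + 1) C →ₗ[k] H ⊗[k] A →ₗ[k] CoringCyclic (galoisCoring k H A C) n :=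
  TensorProduct.uncurry (.id k) H A (CoringCyclic (galoisCoring k H A C) n) ∘ₗ
    (diagActBilin k H C (n + 1)).compr₂ (coringMkBilin (galoisCoring k H A C) n ∘ₗ
      PiTensorProduct.map fun _ => TensorProduct.mk k A C 1)

section lemmas
variable {k H A C} {n m : ℕ}

lemma coringToHopf_mk (w : ⨂[k]^(n + 1) (A ⊗[k] C)) (b : A) :
    coringToHopf k H A C n (coringMk (galoisCoring k H A C) n w b) =
      toHopf k H A C n ((LinearMap.mulLeft k b).rTensor _ (collect k H A C (n + 1) w)) := rfl

lemma coringToHopf_mk_one (w : ⨂[k]^(n + 1) (A ⊗[k] C)) :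
    coringToHopf k H A C n (coringMk (galoisCoring k H A C) n w 1) =
      toHopf k H A C n (collect k H A C (n + 1) w) := by
  rw [coringToHopf_mk, LinearMap.mulLeft_one, LinearMap.rTensor_id, LinearMap.id_apply]

lemma coringToHopf_mk_map (u : ⨂[k]^(n + 1) C) (b : A) :
    coringToHopf k H A C n (coringMk (galoisCoring k H A C) n
      (PiTensorProduct.map (fun _ => TensorProduct.mk k A C 1) u) b) =
      toHopf k H A C n (b ⊗ₜ u) := by
  rw [coringToHopf_mk, collect_map, LinearMap.rTensor_tmul, LinearMap.mulLeft_apply, mul_one]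

lemma freeHopfToCoring_tmul (w : ⨂[k]^(n + 1) C) (h : H) (a : A) :
    freeHopfToCoring k H A C n w (h ⊗ₜ a) = coringMk (galoisCoring k H A C) n
      (PiTensorProduct.map (fun _ => TensorProduct.mk k A C 1) (diagAct k H C (n + 1) h w)) a := rfl

lemma coringMk_spread (a b : A) (u : ⨂[k]^(n + 1) C) :
    coringMk (galoisCoring k H A C) n (spread k A C n (a ⊗ₜ u)) b =
      coringMk (galoisCoring k H A C) n
        (PiTensorProduct.map (fun _ => TensorProduct.mk k A C 1) u) (b * a) :=
  coringMk_left (S := galoisCoring k H A C) _ a b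

/-- Write `u = w · h`. The left side has entries `u · a'₍₁₎` and coefficient `a a'₍₀₎`. Moving
`a'₍₀₎` out of the coefficient to the first factor gives the right action of `a'` on `1 ⊗ u`, with
coefficient `a`; this `a'` returns to the coefficient from the other side as `a' a`. -/
lemma freeHopfToCoring_relation (w : ⨂[k]^(n + 1) C) (h : H) (a a' : A) :
    freeHopfToCoring k H A C n w (twist k H A h a (coact k H A a')) =
      freeHopfToCoring k H A C n w (h ⊗ₜ (a' * a)) := by
  let u := diagAct k H C (n + 1) h w
  have h1 : ∀ q : A ⊗[k] H, freeHopfToCoring k H A C n w (twist k H A h a q) =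
      coringMk (galoisCoring k H A C) n (spread k A C n (TensorProduct.map
        (LinearMap.mulLeft k 1) (diagActBilin k H C (n + 1) u) q)) a := by
    intro q
    induction q using TensorProduct.induction_on with
    | zero => simp [coringMk_zero]
    | add x y hx hy => simp only [map_add, coringMk_add, hx, hy]
    | tmul b g =>
      rw [TensorProduct.map_tmul, coringMk_spread, LinearMap.mulLeft_apply, one_mul,
        diagActBilin_apply, ← diagAct_mul]
      rfl
  -- The spread tensor is recognised as `spread (collect _)` of a tensor with `a'` acting on its
  -- last factor, and `mk_spread_collect` replaces it by that tensor.
  rw [h1, ← diagRight_tmul, ← collect_map (H := H), ← collect_right,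
    coringMk_congr (mk_spread_collect (H := H) _)]
  exact coringMk_right (S := galoisCoring k H A C) _ a' a

end lemmas

/-- The map `(c₀ ⊗ ⋯ ⊗ cₙ) ⊗_H [h ⊗ a] ↦
((1 ⊗ c₀ · h₍₁₎) ⊗_A ⋯ ⊗_A (1 ⊗ cₙ · h₍ₙ₊₁₎)) ⊗_{Aᵉ} a`. -/
def hopfToCoring (n : ℕ) :
    HopfCyclicModule k H A C n →ₗ[k] CoringCyclic (galoisCoring k H A C) n :=
  (hopfRel k H A C n).liftQ
    (TensorProduct.lift ((coeffRel k H A).liftQ (freeHopfToCoring k H A C n).flip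
      (coeffRel_le_ker _ fun h a a' => LinearMap.ext fun w =>
        freeHopfToCoring_relation w h a a')).flip)
    (hopfRel_le_ker _ fun w g m => by
      obtain ⟨q, rfl⟩ := Submodule.mkQ_surjective _ m
      induction q using TensorProduct.induction_on with
      | zero => simp
      | add x y hx hy => simp only [map_add, TensorProduct.tmul_add, hx, hy]
      | tmul h a =>
        change freeHopfToCoring k H A C n (diagAct k H C (n + 1) g w) (h ⊗ₜ a) =
          freeHopfToCoring k H A C n w ((g * h) ⊗ₜ a)
        rw [freeHopfToCoring_tmul, freeHopfToCoring_tmul, diagAct_mul])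

section lemmas
variable {k H A C} {n m : ℕ}

/-- With `coringToHopf_mk_one` this shows that the two maps between the quotients are induced by
`spread` and `collect`, so they are mutually inverse because the latter are. -/
lemma hopfToCoring_toHopf (z : A ⊗[k] (⨂[k]^(n + 1) C)) :
    hopfToCoring k H A C n (toHopf k H A C n z) =
      coringMk (galoisCoring k H A C) n (spread k A C n z) 1 := by
  induction z using TensorProduct.induction_on with
  | zero => simp [coringMk_zero]
  | add x y hx hy => simp only [map_add, coringMk_add, hx, hy]
  | tmul a u =>
    rw [coringMk_spread, one_mul]
    change freeHopfToCoring k H A C n u (1 ⊗ₜ a) = _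
    rw [freeHopfToCoring_tmul, diagAct_one]

end lemmas

/-- The isomorphism between the cyclic modules of the Galois coring and of the module
coalgebra. -/
def coringEquivHopf (n : ℕ) :
    CoringCyclic (galoisCoring k H A C) n ≃ₗ[k] HopfCyclicModule k H A C n :=
  { coringToHopf k H A C n with
    invFun := hopfToCoring k H A C n
    left_inv := fun x => by
      obtain ⟨w, rfl⟩ := exists_coringMk_one x
      change hopfToCoring k H A C n (coringToHopf k H A C n _) = _
      rw [coringToHopf_mk_one, hopfToCoring_toHopf, coringMk_congr (mk_spread_collect w)]
    right_inv := fun y => by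
      obtain ⟨z, rfl⟩ := toHopf_surjective y
      change coringToHopf k H A C n (hopfToCoring k H A C n _) = _
      rw [hopfToCoring_toHopf, coringToHopf_mk_one, collect_spread] }

/-! ### Compatibility of the isomorphism with faces, degeneracies and cyclic operators. -/

section lemmas
variable {k H A C} {n m : ℕ}

lemma coringEquivHopf_apply (x : CoringCyclic (galoisCoring k H A C) n) :
    coringEquivHopf k H A C n x = coringToHopf k H A C n x := rfl

lemma lTensor_counitAt_attach (v : A ⊗[k] C) (u : ⨂[k]^m C) :
    (counitAt k C m 0).lTensor A (attach A u v) = coringCounit k A C v ⊗ₜ u := by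
  induction v using TensorProduct.induction_on with
  | zero => simp
  | add x y hx hy => simp only [map_add, TensorProduct.add_tmul, hx, hy]
  | tmul a c =>
    rw [attach_tmul, LinearMap.lTensor_tmul, counitAt_insertAt, coringCounit_tmul,
      TensorProduct.smul_tmul]

/-- Right linearity of the coring counit: pushing `b` through `v` and then applying the counit gives
`ε(v b) = ε(v) b`. -/
lemma lTensor_counitAt_zero_pushFront (v : A ⊗[k] C) (z : A ⊗[k] (⨂[k]^m C)) :
    (counitAt k C m 0).lTensor A (pushFront k H A C m (v ⊗ₜ z)) =
      (LinearMap.mulLeft k (coringCounit k A C v)).rTensor _ z := by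
  induction z using TensorProduct.induction_on with
  | zero => simp
  | add x y hx hy => simp only [map_add, TensorProduct.tmul_add, hx, hy]
  | tmul b u =>
    rw [pushFront_tmul, lTensor_counitAt_attach, counit_rightAct, LinearMap.rTensor_tmul,
      LinearMap.mulLeft_apply]

lemma lTensor_counitAt_succ_pushFront (i : Fin (m + 1)) (v : A ⊗[k] C)
    (z : A ⊗[k] (⨂[k]^(m + 1) C)) :
    (counitAt k C (m + 1) i.succ).lTensor A (pushFront k H A C (m + 1) (v ⊗ₜ z)) =
      pushFront k H A C m (v ⊗ₜ (counitAt k C m i).lTensor A z) := by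
  induction z using TensorProduct.induction_on with
  | zero => simp
  | add x y hx hy => simp only [map_add, TensorProduct.tmul_add, hx, hy]
  | tmul b u =>
    rw [pushFront_tmul, LinearMap.lTensor_tmul, pushFront_tmul]
    generalize rightAct k H A C b v = v
    induction v using TensorProduct.induction_on with
    | zero => simp
    | add x y hx hy => simp only [map_add, hx, hy]
    | tmul a c => rw [attach_tmul, attach_tmul, LinearMap.lTensor_tmul, counitAt_succ_insertAt_zero]

lemma lTensor_dupAt_succ_pushFront (i : Fin (m + 1)) (v : A ⊗[k] C)
    (z : A ⊗[k] (⨂[k]^(m + 1) C)) :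
    (dupAt (Coalgebra.comul (R := k)) i.succ).lTensor A (pushFront k H A C (m + 1) (v ⊗ₜ z)) =
      pushFront k H A C (m + 2) (v ⊗ₜ (dupAt (Coalgebra.comul (R := k)) i).lTensor A z) := by
  induction z using TensorProduct.induction_on with
  | zero => simp
  | add x y hx hy => simp only [map_add, TensorProduct.tmul_add, hx, hy]
  | tmul b u =>
    rw [pushFront_tmul, LinearMap.lTensor_tmul, pushFront_tmul]
    generalize rightAct k H A C b v = v
    induction v using TensorProduct.induction_on with
    | zero => simp
    | add x y hx hy => simp only [map_add, hx, hy]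
    | tmul a c => rw [attach_tmul, attach_tmul, LinearMap.lTensor_tmul, dupAt_succ_insertAt_zero]

lemma collect_freeFace_zero (w : ⨂[k]^(n + 2) (A ⊗[k] C)) :
    collect k H A C (n + 1) (freeFace (galoisCoring k H A C) n 0 w) =
      (counitAt k C (n + 1) 0).lTensor A (collect k H A C (n + 2) w) := by
  induction w using insertAt_induction (k := k) (V := A ⊗[k] C) (i := 0) with
  | h0 => simp
  | hadd x y hx hy => simp only [map_add, hx, hy]
  | h v y =>
    rw [collect_insertAt, lTensor_counitAt_zero_pushFront, ← collect_left]
    exact congrArg _ (freeFace_castSucc (S := galoisCoring k H A C) 0 v y)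

/-- A face beyond the first acts on the tail, so the proof is by induction. The exception is the
last face on two factors, where `ε(x)` is absorbed to the left by the right action on `v`. -/
lemma collect_freeFace (i : Fin (n + 2)) (w : ⨂[k]^(n + 2) (A ⊗[k] C)) :
    collect k H A C (n + 1) (freeFace (galoisCoring k H A C) n i w) =
      (counitAt k C (n + 1) i).lTensor A (collect k H A C (n + 2) w) := by
  induction i using Fin.cases with
  | zero => exact collect_freeFace_zero w
  | succ i =>
    induction n with
    | zero =>
      obtain rfl := Fin.fin_one_eq_zero i
      induction w using insertAt_induction (k := k) (V := A ⊗[k] C) (i := 0) with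
      | h0 => simp
      | hadd x y hx hy => simp only [map_add, hx, hy]
      | h v y =>
        rw [collect_insertAt, lTensor_counitAt_succ_pushFront]
        induction y using insertAt_induction (k := k) (V := A ⊗[k] C) (i := 0) with
        | h0 => simp
        | hadd x y hx hy => simp only [map_add, TensorProduct.tmul_add, hx, hy]
        | h x t =>
          -- On the collected side `ε(x)` multiplies the tail from the left; balancing turns it into
          -- the right action of `ε(x)` on `v`, as the last face prescribes.
          rw [collect_insertAt, lTensor_counitAt_zero_pushFront, ← pushFront_rightAct,
            ← collect_insertAt, ← opAt_insertAt_self]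
          refine congrArg _ (Eq.trans ?_
            (freeFace_last (S := galoisCoring k H A C) x (insertAt 0 (v ⊗ₜ t))))
          rw [← insertAt_zero_insertAt_last]
          rfl
    | succ n ih =>
      induction w using insertAt_induction (k := k) (V := A ⊗[k] C) (i := 0) with
      | h0 => simp
      | hadd x y hx hy => simp only [map_add, hx, hy]
      | h v y =>
        -- The induction hypothesis covers only positive positions in the tail, so position `0` is
        -- supplied separately.
        have hi : collect k H A C (n + 1) (freeFace (galoisCoring k H A C) n i y) =
            (counitAt k C (n + 1) i).lTensor A (collect k H A C (n + 2) y) := by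
          induction i using Fin.cases with
          | zero => exact collect_freeFace_zero y
          | succ i => exact ih y i
        rw [freeFace_succ_insertAt_zero, collect_insertAt, collect_insertAt,
          lTensor_counitAt_succ_pushFront, hi]

/-- Let `b` be the coefficient of the collected tail. Comultiplying first, `b` crosses `1 ⊗ c₍₂₎`
and then `a ⊗ c₍₁₎`, giving `a b₍₀₎ ⊗ c₍₁₎ · b₍₁₎ ⊗ c₍₂₎ · b₍₂₎` by coassociativity of the coaction.
Collecting first gives `a b₍₀₎ ⊗ Δ(c · b₍₁₎)`, which is the same because `C` is a module coalgebra.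
-/
lemma collect_dupAt_zero (w : ⨂[k]^(n + 1) (A ⊗[k] C)) :
    collect k H A C (n + 2) (dupAt (coringComul k A C) 0 w) =
      (dupAt (Coalgebra.comul (R := k)) 0).lTensor A (collect k H A C (n + 1) w) := by
  induction w using insertAt_induction (k := k) (V := A ⊗[k] C) (i := 0) with
  | h0 => simp
  | hadd x y hx hy => simp only [map_add, hx, hy]
  | h v y =>
  induction v using TensorProduct.induction_on with
  | zero => simp
  | add x y hx hy => simp only [map_add, TensorProduct.add_tmul, hx, hy]
  | tmul a c =>
    let P := TensorProduct.map₂ (RightModuleCoalgebra.act (k := k) (H := H) (C := C))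
      (RightModuleCoalgebra.act (k := k) (H := H) (C := C))
    let Q (z : A ⊗[k] (⨂[k]^n C)) :
        (A ⊗[k] C) ⊗[k] (A ⊗[k] C) →ₗ[k] A ⊗[k] (⨂[k]^(n + 2) C) :=
      pushFront k H A C (n + 1) ∘ₗ
        (pushFront k H A C n ∘ₗ (TensorProduct.mk k _ _).flip z).lTensor (A ⊗[k] C)
    have hQ : collect k H A C (n + 2) (dupAt (coringComul k A C) 0 (insertAt 0 ((a ⊗ₜ c) ⊗ₜ y))) =
        Q (collect k H A C n y) (coringComul k A C (a ⊗ₜ c)) := by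
      rw [dupAt_zero_insertAt]
      generalize coringComul k A C (a ⊗ₜ c) = z
      induction z using TensorProduct.induction_on with
      | zero => simp
      | add x y hx hy => simp only [map_add, TensorProduct.add_tmul, hx, hy]
      | tmul v v' =>
        rw [TensorProduct.assoc_tmul, LinearMap.lTensor_tmul, collect_insertAt, collect_insertAt]
        rfl
    rw [hQ, collect_insertAt]
    generalize collect k H A C n y = z
    induction z using TensorProduct.induction_on with
    | zero => simp [Q]
    | add x y hx hy =>
      simp only [Q, map_add, TensorProduct.tmul_add, LinearMap.comp_add, LinearMap.lTensor_add,
        LinearMap.add_apply] at hx hy ⊢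
      rw [hx, hy]
    | tmul b u =>
      let J : C ⊗[k] C →ₗ[k] ⨂[k]^(n + 2) C :=
        insertAt 0 ∘ₗ (insertAt 0 ∘ₗ (TensorProduct.mk k C _).flip u).lTensor C
      -- Stated for an arbitrary `q` in place of the coaction of `b`, so that it is linear in `q`
      -- and pure tensors suffice; coassociativity enters only in `h2`.
      have h1 : ∀ (c₁ c₂ : C) (q : A ⊗[k] H),
          pushFront k H A C (n + 1) ((a ⊗ₜ c₁) ⊗ₜ attach A u (TensorProduct.map
            (LinearMap.mulLeft k 1) (RightModuleCoalgebra.act (k := k) c₂) q)) =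
          TensorProduct.map (LinearMap.mulLeft k a) (J ∘ₗ P (c₁ ⊗ₜ c₂))
            (TensorProduct.assoc k A H H ((coact k H A).rTensor H q)) := by
        intro c₁ c₂ q
        induction q using TensorProduct.induction_on with
        | zero => simp
        | add x y hx hy => simp only [map_add, TensorProduct.tmul_add, hx, hy]
        | tmul b' g =>
          rw [TensorProduct.map_tmul, attach_tmul, pushFront_tmul, LinearMap.mulLeft_apply,
            one_mul, rightAct_tmul, LinearMap.rTensor_tmul]
          generalize coact k H A b' = r
          induction r using TensorProduct.induction_on with
          | zero => simp
          | add x y hx hy => simp only [map_add, TensorProduct.add_tmul, hx, hy]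
          | tmul x y => rfl
      have h2 : ∀ z : C ⊗[k] C, Q (b ⊗ₜ u) ((TensorProduct.mk k A C 1).lTensor (A ⊗[k] C)
            ((TensorProduct.assoc k A C C).symm (a ⊗ₜ z))) =
          TensorProduct.map (LinearMap.mulLeft k a) (J ∘ₗ P z)
            ((Coalgebra.comul (R := k)).lTensor A (coact k H A b)) := by
        intro z
        induction z using TensorProduct.induction_on with
        | zero => simp
        | add x y hx hy => simp only [map_add, TensorProduct.tmul_add, LinearMap.comp_add,
            TensorProduct.map_add_right, LinearMap.add_apply, hx, hy]
        | tmul c₁ c₂ =>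
          rw [← coact_coassoc, ← h1, ← rightAct_tmul, ← pushFront_tmul]
          rfl
      have hJ : ∀ z : C ⊗[k] C,
          insertAt 0 ((insertAt 0).lTensor C (TensorProduct.assoc k C C _ (z ⊗ₜ u))) = J z := by
        intro z
        induction z using TensorProduct.induction_on with
        | zero => simp
        | add x y hx hy => simp only [map_add, TensorProduct.add_tmul, hx, hy]
        | tmul c₁ c₂ => rfl
      have h3 : ∀ q : A ⊗[k] H, (dupAt (Coalgebra.comul (R := k)) 0).lTensor A (attach A u
            (TensorProduct.map (LinearMap.mulLeft k a) (RightModuleCoalgebra.act (k := k) c) q)) =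
          TensorProduct.map (LinearMap.mulLeft k a) (J ∘ₗ P (Coalgebra.comul (R := k) c))
            ((Coalgebra.comul (R := k)).lTensor A q) := by
        intro q
        induction q using TensorProduct.induction_on with
        | zero => simp
        | add x y hx hy => simp only [map_add, hx, hy]
        | tmul b' g =>
          rw [TensorProduct.map_tmul, attach_tmul, LinearMap.lTensor_tmul, dupAt_zero_insertAt, hJ,
            RightModuleCoalgebra.comul_act]
          rfl
      rw [pushFront_tmul, rightAct_tmul, h3, ← h2]
      rfl

lemma collect_dupAt (j : Fin (n + 1)) (w : ⨂[k]^(n + 1) (A ⊗[k] C)) :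
    collect k H A C (n + 2) (dupAt (coringComul k A C) j w) =
      (dupAt (Coalgebra.comul (R := k)) j).lTensor A (collect k H A C (n + 1) w) := by
  induction n with
  | zero =>
    obtain rfl := Fin.fin_one_eq_zero j
    exact collect_dupAt_zero w
  | succ n ih =>
    induction j using Fin.cases with
    | zero => exact collect_dupAt_zero w
    | succ j =>
      induction w using insertAt_induction (k := k) (V := A ⊗[k] C) (i := 0) with
      | h0 => simp
      | hadd x y hx hy => simp only [map_add, hx, hy]
      | h v y =>
        rw [dupAt_succ_insertAt_zero, collect_insertAt, ih, collect_insertAt,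
          lTensor_dupAt_succ_pushFront]

lemma toHopf_counitAt (i : Fin (n + 2)) (z : A ⊗[k] (⨂[k]^(n + 2) C)) :
    toHopf k H A C n ((counitAt k C (n + 1) i).lTensor A z) =
      hopfFace k H A C n i (toHopf k H A C (n + 1) z) := by
  induction z using TensorProduct.induction_on with
  | zero => simp
  | add x y hx hy => simp only [map_add, hx, hy]
  | tmul a u => rfl

lemma toHopf_dupAt (j : Fin (n + 1)) (z : A ⊗[k] (⨂[k]^(n + 1) C)) :
    toHopf k H A C (n + 1) ((dupAt (Coalgebra.comul (R := k)) j).lTensor A z) =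
      hopfDegeneracy k H A C n j (toHopf k H A C n z) := by
  induction z using TensorProduct.induction_on with
  | zero => simp
  | add x y hx hy => simp only [map_add, hx, hy]
  | tmul a u => rfl

lemma coringEquivHopf_face (i : Fin (n + 2)) (x : CoringCyclic (galoisCoring k H A C) (n + 1)) :
    coringEquivHopf k H A C n (coringFace (galoisCoring k H A C) n i x) =
      hopfFace k H A C n i (coringEquivHopf k H A C (n + 1) x) := by
  obtain ⟨w, rfl⟩ := exists_coringMk_one x
  rw [coringFace_mk, coringEquivHopf_apply, coringEquivHopf_apply, coringToHopf_mk_one,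
    coringToHopf_mk_one, collect_freeFace, toHopf_counitAt]

lemma coringEquivHopf_degeneracy (j : Fin (n + 1)) (x : CoringCyclic (galoisCoring k H A C) n) :
    coringEquivHopf k H A C (n + 1) (coringDegeneracy (galoisCoring k H A C) n j x) =
      hopfDegeneracy k H A C n j (coringEquivHopf k H A C n x) := by
  obtain ⟨w, rfl⟩ := exists_coringMk_one x
  rw [coringDegeneracy_mk, coringEquivHopf_apply, coringEquivHopf_apply, coringToHopf_mk_one,
    coringToHopf_mk_one, ← toHopf_dupAt]
  exact congrArg _ (collect_dupAt j w)

/-- All legs of `1 ∈ H` are `1` and `S(1) = 1`, so the conjugation drops out and only the coaction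
of `A` remains. This is why the generators `[1 ⊗ a]` make the cyclic operator easy to compare. -/
lemma coeffCoact_mkQ_one (a : A) : coeffCoact k H A ((coeffRel k H A).mkQ (1 ⊗ₜ a)) =
    ((coeffRel k H A).mkQ ∘ₗ TensorProduct.mk k H A 1).rTensor H (coact k H A a) := by
  change (coeffRel k H A).mkQ.rTensor H (coactShuffle k H A (comul₂ 1 ⊗ₜ coact k H A a)) = _
  rw [comul₂, LinearMap.comp_apply, Bialgebra.comul_one, Algebra.TensorProduct.one_def,
    LinearMap.lTensor_tmul, Bialgebra.comul_one, Algebra.TensorProduct.one_def]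
  generalize coact k H A a = q
  induction q using TensorProduct.induction_on with
  | zero => simp
  | add x y hx hy => simp only [map_add, TensorProduct.tmul_add, hx, hy]
  | tmul b g => simp

/-- The coefficient `a` acts on the last factor from the right, `(1 ⊗ c) a = a₍₀₎ ⊗ c · a₍₁₎`, and
rotation brings this factor to the front. There its coefficient `a₍₀₎` needs no further moving, and
`a₍₁₎` acts on `c` just as in the target. -/
lemma coringToHopf_cyc_mk_map (a : A) (u : ⨂[k]^(n + 1) C) :
    coringToHopf k H A C n (coringCyc (galoisCoring k H A C) n
      (coringMk (galoisCoring k H A C) n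
        (PiTensorProduct.map (fun _ => TensorProduct.mk k A C 1) u) a)) =
      hopfCyc k H A C n (toHopf k H A C n (a ⊗ₜ u)) := by
  rw [coringCyc_mk, coringToHopf_mk_one, toHopf_tmul, hopfCyc_mk, coeffCoact_mkQ_one]
  change toHopf k H A C n (collect k H A C (n + 1) (rotateBy (rightAct k H A C) n a _)) = _
  induction u using insertAt_induction (i := Fin.last _) with
  | h0 => simp [cycAux]
  | hadd x y hx hy =>
    simp only [cycAux, map_add, LinearMap.comp_apply, LinearMap.rTensor_add,
      LinearMap.add_apply] at hx hy ⊢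
    rw [hx, hy]
  | h c y =>
    rw [rotateBy_apply, map_insertAt, rotate_insertAt_last, opAt_insertAt_self, collect_insertAt,
      collect_map, pushFront_tmul, rightAct_one, LinearMap.id_apply, TensorProduct.mk_apply,
      rightAct_tmul]
    generalize coact k H A a = q
    induction q using TensorProduct.induction_on with
    | zero => simp
    | add x y hx hy => simp only [map_add, hx, hy]
    | tmul b g =>
      rw [LinearMap.rTensor_tmul, cycAux_insertAt, TensorProduct.map_tmul, attach_tmul,
        LinearMap.mulLeft_apply, one_mul]
      rfl

/-- The representatives used here are opposite to those of `exists_coringMk_one`: all entries from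
`A` are `1` and the coefficient is arbitrary. They exhaust the source additively because `toHopf` is
surjective. -/
lemma coringEquivHopf_cyc (x : CoringCyclic (galoisCoring k H A C) n) :
    coringEquivHopf k H A C n (coringCyc (galoisCoring k H A C) n x) =
      hopfCyc k H A C n (coringEquivHopf k H A C n x) := by
  obtain ⟨y, rfl⟩ := (coringEquivHopf k H A C n).symm.surjective x
  obtain ⟨z, rfl⟩ := toHopf_surjective y
  rw [LinearEquiv.apply_symm_apply]
  change coringToHopf k H A C n (coringCyc (galoisCoring k H A C) n
    (hopfToCoring k H A C n _)) = _
  induction z using TensorProduct.induction_on with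
  | zero => simp
  | add x y hx hy => simp only [map_add, hx, hy]
  | tmul a u =>
    rw [hopfToCoring_toHopf, coringMk_spread, one_mul, coringToHopf_cyc_mk_map]

/-- The three identities involving the last factor are pulled from the coring side through the
surjective `coringEquivHopf`. A direct check on the target would need the stability of `M` as a
module and comodule. -/
lemma isCyclicModule_hopfCyclicModule :
    IsCyclicModule (hopfFace k H A C) (hopfDegeneracy k H A C) (hopfCyc k H A C) := by
  refine isCyclicModule_hopf (fun n => ?_) (fun n => ?_) (fun n => ?_) <;>
    refine LinearMap.ext fun y => ?_ <;>
    obtain ⟨x, rfl⟩ := (coringEquivHopf k H A C _).surjective y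
  · rw [← LinearEquiv.coe_coe, ← pow_apply_of_semiconj (coringEquivHopf k H A C n).toLinearMap
      coringEquivHopf_cyc, coringCyc_pow]
    rfl
  · rw [LinearMap.comp_apply, ← coringEquivHopf_cyc, ← coringEquivHopf_face, coringFace_zero_cyc,
      coringEquivHopf_face]
  · simp only [LinearMap.comp_apply]
    rw [← coringEquivHopf_cyc, ← coringEquivHopf_degeneracy, coringDegeneracy_zero_cyc,
      coringEquivHopf_cyc, coringEquivHopf_cyc, coringEquivHopf_degeneracy]

/-- The direction is reversed for the complete list of identities. There is no circularity: the
three identities sent to the target were proved directly for the coring. -/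
lemma isCyclicModule_coringCyclic :
    IsCyclicModule (coringFace (galoisCoring k H A C)) (coringDegeneracy (galoisCoring k H A C))
      (coringCyc (galoisCoring k H A C)) :=
  isCyclicModule_hopfCyclicModule.of_injective
    (fun n => (coringEquivHopf k H A C n).toLinearMap)
    (fun n => (coringEquivHopf k H A C n).injective)
    (fun _ => coringEquivHopf_face) (fun _ => coringEquivHopf_degeneracy)
    (fun _ => coringEquivHopf_cyc)

end lemmas

end Isomorphism

/-! ### The explicit formulas for the isomorphism and for its inverse. -/

section Formulas

variable {k H A C : Type*} [CommRing k] [Ring H] [HopfAlgebra k H] [Ring A] [Algebra k A]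
  [RightComoduleAlgebra k H A] [AddCommGroup C] [Module k C] [Coalgebra k C]
  [RightModuleCoalgebra k H C] {n m : ℕ}

/-- The multiplicative map `b ⊗ u ↦ b₍₀₎ ⊗ (b₍₁₎ ⊗ u)`. -/
def coactFront (k H A : Type*) [CommRing k] [Ring H] [HopfAlgebra k H] [Ring A] [Algebra k A]
    [RightComoduleAlgebra k H A] (m : ℕ) : A ⊗[k] (⨂[k]^m H) →ₗ[k] A ⊗[k] (⨂[k]^(m + 1) H) :=
  (insertAt 0).lTensor A ∘ₗ (TensorProduct.assoc k A H (⨂[k]^m H)).toLinearMap ∘ₗ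
    (coact k H A).rTensor (⨂[k]^m H)

lemma coactFront_tmul (b : A) (u : ⨂[k]^m H) : coactFront k H A m (b ⊗ₜ u) =
    (insertAt 0 ∘ₗ (TensorProduct.mk k H _).flip u).lTensor A (coact k H A b) := by
  rw [coactFront, LinearMap.comp_apply, LinearMap.comp_apply, LinearMap.rTensor_tmul]
  generalize coact k H A b = q
  induction q using TensorProduct.induction_on with
  | zero => simp
  | add x y hx hy => simp only [map_add, TensorProduct.add_tmul, hx, hy]
  | tmul a g => rfl

lemma coactFront_mul (x y : A ⊗[k] (⨂[k]^m H)) :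
    coactFront k H A m (x * y) = coactFront k H A m x * coactFront k H A m y := by
  induction x using TensorProduct.induction_on with
  | zero => simp
  | add a b ha hb => simp only [map_add, add_mul, ha, hb]
  | tmul a u =>
  induction y using TensorProduct.induction_on with
  | zero => simp
  | add a b ha hb => simp only [map_add, mul_add, ha, hb]
  | tmul b v =>
    rw [Algebra.TensorProduct.tmul_mul_tmul, coactFront_tmul, coactFront_tmul, coactFront_tmul,
      coact_mul]
    generalize coact k H A a = p
    generalize coact k H A b = q
    induction p using TensorProduct.induction_on with
    | zero => simp
    | add x y hx hy => simp only [map_add, add_mul, hx, hy]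
    | tmul a g =>
    induction q using TensorProduct.induction_on with
    | zero => simp
    | add x y hx hy => simp only [map_add, mul_add, hx, hy]
    | tmul b h => simp [← insertAt_mul]

lemma coactFront_one : coactFront k H A m 1 = 1 := by
  rw [Algebra.TensorProduct.one_def, coactFront_tmul, coact_one, Algebra.TensorProduct.one_def,
    LinearMap.lTensor_tmul, LinearMap.comp_apply, LinearMap.flip_apply, TensorProduct.mk_apply,
    ← Algebra.TensorProduct.one_def, insertAt_one, ← Algebra.TensorProduct.one_def]

lemma coactFront_list_prod (l : List (A ⊗[k] (⨂[k]^m H))) :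
    coactFront k H A m l.prod = (l.map (coactFront k H A m)).prod := by
  induction l with
  | nil => exact coactFront_one
  | cons x l ih => rw [List.prod_cons, coactFront_mul, ih, List.map_cons, List.prod_cons]

/-- The first factor has nothing to its left to act on; counitality of the coaction reduces its
contribution to `a ⊗ 1`. -/
lemma lTensor_legs_zero (a : A) :
    (legs k H m 0).lTensor A (coact k H A a) = a ⊗ₜ 1 := by
  have h1 : ∀ q : A ⊗[k] H, (legs k H m 0).lTensor A q =
      TensorProduct.rid k A ((Coalgebra.counit (R := k)).lTensor A q) ⊗ₜ 1 := by
    intro q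
    induction q using TensorProduct.induction_on with
    | zero => simp
    | add x y hx hy => simp only [map_add, TensorProduct.add_tmul, hx, hy]
    | tmul b g =>
      rcases m <;> simp [legs, Algebra.algebraMap_eq_smul_one, TensorProduct.smul_tmul']
  rw [h1, coact_counit]

/-- Coassociativity of the coaction: adding one more leg of `a` at the front amounts to coacting
once more on the component in `A`. This matches the passage of the tail through one new factor in
`collect`. -/
lemma lTensor_legs_succ (j : ℕ) (a : A) :
    (legs k H (m + 1) (j + 1)).lTensor A (coact k H A a) =
      coactFront k H A m ((legs k H m j).lTensor A (coact k H A a)) := by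
  let L : A ⊗[k] (H ⊗[k] H) →ₗ[k] A ⊗[k] (⨂[k]^(m + 1) H) :=
    (insertAt 0 ∘ₗ (legs k H m j).lTensor H).lTensor A
  have h1 : ∀ q : A ⊗[k] H, (legs k H (m + 1) (j + 1)).lTensor A q =
      L ((Coalgebra.comul (R := k)).lTensor A q) := by
    intro q
    induction q using TensorProduct.induction_on with
    | zero => simp
    | add x y hx hy => simp only [map_add, hx, hy]
    | tmul b g => rfl
  have h2 : ∀ q : A ⊗[k] H, coactFront k H A m ((legs k H m j).lTensor A q) =
      L (TensorProduct.assoc k A H H ((coact k H A).rTensor H q)) := by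
    intro q
    induction q using TensorProduct.induction_on with
    | zero => simp
    | add x y hx hy => simp only [map_add, hx, hy]
    | tmul b g =>
      rw [LinearMap.lTensor_tmul, coactFront_tmul, LinearMap.rTensor_tmul]
      generalize coact k H A b = r
      induction r using TensorProduct.induction_on with
      | zero => simp
      | add x y hx hy => simp only [map_add, TensorProduct.add_tmul, hx, hy]
      | tmul x y => rfl
  rw [h1, h2, coact_coassoc]

/-- Moves the operation of `pushFront` from `C`-tensors to the algebra `A ⊗ H^{⊗(m+1)}`, where it is
multiplication by `a ⊗ 1` after the algebra map `coactFront`. -/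
lemma pushFront_lTensor_tensorAct (a : A) (c : C) (y : ⨂[k]^m C) (z : A ⊗[k] (⨂[k]^m H)) :
    pushFront k H A C m ((a ⊗ₜ c) ⊗ₜ (tensorAct k H C m y).lTensor A z) =
      (tensorAct k H C (m + 1) (insertAt 0 (c ⊗ₜ y))).lTensor A
        ((a ⊗ₜ 1) * coactFront k H A m z) := by
  induction z using TensorProduct.induction_on with
  | zero => simp
  | add x y hx hy => simp only [map_add, TensorProduct.tmul_add, mul_add, hx, hy]
  | tmul b u =>
    rw [LinearMap.lTensor_tmul, pushFront_tmul, rightAct_tmul, coactFront_tmul]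
    generalize coact k H A b = q
    induction q using TensorProduct.induction_on with
    | zero => simp
    | add x y hx hy => simp only [map_add, mul_add, hx, hy]
    | tmul b g => simp [tensorAct_insertAt]

lemma tprod_eq_insertAt_zero {V : Type*} [AddCommGroup V] [Module k V] (x : Fin (m + 1) → V) :
    PiTensorProduct.tprod k x =
      insertAt 0 (x 0 ⊗ₜ PiTensorProduct.tprod k fun i => x i.succ) := by
  rw [insertAt_tmul]
  congr 1
  exact (Fin.insertNth_self_removeNth 0 x).symm

/-- By induction the tail is a product in `A ⊗ H^{⊗m}`. Because `coactFront` is multiplicative,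
passing through a new first factor gives every element of the tail one more leg, and multiplication
by `a₀ ⊗ 1` supplies the first term of the longer product. -/
lemma collect_tprod (a : Fin m → A) (c : Fin m → C) :
    collect k H A C m (PiTensorProduct.tprod k fun i => a i ⊗ₜ[k] c i) =
      (tensorAct k H C m (PiTensorProduct.tprod k c)).lTensor A
        (List.ofFn fun j : Fin m => (legs k H m j).lTensor A (coact k H A (a j))).prod := by
  induction m with
  | zero =>
    rw [List.ofFn_zero, List.prod_nil, Algebra.TensorProduct.one_def, LinearMap.lTensor_tmul,
      tensorAct_one, ← collect_map (H := H), PiTensorProduct.map_tprod]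
    congr 2
    exact Subsingleton.elim _ _
  | succ m ih =>
    rw [tprod_eq_insertAt_zero, collect_insertAt, ih, pushFront_lTensor_tensorAct, coactFront_list_prod,
      List.map_ofFn,
      tprod_eq_insertAt_zero c, List.ofFn_succ, List.prod_cons, Fin.val_zero, lTensor_legs_zero]
    congr 4
    funext j
    exact (lTensor_legs_succ _ _).symm

lemma coringEquivHopf_tprod (a : Fin (n + 1) → A) (c : Fin (n + 1) → C) :
    coringEquivHopf k H A C n (coringMk (galoisCoring k H A C) n
      (PiTensorProduct.tprod k fun i => a i ⊗ₜ[k] c i) 1) = phiFormula k H A C n a c := by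
  rw [coringEquivHopf_apply, coringToHopf_mk_one, collect_tprod, phiFormula]
  simp only [coactLegs, LinearMap.comp_apply]
  generalize (List.ofFn fun j : Fin (n + 1) =>
    (legs k H (n + 1) j).lTensor A (coact k H A (a j))).prod = z
  induction z using TensorProduct.induction_on with
  | zero => simp
  | add x y hx hy => simp only [map_add, hx, hy]
  | tmul b u => rfl

/-- `h₁ ⊗ ⋯ ⊗ hₘ ↦ f(hₘ) ⊗ ⋯ ⊗ f(h₁)`. -/
def revMap (f : H →ₗ[k] H) (m : ℕ) : ⨂[k]^m H →ₗ[k] ⨂[k]^m H :=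
  (PiTensorProduct.reindex k (fun _ => H) Fin.revPerm).toLinearMap ∘ₗ
    PiTensorProduct.map fun _ => f

lemma revMap_insertAt_last (f : H →ₗ[k] H) (h : H) (u : ⨂[k]^m H) :
    revMap f (m + 1) (insertAt (Fin.last m) (h ⊗ₜ u)) = insertAt 0 (f h ⊗ₜ revMap f m u) := by
  induction u using PiTensorProduct.induction_on with
  | add a b ha hb => simp only [map_add, TensorProduct.tmul_add, ha, hb]
  | smul_tprod r x =>
    simp only [revMap, LinearMap.comp_apply, LinearEquiv.coe_coe, map_smul,
      TensorProduct.tmul_smul, insertAt_tmul, PiTensorProduct.map_tprod]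
    erw [PiTensorProduct.reindex_tprod, PiTensorProduct.reindex_tprod]
    rw [insertAt_tmul]
    congr 2
    funext j
    refine Fin.cases ?_ (fun j => ?_) j
    · simp
    · simp only [Fin.revPerm_symm, Fin.revPerm_apply, Fin.rev_succ, Fin.insertNth_last',
        Fin.snoc_castSucc, Fin.insertNth_zero', Fin.cons_succ]
      rfl

lemma revMap_one {f : H →ₗ[k] H} (hf : f 1 = 1) : revMap f m 1 = 1 := by
  rw [revMap, LinearMap.comp_apply, PiTensorProduct.one_def, PiTensorProduct.map_tprod]
  erw [PiTensorProduct.reindex_tprod]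
  congr 1
  funext j
  exact hf

variable {Sinv : H →ₗ[k] H}

lemma antipodeInv_one (h₁ : Sinv ∘ₗ HopfAlgebra.antipode k = LinearMap.id) : Sinv 1 = 1 := by
  simpa using LinearMap.congr_fun h₁ (1 : H)

/-- `S⁻¹(h₍₂₎) h₍₁₎ = ε(h)`. -/
lemma antipodeInv_mul_comul (h₁ : Sinv ∘ₗ HopfAlgebra.antipode k = LinearMap.id)
    (h₂ : HopfAlgebra.antipode k ∘ₗ Sinv = LinearMap.id) (h : H) :
    LinearMap.mul' k H (TensorProduct.comm k H H (Sinv.lTensor H (Coalgebra.comul (R := k) h))) =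
      Coalgebra.counit (R := k) h • 1 := by
  -- The injective anti-homomorphism `S` may be applied to both sides. It turns `S⁻¹(h₍₂₎) h₍₁₎`
  -- into `S(h₍₁₎) h₍₂₎`, which is covered by the antipode axiom.
  refine Function.LeftInverse.injective (f := HopfAlgebra.antipode k) (LinearMap.congr_fun h₁) ?_
  have h3 : ∀ z : H ⊗[k] H, HopfAlgebra.antipode k
      (LinearMap.mul' k H (TensorProduct.comm k H H (Sinv.lTensor H z))) =
      LinearMap.mul' k H ((HopfAlgebra.antipode k).rTensor H z) := by
    intro z
    induction z using TensorProduct.induction_on with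
    | zero => simp
    | add x y hx hy => simp only [map_add, hx, hy]
    | tmul x y =>
      simp only [LinearMap.lTensor_tmul, TensorProduct.comm_tmul, LinearMap.mul'_apply,
        HopfAlgebra.antipode_mul_antidistrib, LinearMap.rTensor_tmul]
      rw [show HopfAlgebra.antipode k (Sinv y) = y from LinearMap.congr_fun h₂ y]
  rw [h3, HopfAlgebra.mul_antipode_rTensor_comul_apply]
  simp [Algebra.algebraMap_eq_smul_one]

/-- `x ⊗ y ↦ (f(y₍ₘ₎) ⊗ ⋯ ⊗ f(y₍₁₎)) (x₍₁₎ ⊗ ⋯ ⊗ x₍ₘ₎)`. -/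
def revMul (f : H →ₗ[k] H) (m : ℕ) : H ⊗[k] H →ₗ[k] ⨂[k]^m H :=
  LinearMap.mul' k (⨂[k]^m H) ∘ₗ (TensorProduct.comm k _ _).toLinearMap ∘ₗ
    TensorProduct.map (iterComul k H m) (revMap f m ∘ₗ iterComul k H m)

lemma revMul_tmul (f : H →ₗ[k] H) (x y : H) :
    revMul f m (x ⊗ₜ y) = revMap f m (iterComul k H m y) * iterComul k H m x := rfl

/-- Reversal brings the last leg of `y` to the front, where it meets the first leg of `x`. The rest
is the same expression one length shorter, `f(y₍₂₎) x₍₁₎ ⊗ revMul (x₍₂₎ ⊗ y₍₁₎)`. -/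
lemma revMul_succ_tmul (f : H →ₗ[k] H) (x y : H) :
    revMul f (m + 1) (x ⊗ₜ y) = insertAt 0 (TensorProduct.map
      (LinearMap.mul' k H ∘ₗ (TensorProduct.comm k H H).toLinearMap ∘ₗ f.lTensor H) (revMul f m)
      (TensorProduct.tensorTensorTensorComm k H H H H
        (Coalgebra.comul (R := k) x ⊗ₜ
          TensorProduct.comm k H H (Coalgebra.comul (R := k) y)))) := by
  rw [revMul_tmul, ← insertAt_removeAt (Fin.last m) (iterComul k H (m + 1) y),
    removeAt_last_iterComul, iterComul_succ]
  generalize Coalgebra.comul (R := k) x = p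
  generalize Coalgebra.comul (R := k) y = q
  induction p using TensorProduct.induction_on with
  | zero => simp
  | add a b ha hb => simp only [map_add, TensorProduct.add_tmul, mul_add, ha, hb]
  | tmul x₁ x₂ =>
  induction q using TensorProduct.induction_on with
  | zero => simp
  | add a b ha hb => simp only [map_add, TensorProduct.tmul_add, add_mul, ha, hb]
  | tmul y₁ y₂ =>
    simp [revMap_insertAt_last, ← insertAt_mul, revMul_tmul]

/-- The cancellation proceeds from the inside: with four legs of `h`, the value is `S⁻¹(h₍₄₎) h₍₁₎ ⊗
revMul (h₍₂₎ ⊗ h₍₃₎)`. By induction the inner pair is a counit, which leaves `S⁻¹(h₍₂₎) h₍₁₎ = ε(h)`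
in the first factor. -/
lemma revMul_comul (h₁ : Sinv ∘ₗ HopfAlgebra.antipode k = LinearMap.id)
    (h₂ : HopfAlgebra.antipode k ∘ₗ Sinv = LinearMap.id) (h : H) :
    revMul Sinv m (Coalgebra.comul (R := k) h) = Coalgebra.counit (R := k) h • 1 := by
  induction m generalizing h with
  | zero =>
    have h3 : ∀ z : H ⊗[k] H, revMul Sinv 0 z = Coalgebra.counit (R := k)
        (TensorProduct.lid k H ((Coalgebra.counit (R := k)).rTensor H z)) • 1 := by
      intro z
      induction z using TensorProduct.induction_on with
      | zero => simp
      | add x y hx hy => simp only [map_add, add_smul, hx, hy]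
      | tmul x y =>
        rw [revMul_tmul, iterComul_zero, iterComul_zero, map_smul,
          revMap_one (antipodeInv_one h₁)]
        simp [smul_smul]
    rw [h3, Coalgebra.rTensor_counit_comul]
    simp
  | succ m ih =>
    let N : H ⊗[k] H →ₗ[k] H :=
      LinearMap.mul' k H ∘ₗ (TensorProduct.comm k H H).toLinearMap ∘ₗ Sinv.lTensor H
    /- `(x ⊗ (y ⊗ z)) ⊗ t ↦ S⁻¹(t) x ⊗ revMul (y ⊗ z)` -/
    let Q (t : H) : H ⊗[k] (H ⊗[k] H) →ₗ[k] H ⊗[k] (⨂[k]^m H) :=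
      TensorProduct.map (N ∘ₗ (TensorProduct.mk k H H).flip t) (revMul Sinv m)
    let R : H ⊗[k] (H ⊗[k] H) →ₗ[k] H ⊗[k] (⨂[k]^m H) :=
      TensorProduct.map N (revMul Sinv m) ∘ₗ
        (TensorProduct.tensorTensorTensorComm k H H H H).toLinearMap ∘ₗ
        TensorProduct.map Coalgebra.comul (TensorProduct.comm k H H).toLinearMap
    have h3 : ∀ z : H ⊗[k] H, revMul Sinv (m + 1) z =
        insertAt 0 (R ((Coalgebra.comul (R := k)).lTensor H z)) := by
      intro z
      induction z using TensorProduct.induction_on with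
      | zero => simp
      | add x y hx hy => simp only [map_add, hx, hy]
      | tmul x y => rw [revMul_succ_tmul]; rfl
    have h4 : ∀ (z : H ⊗[k] H) (t : H), R (TensorProduct.assoc k H H H (z ⊗ₜ t)) =
        Q t (TensorProduct.assoc k H H H ((Coalgebra.comul (R := k)).rTensor H z)) := by
      intro z t
      induction z using TensorProduct.induction_on with
      | zero => simp
      | add x y hx hy => simp only [map_add, TensorProduct.add_tmul, hx, hy]
      | tmul x y =>
        simp only [R, TensorProduct.assoc_tmul, LinearMap.comp_apply, TensorProduct.map_tmul,
          LinearEquiv.coe_coe, TensorProduct.comm_tmul, LinearMap.rTensor_tmul]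
        generalize Coalgebra.comul (R := k) x = p
        induction p using TensorProduct.induction_on with
        | zero => simp
        | add x y hx hy => simp only [map_add, TensorProduct.add_tmul, hx, hy]
        | tmul x₁ x₂ => rfl
    -- The inner pair is collapsed here by the induction hypothesis, while the outer leg `t` is kept
    -- as a parameter.
    have h5 : ∀ (z : H ⊗[k] H) (t : H), Q t ((Coalgebra.comul (R := k)).lTensor H z) =
        N (TensorProduct.rid k H ((Coalgebra.counit (R := k)).lTensor H z) ⊗ₜ t) ⊗ₜ 1 := by
      intro z t
      induction z using TensorProduct.induction_on with
      | zero => simp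
      | add x y hx hy => simp only [map_add, TensorProduct.add_tmul, hx, hy]
      | tmul x y =>
        rw [LinearMap.lTensor_tmul, TensorProduct.map_tmul, ih]
        simp only [LinearMap.comp_apply, LinearMap.flip_apply, TensorProduct.mk_apply,
          LinearMap.lTensor_tmul, TensorProduct.rid_tmul, ← TensorProduct.smul_tmul', map_smul,
          TensorProduct.tmul_smul]
    have h6 : ∀ z : H ⊗[k] H, R (TensorProduct.assoc k H H H
        ((Coalgebra.comul (R := k)).rTensor H z)) = N z ⊗ₜ 1 := by
      intro z
      induction z using TensorProduct.induction_on with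
      | zero => simp
      | add x y hx hy => simp only [map_add, TensorProduct.add_tmul, hx, hy]
      | tmul x t =>
        rw [LinearMap.rTensor_tmul, h4, Coalgebra.coassoc_apply, h5,
          Coalgebra.lTensor_counit_comul, TensorProduct.rid_tmul, one_smul]
    rw [h3, ← Coalgebra.coassoc_apply, h6]
    simp only [N, LinearMap.comp_apply, LinearEquiv.coe_coe]
    rw [antipodeInv_mul_comul h₁ h₂, ← TensorProduct.smul_tmul', map_smul,
      ← Algebra.TensorProduct.one_def, insertAt_one]

/-- With `u = w · h`, where `w` is the tensor of the `cᵢ`, the image is the class of `a₍₀₎ ⊗ u ·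
S⁻¹(a₍₁₎)`, with reversed legs. Letting `a₍₀₎` act from the right instead of the left multiplies
these legs by the diagonal legs of the new `a₍₁₎`, and `revMul_comul` cancels them, leaving `a ⊗ u`.
-/
lemma coringEquivHopf_psiFormula (h₁ : Sinv ∘ₗ HopfAlgebra.antipode k = LinearMap.id)
    (h₂ : HopfAlgebra.antipode k ∘ₗ Sinv = LinearMap.id) (c : Fin (n + 1) → C) (h : H) (a : A) :
    coringEquivHopf k H A C n (psiFormula k H A C Sinv n c h a) =
      hopfMk k H A C n (PiTensorProduct.tprod k c) ((coeffRel k H A).mkQ (h ⊗ₜ[k] a)) := by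
  rw [hopfMk_mkQ, coringEquivHopf_apply, psiFormula]
  set u := diagAct k H C (n + 1) h (PiTensorProduct.tprod k c)
  let L : A ⊗[k] (H ⊗[k] H) →ₗ[k] A ⊗[k] (⨂[k]^(n + 1) C) :=
    (tensorAct k H C (n + 1) u ∘ₗ revMul Sinv (n + 1)).lTensor A
  have h3 : ∀ q : A ⊗[k] H, L ((Coalgebra.comul (R := k)).lTensor A q) =
      TensorProduct.rid k A ((Coalgebra.counit (R := k)).lTensor A q) ⊗ₜ u := by
    intro q
    induction q using TensorProduct.induction_on with
    | zero => simp
    | add x y hx hy => simp only [map_add, TensorProduct.add_tmul, hx, hy]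
    | tmul b g =>
      simp only [L, LinearMap.lTensor_tmul, LinearMap.comp_apply, revMul_comul h₁ h₂, map_smul,
        tensorAct_one, TensorProduct.rid_tmul, TensorProduct.smul_tmul]
  -- The simple element is expanded, rather than the complicated one contracted, so that both sides
  -- become linear in the outer coaction of `a`.
  have h4 : a ⊗ₜ u = L (TensorProduct.assoc k A H H ((coact k H A).rTensor H (coact k H A a))) := by
    rw [coact_coassoc, h3, coact_counit]
  rw [h4]
  generalize coact k H A a = q
  induction q using TensorProduct.induction_on with
  | zero => simp
  | add x y hx hy => simp only [map_add, hx, hy]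
  | tmul b g =>
    change coringToHopf k H A C n (coringMk (galoisCoring k H A C) n
      (PiTensorProduct.map (fun _ => TensorProduct.mk k A C 1)
        (tensorAct k H C (n + 1) u (revMap Sinv (n + 1) (iterComul k H (n + 1) g)))) b) = _
    rw [coringToHopf_mk_map, LinearMap.rTensor_tmul]
    -- The intermediate element has `b` acting from the right on coefficient `1`. `toHopf` does not
    -- distinguish it from left multiplication by `b`, and it supplies the second coaction.
    refine Eq.trans (b := toHopf k H A C n (diagRight k H A C (n + 1) b (1 ⊗ₜ
      tensorAct k H C (n + 1) u (revMap Sinv (n + 1) (iterComul k H (n + 1) g))))) ?_ ?_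
    · rw [toHopf_diagRight, LinearMap.rTensor_tmul, LinearMap.mulLeft_apply, mul_one]
    · rw [diagRight_tmul]
      generalize coact k H A b = r
      induction r using TensorProduct.induction_on with
      | zero => simp
      | add x y hx hy => simp only [map_add, TensorProduct.add_tmul, hx, hy]
      | tmul x y =>
        simp only [TensorProduct.map_tmul, LinearMap.mulLeft_apply, one_mul, diagActBilin_apply,
          diagAct, LinearMap.flip_apply, TensorProduct.assoc_tmul, L, LinearMap.lTensor_tmul,
          LinearMap.comp_apply, revMul_tmul, tensorAct_mul]

end Formulas

end HopfCyclic

end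

theorem theorem3p6 {k H A C : Type*} [Field k] [Ring H] [HopfAlgebra k H] [Ring A] [Algebra k A]
    [HopfCyclic.RightComoduleAlgebra k H A] [AddCommGroup C] [Module k C] [Coalgebra k C]
    [HopfCyclic.RightModuleCoalgebra k H C] :
    HopfCyclic.IsCyclicModule
      (HopfCyclic.coringFace (HopfCyclic.galoisCoring k H A C))
      (HopfCyclic.coringDegeneracy (HopfCyclic.galoisCoring k H A C))
      (HopfCyclic.coringCyc (HopfCyclic.galoisCoring k H A C)) ∧
    HopfCyclic.IsCyclicModule (HopfCyclic.hopfFace k H A C) (HopfCyclic.hopfDegeneracy k H A C)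
      (HopfCyclic.hopfCyc k H A C) ∧
    ∃ Φ : ∀ n : ℕ, HopfCyclic.CoringCyclic (HopfCyclic.galoisCoring k H A C) n ≃ₗ[k]
        HopfCyclic.HopfCyclicModule k H A C n,
      (∀ (n : ℕ) (i : Fin (n + 2))
          (x : HopfCyclic.CoringCyclic (HopfCyclic.galoisCoring k H A C) (n + 1)),
        Φ n (HopfCyclic.coringFace (HopfCyclic.galoisCoring k H A C) n i x) =
          HopfCyclic.hopfFace k H A C n i (Φ (n + 1) x)) ∧
      (∀ (n : ℕ) (j : Fin (n + 1))
          (x : HopfCyclic.CoringCyclic (HopfCyclic.galoisCoring k H A C) n),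
        Φ (n + 1) (HopfCyclic.coringDegeneracy (HopfCyclic.galoisCoring k H A C) n j x) =
          HopfCyclic.hopfDegeneracy k H A C n j (Φ n x)) ∧
      (∀ (n : ℕ) (x : HopfCyclic.CoringCyclic (HopfCyclic.galoisCoring k H A C) n),
        Φ n (HopfCyclic.coringCyc (HopfCyclic.galoisCoring k H A C) n x) =
          HopfCyclic.hopfCyc k H A C n (Φ n x)) ∧
      (∀ (n : ℕ) (a : Fin (n + 1) → A) (c : Fin (n + 1) → C),
        Φ n (HopfCyclic.coringMk (HopfCyclic.galoisCoring k H A C) n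
            (PiTensorProduct.tprod k fun i => a i ⊗ₜ[k] c i) 1) =
          HopfCyclic.phiFormula k H A C n a c) ∧
      (∀ Sinv : H →ₗ[k] H, Sinv ∘ₗ HopfAlgebra.antipode k = LinearMap.id →
        HopfAlgebra.antipode k ∘ₗ Sinv = LinearMap.id →
        ∀ (n : ℕ) (c : Fin (n + 1) → C) (h : H) (a : A),
          (Φ n).symm (HopfCyclic.hopfMk k H A C n (PiTensorProduct.tprod k c)
              ((HopfCyclic.coeffRel k H A).mkQ (h ⊗ₜ[k] a))) =
            HopfCyclic.psiFormula k H A C Sinv n c h a) := by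
  exact ⟨HopfCyclic.isCyclicModule_coringCyclic, HopfCyclic.isCyclicModule_hopfCyclicModule,
    HopfCyclic.coringEquivHopf k H A C, fun _ => HopfCyclic.coringEquivHopf_face,
    fun _ => HopfCyclic.coringEquivHopf_degeneracy, fun _ => HopfCyclic.coringEquivHopf_cyc,
    fun _ => HopfCyclic.coringEquivHopf_tprod, fun Sinv h₁ h₂ n c h a =>
      (LinearEquiv.symm_apply_eq _).2 (HopfCyclic.coringEquivHopf_psiFormula h₁ h₂ c h a).symm⟩
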